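/- For partitions $\nu$ of $n$ and $\mu$ of $m$, let $s_\nu\circ s_\mu$ denote the plethysm of the Schur functions $s_\nu$ and $s_\mu$, and define the plethysm coefficients $p^\lambda_{\nu,\mu}\in\mathbb{Z}$ by $s_\nu\circ s_\mu=\sum_{\lambda\vdash mn}p^\lambda_{\nu,\mu}\,s_\lambda$. For partitions $\lambda,\theta$ put $\lambda+\theta=(\lambda_1+\theta_1,\lambda_2+\theta_2,\ldots)$. Let $m$ be even, let $a\geq 2$, and let $\lambda=(\lambda_1,\ldots,\lambda_\ell)$ be a partition of $mn$. (1) If $\lambda$ has fewer than $2m$ parts, then $$p^\lambda_{(n),(1^m)}\leq p^{\lambda+(1^{am})}_{(n+a),(1^m)}.$$ (2) Equivalently (by conjugating partitions), if $\lambda_1<2m$ and $\tilde\lambda:=(am,\lambda_1,\ldots,\lambda_\ell)$, then $$p^\lambda_{(n),(m)}\leq p^{\tilde\lambda}_{(n+a),(m)}.$$ -/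

import Mathlib

/-! Partitions are Young diagrams: `lam.rowLen i` is the part `lam_{i+1}`, `lam.colLen 0` is the number
of (nonzero) parts, `lam.card` is the size. -/

namespace Pleth

/-- The partition `(n)` with one part (the empty partition if `n = 0`). -/
def oneRow (n : ℕ) : YoungDiagram :=
  YoungDiagram.ofRowLens [n] (List.pairwise_singleton _ n).sortedGE

/-- The partition `(1^m)`. -/
def oneCol (m : ℕ) : YoungDiagram :=
  YoungDiagram.ofRowLens (List.replicate m 1) (List.Pairwise.sortedGE (List.pairwise_replicate.2 (Or.inr (le_refl 1))))

/-- The sum of partitions `lam + th = (lam_1 + th_1, lam_2 + th_2, ...)`. -/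
def addParts (lam th : YoungDiagram) : YoungDiagram :=
  YoungDiagram.ofRowLens
    ((List.range (max (lam.colLen 0) (th.colLen 0))).map fun i => lam.rowLen i + th.rowLen i)
    (by
      refine List.Pairwise.sortedGE (List.pairwise_map.2 (List.pairwise_lt_range.imp ?_))
      intro i j hij
      exact add_le_add (lam.rowLen_anti i j hij.le) (th.rowLen_anti i j hij.le))

/-- The partition `(k, lam_1, lam_2, ...)`, for `lam_1 ≤ k`. -/
def consPart (k : ℕ) (lam : YoungDiagram) (h : lam.rowLen 0 ≤ k) : YoungDiagram :=
  YoungDiagram.ofRowLens (k :: lam.rowLens)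
    (by
      refine List.Pairwise.sortedGE (List.pairwise_cons.2 ⟨fun x hx => ?_, lam.rowLens_sorted.pairwise⟩)
      simp only [YoungDiagram.rowLens, List.mem_map, List.mem_range] at hx
      obtain ⟨i, -, rfl⟩ := hx
      exact (lam.rowLen_anti 0 i (Nat.zero_le i)).trans h)

/-- The content of a semistandard tableau `T`: the exponent of the monomial `x^T`. -/
noncomputable def content {lam : YoungDiagram} (T : SemistandardYoungTableau lam) : ℕ →₀ ℕ :=
  ∑ c ∈ lam.cells, Finsupp.single (T c.1 c.2) 1

/-- The Schur function `s_lam = ∑_T x^T`, in the variables `x_0, x_1, x_2, ...`: the coefficient of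
a monomial is the (finite) number of semistandard tableaux of shape `lam` with that content. -/
noncomputable def schur (lam : YoungDiagram) : MvPowerSeries ℕ ℕ :=
  fun d => Nat.card {T : SemistandardYoungTableau lam // content T = d}

/-- The monomials of `g`, each listed as many times as its coefficient says. -/
abbrev MonomialIndex (g : MvPowerSeries ℕ ℕ) : Type :=
  Σ α : ℕ →₀ ℕ, Fin (MvPowerSeries.coeff α g)

/-- An enumeration of the monomials of `g`, that is, a bijection with a set of variables `y_i`. -/
noncomputable def enumIndex (g : MvPowerSeries ℕ ℕ) : MonomialIndex g → ℕ :=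
  (exists_injective_nat (MonomialIndex g)).choose

/-- The plethysm `f ∘ g` of a homogeneous symmetric function `f` with a symmetric function `g` with
nonnegative integer coefficients: the variables of `f` are replaced by the monomials of `g`, each
taken as many times as its coefficient in `g` says (and variables in excess, if there are any, by
zero). The coefficient of `x^d` collects the monomials `∏ y^(k y)` of `f` that become `x^d`. As `f`
is symmetric, it does not matter how the monomials are matched with the variables. -/
noncomputable def plethysm (f g : MvPowerSeries ℕ ℕ) : MvPowerSeries ℕ ℕ :=
  fun d => ∑ᶠ (k : MonomialIndex g →₀ ℕ) (_ : (k.sum fun y e => e • y.1) = d),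
    MvPowerSeries.coeff (k.mapDomain (enumIndex g)) f

/-- `f = ∑_lam c_lam s_lam`, a finite linear combination with integer coefficients. -/
def IsSchurExpansion (f : MvPowerSeries ℕ ℕ) (c : YoungDiagram →₀ ℤ) : Prop :=
  MvPowerSeries.map (Nat.castRingHom ℤ) f =
    c.sum fun lam z => z • MvPowerSeries.map (Nat.castRingHom ℤ) (schur lam)

open Classical in
/-- The plethysm coefficient `p^lam_{nu,mu}`: the coefficient of `s_lam` in the expansion of
`s_nu ∘ s_mu` in Schur functions. (There is exactly one such expansion; the uniqueness is
`IsSchurExpansion.unique` below.) -/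
noncomputable def plethysmCoeff (lam nu mu : YoungDiagram) : ℤ :=
  if h : ∃ c, IsSchurExpansion (plethysm (schur nu) (schur mu)) c then h.choose lam else 0

/-! ### Schur functions are linearly independent -/

theorem entry_ge {lam : YoungDiagram} (T : SemistandardYoungTableau lam) :
    ∀ i j, (i, j) ∈ lam → i ≤ T i j := by
  intro i
  induction i with
  | zero => intro j _; exact Nat.zero_le _
  | succ i ih =>
    intro j h
    have h1 : (i, j) ∈ lam := lam.up_left_mem (Nat.le_succ i) le_rfl h
    exact Nat.succ_le_of_lt ((ih j h1).trans_lt (T.col_strict (Nat.lt_succ_self i) h))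

theorem content_apply {lam : YoungDiagram} (T : SemistandardYoungTableau lam) (v : ℕ) :
    content T v = (lam.cells.filter fun c => T c.1 c.2 = v).card := by
  rw [content, Finsupp.finsetSum_apply, Finset.card_filter]
  simp only [Finsupp.single_apply]

theorem finite_content (lam : YoungDiagram) (d : ℕ →₀ ℕ) :
    Finite {T : SemistandardYoungTableau lam // content T = d} := by
  have key : ∀ T : {T : SemistandardYoungTableau lam // content T = d}, ∀ c : lam.cells,
      T.1 c.1.1 c.1.2 ∈ d.support := by
    rintro ⟨T, rfl⟩ ⟨c, hc⟩
    rw [Finsupp.mem_support_iff, content_apply]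
    exact Finset.card_ne_zero_of_mem (a := c) (Finset.mem_filter.2 ⟨hc, rfl⟩)
  refine Finite.of_injective
    (fun T (c : lam.cells) => (⟨T.1 c.1.1 c.1.2, key T c⟩ : d.support)) ?_
  intro T T' h
  refine Subtype.ext (SemistandardYoungTableau.ext fun i j => ?_)
  by_cases hc : (i, j) ∈ lam
  · have := congrFun h ⟨(i, j), (YoungDiagram.mem_cells _).2 hc⟩
    exact congrArg Subtype.val this
  · rw [T.1.zeros hc, T'.1.zeros hc]

/-- The sum of the first `k` parts. -/
def partialSum (lam : YoungDiagram) (k : ℕ) : ℕ :=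
  (lam.cells.filter fun c => c.1 < k).card

theorem partialSum_succ (lam : YoungDiagram) (k : ℕ) :
    partialSum lam (k + 1) = partialSum lam k + lam.rowLen k := by
  rw [YoungDiagram.rowLen_eq_card, partialSum, partialSum, YoungDiagram.row,
    ← Finset.card_union_of_disjoint]
  · congr 1
    ext c
    simp only [Finset.mem_filter, Finset.mem_union]
    have : c.1 < k + 1 ↔ c.1 < k ∨ c.1 = k := by omega
    tauto
  · rw [Finset.disjoint_filter]
    intro c _ h1 h2
    omega

theorem partialSum_injective : Function.Injective partialSum := by
  intro lam mu h
  have hr : ∀ i, lam.rowLen i = mu.rowLen i := by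
    intro i
    have h1 := partialSum_succ lam i
    have h2 := partialSum_succ mu i
    rw [h] at h1
    omega
  ext ⟨i, j⟩
  rw [YoungDiagram.mem_cells, YoungDiagram.mem_cells, YoungDiagram.mem_iff_lt_rowLen,
    YoungDiagram.mem_iff_lt_rowLen, hr]

theorem partialSum_le_of_content {lam mu : YoungDiagram} (T : SemistandardYoungTableau mu)
    (h : content T = content (SemistandardYoungTableau.highestWeight lam)) :
    partialSum lam ≤ partialSum mu := by
  have count : ∀ {nu : YoungDiagram} (S : SemistandardYoungTableau nu) (k : ℕ),
      (nu.cells.filter fun c => S c.1 c.2 < k).card = ∑ v ∈ Finset.range k, content S v := by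
    intro nu S k
    have hm : ∀ c ∈ nu.cells.filter (fun c => S c.1 c.2 < k), S c.1 c.2 ∈ Finset.range k := by
      intro c hc
      exact Finset.mem_range.2 (Finset.mem_filter.1 hc).2
    rw [Finset.card_eq_sum_card_fiberwise hm]
    refine Finset.sum_congr rfl fun v hv => ?_
    rw [content_apply, Finset.filter_filter]
    congr 1
    refine Finset.filter_congr fun c _ => ?_
    have := Finset.mem_range.1 hv
    constructor
    · exact fun h => h.2
    · exact fun h => ⟨by omega, h⟩
  intro k
  have h1 : partialSum lam k =
      (lam.cells.filter fun c => SemistandardYoungTableau.highestWeight lam c.1 c.2 < k).card := by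
    refine congrArg Finset.card (Finset.filter_congr fun c hc => ?_)
    rw [SemistandardYoungTableau.highestWeight_apply, if_pos ((YoungDiagram.mem_cells _).1 hc)]
  rw [h1, count, ← h, ← count]
  refine Finset.card_le_card fun c hc => ?_
  rw [Finset.mem_filter] at hc ⊢
  exact ⟨hc.1, (entry_ge T c.1 c.2 ((YoungDiagram.mem_cells _).1 hc.1)).trans_lt hc.2⟩

theorem schur_linearIndependent :
    LinearIndependent ℤ fun lam => MvPowerSeries.map (Nat.castRingHom ℤ) (schur lam) := by
  rw [linearIndependent_iff]
  intro c hc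
  by_contra hne
  obtain ⟨lam, hl, hmax⟩ := Finset.exists_max_image c.support
    (fun lam => (toLex fun i : ℕ => partialSum lam i : Lex (ℕ → ℕ)))
    (Finsupp.support_nonempty_iff.2 hne)
  have h0 := congrArg
    (MvPowerSeries.coeff (content (SemistandardYoungTableau.highestWeight lam))) hc
  rw [Finsupp.linearCombination_apply, Finsupp.sum, map_sum, map_zero,
    Finset.sum_eq_single_of_mem lam hl] at h0
  · have : Nonempty {T : SemistandardYoungTableau lam //
        content T = content (SemistandardYoungTableau.highestWeight lam)} := ⟨⟨_, rfl⟩⟩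
    have hfin := finite_content lam (content (SemistandardYoungTableau.highestWeight lam))
    have hpos := Nat.card_pos (α := {T : SemistandardYoungTableau lam //
        content T = content (SemistandardYoungTableau.highestWeight lam)})
    rw [map_zsmul, MvPowerSeries.coeff_map, smul_eq_mul, mul_eq_zero] at h0
    rcases h0 with h0 | h0
    · exact Finsupp.mem_support_iff.1 hl h0
    · exact hpos.ne' (Int.natCast_eq_zero.1 h0)
  · intro mu hmu hne'
    rw [map_zsmul, MvPowerSeries.coeff_map]
    have : IsEmpty {T : SemistandardYoungTableau mu //
        content T = content (SemistandardYoungTableau.highestWeight lam)} := by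
      refine ⟨fun T => hne' ?_⟩
      have h1 := partialSum_le_of_content T.1 T.2
      have h2 := hmax mu hmu
      exact partialSum_injective (toLex.injective (le_antisymm h2 (Pi.toLex_monotone h1)))
    have h3 : MvPowerSeries.coeff (content (SemistandardYoungTableau.highestWeight lam))
        (schur mu) = 0 := Nat.card_of_isEmpty
    rw [h3, map_zero, smul_zero]

theorem IsSchurExpansion.unique {f : MvPowerSeries ℕ ℕ} {c c' : YoungDiagram →₀ ℤ}
    (h : IsSchurExpansion f c) (h' : IsSchurExpansion f c') : c = c' := by
  refine schur_linearIndependent (?_ : Finsupp.linearCombination ℤ _ c = _)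
  rw [Finsupp.linearCombination_apply, Finsupp.linearCombination_apply]
  exact h.symm.trans h'

theorem plethysmCoeff_eq {nu mu : YoungDiagram} {c : YoungDiagram →₀ ℤ}
    (h : IsSchurExpansion (plethysm (schur nu) (schur mu)) c) (lam : YoungDiagram) :
    plethysmCoeff lam nu mu = c lam := by
  have hex : ∃ c, IsSchurExpansion (plethysm (schur nu) (schur mu)) c := ⟨c, h⟩
  rw [plethysmCoeff, dif_pos hex, hex.choose_spec.unique h]

theorem le_mul_of_lt_two_mul {a m k : ℕ} (ha : 2 ≤ a) (hk : k < 2 * m) : k ≤ a * m :=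
  hk.le.trans (Nat.mul_le_mul_right m ha)

end Pleth

/-!
For even `m`, both kinds of plethysm coefficients count highest weight vectors in the symmetric
algebra `R` of the `m`-th exterior power of the standard representation: the multiplicity of `lam` in
`h_n ∘ e_m` is the number `multiplicity m lam` of linearly independent highest weight vectors of weight
`lam` in `R`, and, by conjugation, the multiplicity of `lam` in `h_n ∘ h_m` is `multiplicity m lamᵗ`.
The algebra `R` is a polynomial ring, whose variables are the `m`-element sets of natural numbers, and
the raising operators act on it by derivations. Therefore products of highest weight vectors are
highest weight vectors, and multiplication by a nonzero one of weight `(1 ^ (a m))` is an injective map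
from those of weight `lam` to those of weight `lam + (1 ^ (a m))` (`multiplicity_le_addParts`).
A vector of weight `(1 ^ (a m))` exists because `h_a ∘ h_m` contains the monomial `x_0 ^ (a m)`, which occurs in no Schur function of
degree `a m` but that of a row (`multiplicity_oneCol_ne_zero`).

The only representation theory needed to expand the character of `R` in Schur functions is the
branching rule from `gl_{k+1}` to `gl_k` (`ContravariantModule.finrank_subHighest`). Iterated, it
says that the weight spaces of `R` are counted by highest weight vectors and chains of horizontal
strips (`finrank_eq_sum_stripCount`), and these chains are semistandard tableaux (`coeff_schur`).
The branching rule holds in any module with a positive contravariant form, here the apolar form on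
polynomials. Which words in the lowering operators lead from a highest weight vector of weight `ν`
to `gl_k`-highest weight vectors depends on `ν` only, since the form on the submodule generated by
such a vector is given by universal formulas (`ContravariantModule.act_eq_zero_iff`). So it suffices
to treat one module for each `ν`, and the one chosen is realized by polynomials in the entries of a
matrix which are invariant under unitriangular column operations. There the `gl_k`-highest weight
vectors are the products of minors `minorProduct`, one for each interlacing pair of weights, and
Gaussian elimination shows that there are no others (`eq_zero_of_coeff_normalMonomial`,
`le_of_coeff_normalMonomial`).

Conjugation (`superCount_true_eq_sum`) is carried out on coefficients. Multisets of monomials in even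
and odd letters interpolate between `h_n ∘ h_m` and `h_n ∘ e_m`; exchanging an even and an odd letter
in one block is a sign-reversing involution, which yields the relations `∑ (-1)^i h_{K-i} e_i = 0` in
these letters (`sum_superCount_eq_zero`). Chains of horizontal and vertical strips satisfy the same
relations (`sum_stripCount_eq_zero`), and the relations reduce everything to odd letters, where the
identity is the expansion of the character of `R` (`eq_of_eq_on_odd`). The parity of `m` enters here:
blocks of `m` odd letters commute only for even `m`.
-/

namespace Pleth

open MvPolynomial

/-! ### Modules with a positive contravariant form -/

/-- The `i`-th simple root, as a weight `ℕ → ℤ`. -/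
def root (i : ℕ) : ℕ → ℤ := Pi.single i 1 - Pi.single (i + 1) 1

/-- A weight module of `gl_{k+1}` with a positive definite contravariant form, over `ℚ`: raising
operators `E i` and lowering operators `F i` for the `k` simple roots, adjoint to each other,
finite-dimensional mutually orthogonal weight spaces, and nonnegative weights. Weights are functions
`ℕ → ℤ`, so that coordinates beyond `k` may record an action that commutes with `gl_{k+1}`. The
Serre relations are not needed, nor is it required that the weight spaces span. -/
structure ContravariantModule (k : ℕ) (U : Type*) [AddCommGroup U] [Module ℚ U] where
  E : Fin k → U →ₗ[ℚ] U
  F : Fin k → U →ₗ[ℚ] U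
  W : (ℕ → ℤ) → Submodule ℚ U
  form : LinearMap.BilinForm ℚ U
  form_symm : ∀ u v, form u v = form v u
  form_pos : ∀ u, u ≠ 0 → 0 < form u u
  form_orth : ∀ {d e u v}, d ≠ e → u ∈ W d → v ∈ W e → form u v = 0
  E_mem : ∀ {i : Fin k} {d u}, u ∈ W d → E i u ∈ W (d + root i)
  F_mem : ∀ {i : Fin k} {d u}, u ∈ W d → F i u ∈ W (d - root i)
  adj : ∀ i u v, form (E i u) v = form u (F i v)
  comm : ∀ {i j : Fin k} {d u}, u ∈ W d →
    E i (F j u) = F j (E i u) + if i = j then ((d i - d (i + 1) : ℤ) : ℚ) • u else 0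
  finite : ∀ d, FiniteDimensional ℚ (W d)
  nonneg : ∀ {d u}, u ∈ W d → u ≠ 0 → 0 ≤ d

/-- The sum of the simple roots of the letters of a word. -/
def wordWeight {k : ℕ} (w : List (Fin k)) : ℕ → ℤ := (w.map fun i => root i).sum

@[simp] theorem wordWeight_nil {k : ℕ} : wordWeight ([] : List (Fin k)) = 0 := rfl

@[simp] theorem wordWeight_cons {k : ℕ} (i : Fin k) (w : List (Fin k)) :
    wordWeight (i :: w) = root i + wordWeight w := by
  simp [wordWeight]

/-- Formal linear combinations of words in the lowering operators. -/
abbrev Words (k : ℕ) : Type := List (Fin k) →₀ ℚ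

/-- Left multiplication of words by the letter `j`. -/
noncomputable def consLetter {k : ℕ} (j : Fin k) : Words k →ₗ[ℚ] Words k :=
  Finsupp.lmapDomain ℚ ℚ (List.cons j)

/-- The raising operator on words `F_{j_1} F_{j_2} ⋯` applied to a highest weight vector `v`, computed
from the commutation relations. It depends only on the numbers `δ i = ν i - ν (i + 1)`, where `ν` is
the weight of `v`. -/
noncomputable def raiseWord {k : ℕ} (δ : Fin k → ℤ) (i : Fin k) : List (Fin k) → Words k
  | [] => 0
  | j :: w => consLetter j (raiseWord δ i w) +
      if i = j then ((δ i - (wordWeight w i - wordWeight w (i + 1)) : ℤ) : ℚ) • Finsupp.single w 1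
      else 0

/-- The linear extension of `raiseWord`. -/
noncomputable def raise {k : ℕ} (δ : Fin k → ℤ) (i : Fin k) : Words k →ₗ[ℚ] Words k :=
  Finsupp.linearCombination ℚ (raiseWord δ i)

/-- Apply the raising operators of the letters of a word, the first letter first. -/
noncomputable def raiseSeq {k : ℕ} (δ : Fin k → ℤ) : List (Fin k) → Words k →ₗ[ℚ] Words k
  | [] => LinearMap.id
  | j :: w => raiseSeq δ w ∘ₗ raise δ j

/-- The radical of the universal contravariant form: combinations of words which annihilate every
highest weight vector of a weight with differences `δ`, see `act_eq_zero_iff`. -/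
def Null {k : ℕ} (δ : Fin k → ℤ) (c : Words k) : Prop := ∀ w, raiseSeq δ w c [] = 0

/-- The differences `ν i - ν (i + 1)` of a weight. -/
def gaps (k : ℕ) (ν : ℕ → ℤ) : Fin k → ℤ := fun i => ν i - ν (i + 1)

namespace ContravariantModule

variable {k : ℕ} {U : Type*} [AddCommGroup U] [Module ℚ U] (M : ContravariantModule k U)

theorem eq_zero_of_form_self {u : U} (h : M.form u u = 0) : u = 0 := by
  by_contra hu
  exact (M.form_pos u hu).ne' h

theorem adj' (i : Fin k) (u v : U) : M.form (M.F i u) v = M.form u (M.E i v) := by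
  rw [M.form_symm, ← M.adj, M.form_symm]

/-- Orthogonal projection of `u` to a finite-dimensional subspace. -/
theorem exists_projection (S : Submodule ℚ U) [FiniteDimensional ℚ S] (u : U) :
    ∃ s ∈ S, ∀ x ∈ S, M.form x (u - s) = 0 := by
  have hinj : Function.Injective (M.form.restrict S : S →ₗ[ℚ] Module.Dual ℚ S) := by
    rw [injective_iff_map_eq_zero]
    intro x hx
    exact Subtype.ext (M.eq_zero_of_form_self (LinearMap.congr_fun hx x))
  obtain ⟨s, hs⟩ := (LinearMap.injective_iff_surjective_of_finrank_eq_finrank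
    Subspace.dual_finrank_eq.symm).1 hinj ((M.form u).domRestrict S)
  refine ⟨s, s.2, fun x hx => ?_⟩
  have h := LinearMap.congr_fun hs ⟨x, hx⟩
  rw [M.form_symm, map_sub, LinearMap.sub_apply, sub_eq_zero]
  exact h.symm

/-- The product of the lowering operators of the letters of a word. -/
noncomputable def lower (w : List (Fin k)) : U →ₗ[ℚ] U :=
  w.foldr (fun i f => M.F i ∘ₗ f) LinearMap.id

@[simp] theorem lower_nil (u : U) : M.lower [] u = u := rfl

@[simp] theorem lower_cons (i : Fin k) (w : List (Fin k)) (u : U) :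
    M.lower (i :: w) u = M.F i (M.lower w u) := rfl

/-- The action of linear combinations of words. -/
noncomputable def act : Words k →ₗ[ℚ] U →ₗ[ℚ] U := Finsupp.linearCombination ℚ M.lower

theorem act_single (w : List (Fin k)) (q : ℚ) (u : U) :
    M.act (Finsupp.single w q) u = q • M.lower w u := by
  simp [act]

theorem act_cons (j : Fin k) (c : Words k) (u : U) :
    M.act (consLetter j c) u = M.F j (M.act c u) := by
  induction c using Finsupp.induction_linear with
  | zero => simp
  | add a b ha hb => simp [ha, hb]
  | single w q =>
    rw [consLetter, Finsupp.lmapDomain_apply, Finsupp.mapDomain_single, act_single, act_single,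
      lower_cons, map_smul]

theorem lower_mem {d : ℕ → ℤ} {u : U} (hu : u ∈ M.W d) (w : List (Fin k)) :
    M.lower w u ∈ M.W (d - wordWeight w) := by
  induction w with
  | nil => simpa using hu
  | cons i w ih =>
    have := M.F_mem (i := i) ih
    rwa [sub_sub, add_comm, ← wordWeight_cons] at this

theorem E_lower {ν : ℕ → ℤ} {v : U} (hv : v ∈ M.W ν) (hE : ∀ i, M.E i v = 0) (i : Fin k)
    (w : List (Fin k)) : M.E i (M.lower w v) = M.act (raiseWord (gaps k ν) i w) v := by
  induction w with
  | nil => simp [raiseWord, hE]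
  | cons j w ih =>
    rw [lower_cons, M.comm (M.lower_mem hv w), ih, raiseWord, map_add, LinearMap.add_apply,
      act_cons]
    congr 1
    split_ifs with h
    · rw [map_smul, LinearMap.smul_apply, act_single, one_smul]
      congr 2
      simp only [gaps, Pi.sub_apply]
      ring
    · simp

theorem E_act {ν : ℕ → ℤ} {v : U} (hv : v ∈ M.W ν) (hE : ∀ i, M.E i v = 0) (i : Fin k)
    (c : Words k) : M.E i (M.act c v) = M.act (raise (gaps k ν) i c) v := by
  induction c using Finsupp.induction_linear with
  | zero => simp
  | add a b ha hb => simp [ha, hb]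
  | single w q =>
    rw [act_single, map_smul, M.E_lower hv hE, raise, Finsupp.linearCombination_single, map_smul,
      LinearMap.smul_apply]

theorem form_act_of_highest {v v' : U} (hE : ∀ i, M.E i v = 0) (c : Words k) :
    M.form v (M.act c v') = c [] * M.form v v' := by
  induction c using Finsupp.induction_linear with
  | zero => simp
  | add a b ha hb => simp [ha, hb, add_mul]
  | single w q =>
    rw [act_single, map_smul]
    cases w with
    | nil => simp
    | cons j w => simp [← M.adj, hE]

/-- Scalar products in the submodule generated by a highest weight vector are computed from its weight
and norm by a universal formula. -/
theorem form_lower_act {ν : ℕ → ℤ} {v v' : U} (hE : ∀ i, M.E i v = 0) (hv' : v' ∈ M.W ν)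
    (hE' : ∀ i, M.E i v' = 0) (w : List (Fin k)) (c : Words k) :
    M.form (M.lower w v) (M.act c v') = raiseSeq (gaps k ν) w c [] * M.form v v' := by
  induction w generalizing c with
  | nil => exact M.form_act_of_highest hE c
  | cons j w ih => rw [lower_cons, adj', M.E_act hv' hE', ih]; rfl

theorem act_mem_span (c : Words k) (v : U) :
    M.act c v ∈ Submodule.span ℚ (Set.range fun w => M.lower w v) := by
  induction c using Finsupp.induction_linear with
  | zero => simp
  | add a b ha hb => simpa using Submodule.add_mem _ ha hb
  | single w q =>
    rw [act_single]
    exact Submodule.smul_mem _ _ (Submodule.subset_span ⟨w, rfl⟩)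

theorem eq_zero_of_orthogonal_lower {c : Words k} {v : U}
    (h : ∀ w, M.form (M.lower w v) (M.act c v) = 0) : M.act c v = 0 := by
  refine M.eq_zero_of_form_self ?_
  have : ∀ x ∈ Submodule.span ℚ (Set.range fun w => M.lower w v), M.form x (M.act c v) = 0 := by
    intro x hx
    induction hx using Submodule.span_induction with
    | mem x hx => obtain ⟨w, rfl⟩ := hx; exact h w
    | zero => simp
    | add x y _ _ hx hy => simp [hx, hy]
    | smul a x _ hx => simp [hx]
  exact this _ (M.act_mem_span c v)

/-- Which combinations of words annihilate a highest weight vector depends only on its weight: the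
vectors `act c v` are determined by their scalar products with the `lower w v`, and these are
universal. -/
theorem act_eq_zero_iff {ν : ℕ → ℤ} {v : U} (hv : v ∈ M.W ν) (hE : ∀ i, M.E i v = 0)
    (h0 : v ≠ 0) (c : Words k) : M.act c v = 0 ↔ Null (gaps k ν) c := by
  constructor
  · intro h w
    have := M.form_lower_act hE hv hE w c
    rw [h, map_zero] at this
    exact (mul_eq_zero.1 this.symm).resolve_right (M.form_pos v h0).ne'
  · intro h
    refine M.eq_zero_of_orthogonal_lower fun w => ?_
    rw [M.form_lower_act hE hv hE, h w, zero_mul]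

/-- The highest weight vectors of weight `ν`. -/
def highest (ν : ℕ → ℤ) : Submodule ℚ U := M.W ν ⊓ ⨅ i, LinearMap.ker (M.E i)

/-- The vectors of weight `ν` which are highest weight vectors for `gl_k`, that is, which are killed
by all raising operators but the last. -/
def subHighest (ν : ℕ → ℤ) : Submodule ℚ U :=
  M.W ν ⊓ ⨅ i : {i : Fin k // (i : ℕ) + 1 < k}, LinearMap.ker (M.E i)

theorem mem_highest {ν : ℕ → ℤ} {v : U} : v ∈ M.highest ν ↔ v ∈ M.W ν ∧ ∀ i, M.E i v = 0 := by
  simp [highest]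

theorem mem_subHighest {ν : ℕ → ℤ} {v : U} :
    v ∈ M.subHighest ν ↔ v ∈ M.W ν ∧ ∀ i : Fin k, (i : ℕ) + 1 < k → M.E i v = 0 := by
  simp [subHighest]

instance (ν : ℕ → ℤ) : FiniteDimensional ℚ (M.W ν) := M.finite ν

instance (ν : ℕ → ℤ) : FiniteDimensional ℚ (M.highest ν) :=
  Submodule.finiteDimensional_of_le inf_le_left

instance (ν : ℕ → ℤ) : FiniteDimensional ℚ (M.subHighest ν) :=
  Submodule.finiteDimensional_of_le inf_le_left

theorem form_act_act_eq_zero {ν ν' : ℕ → ℤ} (h : ν ≠ ν') {v v' : U} (hv : v ∈ M.highest ν)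
    (hv' : v' ∈ M.highest ν') (c c' : Words k) : M.form (M.act c v) (M.act c' v') = 0 := by
  rw [mem_highest] at hv hv'
  induction c using Finsupp.induction_linear with
  | zero => simp
  | add a b ha hb => simp [ha, hb]
  | single w q =>
    rw [act_single, map_smul, LinearMap.smul_apply, M.form_lower_act hv.2 hv'.1 hv'.2,
      M.form_orth h hv.1 hv'.1, mul_zero, smul_zero]

/-- A highest weight is dominant, since `‖F i v‖² = (ν i - ν (i + 1)) ‖v‖²`. -/
theorem dominant {ν : ℕ → ℤ} {v : U} (hv : v ∈ M.highest ν) (h0 : v ≠ 0) (i : Fin k) :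
    ν (i + 1) ≤ ν i := by
  rw [mem_highest] at hv
  have h1 : M.form (M.F i v) (M.F i v) = ((ν i - ν (i + 1) : ℤ) : ℚ) * M.form v v := by
    rw [adj', M.comm hv.1, hv.2, map_zero, zero_add, if_pos rfl, map_smul, smul_eq_mul]
  have h2 : 0 ≤ M.form (M.F i v) (M.F i v) := by
    by_cases h : M.F i v = 0
    · rw [h]; simp
    · exact (M.form_pos _ h).le
  rw [h1] at h2
  have h3 := nonneg_of_mul_nonneg_left h2 (M.form_pos v h0)
  have h4 : (0 : ℤ) ≤ ν i - ν (i + 1) := by exact_mod_cast h3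
  linarith

/-- A measure of weights which drops under raising operators. -/
def depth (k : ℕ) (e : ℕ → ℤ) : ℤ := ∑ j ∈ Finset.range (k + 1), (j : ℤ) * e j

theorem depth_add_root (e : ℕ → ℤ) (i : Fin k) : depth k (e + root i) = depth k e - 1 := by
  have h1 : (i : ℕ) < k + 1 := by omega
  have h2 : (i : ℕ) + 1 < k + 1 := by omega
  simp only [depth, root, Pi.add_apply, Pi.sub_apply, mul_add, mul_sub, Finset.sum_add_distrib,
    Finset.sum_sub_distrib, Pi.single_apply, mul_ite, mul_one, mul_zero, Finset.sum_ite_eq',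
    Finset.mem_range, h1, h2, if_true]
  push_cast
  ring

theorem depth_nonneg {e : ℕ → ℤ} (h : 0 ≤ e) : 0 ≤ depth k e :=
  Finset.sum_nonneg fun j _ => mul_nonneg (Int.natCast_nonneg j) (h j)

/-- The vectors obtained from the highest weight vectors of `C` by words of lowering operators that
end up in weight `e`. -/
def generated (C : Submodule ℚ U) (e : ℕ → ℤ) : Submodule ℚ U :=
  Submodule.span ℚ {u | ∃ ν, ∃ v ∈ M.highest ν ⊓ C, ∃ w, ν - wordWeight w = e ∧ M.lower w v = u}

theorem F_mem_generated {C : Submodule ℚ U} {e : ℕ → ℤ} (i : Fin k) {u : U}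
    (hu : u ∈ M.generated C e) : M.F i u ∈ M.generated C (e - root i) := by
  induction hu using Submodule.span_induction with
  | mem u hu =>
    obtain ⟨ν, v, hv, w, rfl, rfl⟩ := hu
    exact Submodule.subset_span ⟨ν, v, hv, i :: w, by rw [wordWeight_cons]; abel, rfl⟩
  | zero => simp
  | add x y _ _ hx hy => simpa using Submodule.add_mem _ hx hy
  | smul a x _ hx => simpa using Submodule.smul_mem _ a hx

/-- Complete reducibility: a stable subspace is generated by its highest weight vectors. -/
theorem mem_generated {C : Submodule ℚ U} (hCE : ∀ i, ∀ u ∈ C, M.E i u ∈ C)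
    (hCF : ∀ i, ∀ u ∈ C, M.F i u ∈ C) {e : ℕ → ℤ} {u : U} (hu : u ∈ M.W e) (huC : u ∈ C) :
    u ∈ M.generated C e := by
  by_cases h0 : u = 0
  · rw [h0]; exact Submodule.zero_mem _
  obtain ⟨n, hn⟩ := Int.eq_ofNat_of_zero_le (depth_nonneg (k := k) (M.nonneg hu h0))
  induction n using Nat.strong_induction_on generalizing e u with
  | _ n ih =>
    set S : Submodule ℚ U := ⨆ i : Fin k, (M.W (e + root i) ⊓ C).map (M.F i) with hS
    have hSW : S ≤ M.W e ⊓ C := by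
      refine iSup_le fun i => ?_
      rintro _ ⟨x, ⟨hx, hxC⟩, rfl⟩
      refine ⟨?_, hCF i x hxC⟩
      simpa using M.F_mem (i := i) hx
    have : FiniteDimensional ℚ S := Submodule.finiteDimensional_of_le (hSW.trans inf_le_left)
    have hSg : S ≤ M.generated C e := by
      refine iSup_le fun i => ?_
      rintro _ ⟨x, ⟨hx, hxC⟩, rfl⟩
      by_cases hx0 : x = 0
      · simp [hx0]
      have hd := depth_add_root e i
      have hd' := depth_nonneg (k := k) (M.nonneg hx hx0)
      have := M.F_mem_generated i (ih (n - 1) (by omega) hx hxC hx0 (by omega))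
      simpa using this
    obtain ⟨s, hs, hperp⟩ := M.exists_projection S u
    -- `u - s` is orthogonal to the images of the lowering operators, hence killed by their adjoints
    have hW := Submodule.sub_mem _ hu (hSW hs).1
    have hC := Submodule.sub_mem _ huC (hSW hs).2
    have hhigh : u - s ∈ M.generated C e := by
      refine Submodule.subset_span ⟨e, u - s, ⟨M.mem_highest.2 ⟨hW, fun i => ?_⟩, hC⟩, [], by simp,
        rfl⟩
      refine M.eq_zero_of_form_self ?_
      rw [← M.adj']
      exact hperp _ (le_iSup (fun i : Fin k => (M.W (e + root i) ⊓ C).map (M.F i)) i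
        ⟨_, ⟨M.E_mem hW, hCE i _ hC⟩, rfl⟩)
    have := Submodule.add_mem _ hhigh (hSg hs)
    simpa using this

end ContravariantModule

/-- The weights `ν` and `e` interlace in the coordinates up to `k`, `ν 0 ≥ e 0 ≥ ν 1 ≥ ⋯ ≥ ν k ≥ 0`,
have the same sum there, and agree beyond. -/
def Interlace (k : ℕ) (ν e : ℕ → ℤ) : Prop :=
  (∀ j < k, ν (j + 1) ≤ e j ∧ e j ≤ ν j) ∧ 0 ≤ ν k ∧ (∀ j, k < j → ν j = e j) ∧
    ∑ j ∈ Finset.range (k + 1), ν j = ∑ j ∈ Finset.range (k + 1), e j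

/-- The combinations of words which send a highest weight vector of weight `ν` to a `gl_k`-highest
weight vector of weight `e`. -/
def Admissible (k : ℕ) (ν e : ℕ → ℤ) (c : Words k) : Prop :=
  c ∈ Finsupp.supported ℚ ℚ {w | ν - wordWeight w = e} ∧
    ∀ i : Fin k, (i : ℕ) + 1 < k → Null (gaps k ν) (raise (gaps k ν) i c)

/-! ### Polynomial rings with derivations permuting the variables -/

section Apolar

variable {σ : Type*}

/-- The product of the factorials of the exponents, the norm of a monomial in the apolar form. -/
noncomputable def multiFactorial (a : σ →₀ ℕ) : ℚ := a.prod fun _ n => (n.factorial : ℚ)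

theorem multiFactorial_pos (a : σ →₀ ℕ) : 0 < multiFactorial a :=
  Finset.prod_pos fun _ _ => by positivity

theorem multiFactorial_add_single (a : σ →₀ ℕ) (s : σ) :
    multiFactorial (a + Finsupp.single s 1) = (a s + 1) * multiFactorial a := by
  classical
  have h0 : ∀ _ : σ, ((Nat.factorial 0 : ℕ) : ℚ) = 1 := fun _ => by simp
  rw [multiFactorial, ← Finsupp.mul_prod_erase' _ s _ h0, multiFactorial,
    ← Finsupp.mul_prod_erase' a s _ h0]
  have : Finsupp.erase s (a + Finsupp.single s 1) = Finsupp.erase s a := by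
    rw [Finsupp.erase_add, Finsupp.erase_single, add_zero]
  rw [this, Finsupp.add_apply, Finsupp.single_eq_same, Nat.factorial_succ]
  push_cast
  ring

/-- The apolar form on polynomials: distinct monomials are orthogonal, and the norm of `x ^ a` is
`a!`. Multiplication by a variable is adjoint to the corresponding partial derivative. -/
noncomputable def apolar : LinearMap.BilinForm ℚ (MvPolynomial σ ℚ) :=
  (basisMonomials σ ℚ).constr ℚ fun a => multiFactorial a • lcoeff ℚ a

theorem apolar_monomial (a : σ →₀ ℕ) (c : ℚ) (g : MvPolynomial σ ℚ) :
    apolar (monomial a c) g = c * (multiFactorial a * coeff a g) := by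
  have : monomial a c = c • basisMonomials σ ℚ a := by simp [smul_monomial]
  rw [this, map_smul, apolar, Module.Basis.constr_basis]
  simp

theorem apolar_apply (f g : MvPolynomial σ ℚ) :
    apolar f g = ∑ a ∈ f.support, multiFactorial a * (coeff a f * coeff a g) := by
  conv_lhs => rw [f.as_sum]
  rw [map_sum, LinearMap.sum_apply]
  refine Finset.sum_congr rfl fun a _ => ?_
  rw [apolar_monomial]
  ring

theorem apolar_symm (f g : MvPolynomial σ ℚ) : apolar f g = apolar g f := by
  classical
  rw [apolar_apply, apolar_apply]
  rw [Finset.sum_subset (Finset.subset_union_left (s₂ := g.support)),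
    Finset.sum_subset (Finset.subset_union_right (s₁ := f.support) (s₂ := g.support))]
  · exact Finset.sum_congr rfl fun a _ => by ring
  · intro a _ ha
    rw [notMem_support_iff.1 ha]; ring
  · intro a _ ha
    rw [notMem_support_iff.1 ha]; ring

theorem apolar_pos {f : MvPolynomial σ ℚ} (hf : f ≠ 0) : 0 < apolar f f := by
  rw [apolar_apply]
  refine Finset.sum_pos (fun a ha => ?_) (Finsupp.support_nonempty_iff.2 (by simpa using hf))
  exact mul_pos (multiFactorial_pos a) (mul_self_pos.2 (mem_support_iff.1 ha))

theorem apolar_X_mul (s : σ) (f g : MvPolynomial σ ℚ) :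
    apolar (X s * f) g = apolar f (pderiv s g) := by
  induction f using MvPolynomial.induction_on' with
  | add p q hp hq => rw [mul_add, map_add, map_add, LinearMap.add_apply, LinearMap.add_apply, hp, hq]
  | monomial a c =>
    rw [X, monomial_mul, one_mul, add_comm, apolar_monomial, apolar_monomial, coeff_pderiv,
      multiFactorial_add_single]
    ring

/-- The variable with a given index, or zero. -/
noncomputable def optX (o : Option σ) : MvPolynomial σ ℚ := o.elim 0 X

@[simp] theorem optX_none : optX (none : Option σ) = 0 := rfl

@[simp] theorem optX_some (s : σ) : optX (some s) = X s := rfl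

/-- The derivation which moves the variables along a partial injection. -/
noncomputable def shift (p : σ ≃. σ) : Derivation ℚ (MvPolynomial σ ℚ) (MvPolynomial σ ℚ) :=
  mkDerivation ℚ fun s => optX (p s)

@[simp] theorem shift_X (p : σ ≃. σ) (s : σ) : shift p (X s) = optX (p s) := mkDerivation_X ..

theorem pderiv_optX (o : Option σ) (s : σ) [Decidable (o = some s)] :
    pderiv s (optX o) = if o = some s then (1 : MvPolynomial σ ℚ) else 0 := by
  classical
  cases o with
  | none => simp
  | some t =>
    rw [optX_some, pderiv_X, Pi.single_apply]
    by_cases h : t = s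
    · simp [h]
    · rw [if_neg h, if_neg (by simpa using h)]

theorem pderiv_shift_symm (p : σ ≃. σ) (s : σ) (g : MvPolynomial σ ℚ) :
    pderiv s (shift p.symm g) =
      shift p.symm (pderiv s g) + (p s).elim 0 fun t => pderiv t g := by
  classical
  have hD : ∀ o : Option σ, ∃ D : Derivation ℚ (MvPolynomial σ ℚ) (MvPolynomial σ ℚ),
      (∀ g, D g = o.elim 0 fun t => pderiv t g) := by
    rintro (_ | t)
    · exact ⟨0, fun g => rfl⟩
    · exact ⟨pderiv t, fun _ => rfl⟩
  obtain ⟨D, hD⟩ := hD (p s)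
  have h : ⁅(pderiv s : Derivation ℚ (MvPolynomial σ ℚ) (MvPolynomial σ ℚ)), shift p.symm⁆ = D := by
    refine MvPolynomial.derivation_ext (R := ℚ) fun t => ?_
    rw [Derivation.commutator_apply, hD, shift_X, pderiv_optX, pderiv_X, Pi.single_apply]
    have h1 : shift p.symm (if t = s then (1 : MvPolynomial σ ℚ) else 0) = 0 := by
      split_ifs <;> simp
    rw [h1, sub_zero]
    have h2 : p.symm t = some s ↔ p s = some t := p.eq_some_iff
    cases hp : p s with
    | none => rw [if_neg (by rw [h2, hp]; simp)]; rfl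
    | some r =>
      simp only [Option.elim_some, pderiv_X, Pi.single_apply, h2, hp, Option.some.injEq]
      exact if_congr eq_comm rfl rfl
  rw [← hD, ← h, Derivation.commutator_apply]
  abel

theorem apolar_shift (p : σ ≃. σ) (f g : MvPolynomial σ ℚ) :
    apolar (shift p f) g = apolar f (shift p.symm g) := by
  induction f using MvPolynomial.induction_on generalizing g with
  | C c =>
    have h1 : constantCoeff (shift p.symm g) = 0 := by
      induction g using MvPolynomial.induction_on with
      | C c => simp
      | add p q hp hq => simp [hp, hq]
      | mul_X q s _ =>
        rw [Derivation.leibniz, shift_X, map_add, smul_eq_mul, smul_eq_mul, map_mul, map_mul,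
          constantCoeff_X, zero_mul, add_zero]
        cases p.symm s <;> simp
    have h2 : (C c : MvPolynomial σ ℚ) = monomial 0 c := rfl
    rw [h2, apolar_monomial, ← constantCoeff_eq, h1, ← h2]
    simp
  | add p q hp hq => simp [hp, hq]
  | mul_X f s ih =>
    rw [Derivation.leibniz, smul_eq_mul, smul_eq_mul, map_add, LinearMap.add_apply, apolar_X_mul,
      mul_comm f (X s), apolar_X_mul, ih, pderiv_shift_symm, map_add, shift_X, add_comm]
    congr 1
    cases p s with
    | none => simp
    | some t => rw [optX_some, mul_comm, apolar_X_mul]; rfl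

end Apolar

section Weights

variable {σ : Type*} {A : Type*} [AddCommGroup A] {w : σ → A}

theorem derivation_monomial (D : Derivation ℚ (MvPolynomial σ ℚ) (MvPolynomial σ ℚ))
    (a : σ →₀ ℕ) (c : ℚ) :
    D (monomial a c) = a.sum fun s n => monomial (a - Finsupp.single s 1) (c * n) * D (X s) := by
  have : D = mkDerivation ℚ fun s => D (X s) := derivation_ext fun s => by simp
  conv_lhs => rw [this]
  rw [mkDerivation_monomial, Finsupp.smul_sum]
  refine Finset.sum_congr rfl fun s _ => ?_
  dsimp only
  rw [smul_eq_mul, ← smul_mul_assoc, smul_monomial, smul_eq_mul]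

theorem weight_sub_single {a : σ →₀ ℕ} {s : σ} (hs : s ∈ a.support) :
    Finsupp.weight w (a - Finsupp.single s 1) + w s = Finsupp.weight w a := by
  have h : a = (a - Finsupp.single s 1) + Finsupp.single s 1 :=
    (tsub_add_cancel_of_le (Finsupp.single_le_iff.2
      (Nat.one_le_iff_ne_zero.2 (Finsupp.mem_support_iff.1 hs)))).symm
  conv_rhs => rw [h, map_add, Finsupp.weight_single, one_smul]

/-- A derivation shifts weights by `α` if it does so on the variables. -/
theorem derivation_isWeightedHomogeneous
    (D : Derivation ℚ (MvPolynomial σ ℚ) (MvPolynomial σ ℚ)) {α d : A}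
    (hD : ∀ s, IsWeightedHomogeneous w (D (X s)) (w s + α)) {f : MvPolynomial σ ℚ}
    (hf : IsWeightedHomogeneous w f d) : IsWeightedHomogeneous w (D f) (d + α) := by
  rw [f.as_sum, map_sum]
  refine IsWeightedHomogeneous.sum _ _ _ fun a ha => ?_
  have hd := hf (mem_support_iff.1 ha)
  rw [derivation_monomial]
  refine IsWeightedHomogeneous.sum _ _ _ fun s hs => ?_
  have := (isWeightedHomogeneous_monomial w (a - Finsupp.single s 1) (coeff a f * (a s : ℚ))
    rfl).mul (hD s)
  rwa [← add_assoc, weight_sub_single hs, hd] at this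

/-- Euler's formula: a derivation which multiplies each variable by a linear function of its weight
does so with all polynomials of a given weight. -/
theorem derivation_euler (D : Derivation ℚ (MvPolynomial σ ℚ) (MvPolynomial σ ℚ)) (ℓ : A →+ ℤ)
    (hD : ∀ s, D (X s) = (ℓ (w s) : ℚ) • X s) {d : A} {f : MvPolynomial σ ℚ}
    (hf : IsWeightedHomogeneous w f d) : D f = (ℓ d : ℚ) • f := by
  conv_rhs => rw [f.as_sum]
  conv_lhs => rw [f.as_sum]
  rw [map_sum, Finset.smul_sum]
  refine Finset.sum_congr rfl fun a ha => ?_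
  rw [derivation_monomial, ← hf (mem_support_iff.1 ha), Finsupp.weight_apply, Finsupp.sum,
    Finsupp.sum, map_sum, Int.cast_sum, Finset.sum_smul]
  refine Finset.sum_congr rfl fun s hs => ?_
  have h : a - Finsupp.single s 1 + Finsupp.single s 1 = a :=
    tsub_add_cancel_of_le (Finsupp.single_le_iff.2
      (Nat.one_le_iff_ne_zero.2 (Finsupp.mem_support_iff.1 hs)))
  rw [hD, mul_smul_comm, X, monomial_mul, h, mul_one, smul_monomial, smul_monomial, map_nsmul]
  congr 1
  simp only [smul_eq_mul, nsmul_eq_mul]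
  push_cast
  ring

theorem apolar_eq_zero_of_weight {d e : A} (hde : d ≠ e) {f g : MvPolynomial σ ℚ}
    (hf : IsWeightedHomogeneous w f d) (hg : IsWeightedHomogeneous w g e) : apolar f g = 0 := by
  rw [apolar_apply]
  refine Finset.sum_eq_zero fun a ha => ?_
  by_cases h : coeff a g = 0
  · rw [h]; ring
  · exact absurd ((hf (mem_support_iff.1 ha)).symm.trans (hg h)) hde

/-- The monomials of weight `d` form a basis of the weight space. -/
noncomputable def weightBasis (w : σ → A) (d : A) :
    Module.Basis {a : σ →₀ ℕ // Finsupp.weight w a = d} ℚ (weightedHomogeneousSubmodule ℚ w d) :=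
  (basisRestrictSupport ℚ {a | Finsupp.weight w a = d}).map
    (LinearEquiv.ofEq _ _ (weightedHomogeneousSubmodule_eq_finsupp_supported ℚ w d).symm)

theorem finrank_weightedHomogeneousSubmodule (w : σ → A) (d : A) :
    Module.finrank ℚ (weightedHomogeneousSubmodule ℚ w d) =
      Nat.card {a : σ →₀ ℕ // Finsupp.weight w a = d} :=
  Module.finrank_eq_nat_card_basis (weightBasis w d)

end Weights

section NonnegativeWeights

variable {σ : Type*} {w : σ → ℕ → ℤ}

theorem weight_nonneg (hw : ∀ s, 0 ≤ w s) (a : σ →₀ ℕ) : 0 ≤ Finsupp.weight w a := by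
  rw [Finsupp.weight_apply]
  exact Finset.sum_nonneg fun s _ => nsmul_nonneg (hw s) _

theorem finite_weight (hw : ∀ s, 0 < w s)
    (hfin : ∀ a : σ →₀ ℕ, {s | w s ≤ Finsupp.weight w a}.Finite)
    (d : ℕ → ℤ) : {a : σ →₀ ℕ | Finsupp.weight w a = d}.Finite := by
  classical
  rcases Set.eq_empty_or_nonempty {a : σ →₀ ℕ | Finsupp.weight w a = d} with h | ⟨b, rfl⟩
  · rw [h]
    exact Set.finite_empty
  have hpos : ∀ s, ∃ i, 0 < w s i := fun s => (Pi.lt_def.1 (hw s)).2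
  choose i hi using hpos
  refine ((hfin b).toFinset.finsupp fun s =>
    Finset.range ((Finsupp.weight w b (i s)).toNat + 1)).finite_toSet.subset
    fun a ha => ?_
  have hle : ∀ s, a s • w s ≤ Finsupp.weight w b := by
    intro s
    rw [← (ha : Finsupp.weight w a = Finsupp.weight w b), Finsupp.weight_apply]
    by_cases hs : s ∈ a.support
    · exact Finset.single_le_sum (f := fun s => a s • w s)
        (fun s _ => nsmul_nonneg (hw s).le _) hs
    · rw [Finsupp.notMem_support_iff.1 hs, zero_smul]
      exact Finset.sum_nonneg fun s _ => nsmul_nonneg (hw s).le _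
  rw [Finset.mem_coe, Finset.mem_finsupp_iff]
  constructor
  · intro s hs
    rw [Set.Finite.mem_toFinset]
    have h1 : 1 ≤ a s := Nat.one_le_iff_ne_zero.2 (Finsupp.mem_support_iff.1 hs)
    refine le_trans ?_ (hle s)
    calc w s = 1 • w s := (one_smul _ _).symm
      _ ≤ a s • w s := nsmul_le_nsmul_left (hw s).le h1
  · intro s _
    rw [Finset.mem_range]
    have h1 := hle s (i s)
    have h2 := hi s
    rw [Pi.smul_apply, nsmul_eq_mul] at h1
    have h3 : (a s : ℤ) ≤ Finsupp.weight w b (i s) := by nlinarith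
    omega

/-- The contravariant module on a polynomial ring whose raising operators move the variables along
partial injections `p i`, with the apolar form. -/
noncomputable def polynomialModule (k : ℕ) (w : σ → ℕ → ℤ) (p : Fin k → σ ≃. σ)
    (hw : ∀ s, 0 < w s)
    (hfin : ∀ a : σ →₀ ℕ, {s | w s ≤ Finsupp.weight w a}.Finite)
    (hp : ∀ i s t, p i s = some t → w t = w s + root i)
    (hcomm : ∀ i j s, shift (p i) (optX ((p j).symm s)) = shift (p j).symm (optX (p i s)) +
      if i = j then ((w s i - w s (i + 1) : ℤ) : ℚ) • X s else 0) :
    ContravariantModule k (MvPolynomial σ ℚ) where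
  E i := shift (p i)
  F i := shift (p i).symm
  W d := weightedHomogeneousSubmodule ℚ w d
  form := apolar
  form_symm := apolar_symm
  form_pos _ := apolar_pos
  form_orth h hu hv := apolar_eq_zero_of_weight h hu hv
  E_mem {i d u} hu := derivation_isWeightedHomogeneous _ (fun s => by
    rw [shift_X]
    cases h : p i s with
    | none => exact isWeightedHomogeneous_zero ℚ w _
    | some t => rw [optX_some, ← hp i s t h]; exact isWeightedHomogeneous_X ℚ w t) hu
  F_mem {i d u} hu := by
    rw [sub_eq_add_neg]
    refine derivation_isWeightedHomogeneous _ (fun s => ?_) hu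
    rw [shift_X]
    cases h : (p i).symm s with
    | none => exact isWeightedHomogeneous_zero ℚ w _
    | some t =>
      have h1 := hp i t s ((p i).eq_some_iff.1 h)
      have h2 : w s + -root i = w t := by rw [h1]; abel
      rw [optX_some, h2]
      exact isWeightedHomogeneous_X ℚ w t
  adj i u v := apolar_shift (p i) u v
  comm {i j d u} hu := by
    let ℓ : (ℕ → ℤ) →+ ℤ := if i = j then
      Pi.evalAddMonoidHom (fun _ => ℤ) (i : ℕ) - Pi.evalAddMonoidHom (fun _ => ℤ) ((i : ℕ) + 1)
      else 0
    have hℓ : ∀ e, ℓ e = if i = j then e i - e (i + 1) else 0 := fun e => by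
      by_cases h : i = j <;> simp [ℓ, h]
    have h := derivation_euler ⁅shift (p i), shift (p j).symm⁆ ℓ (fun s => by
      rw [Derivation.commutator_apply, shift_X, shift_X, hcomm, hℓ, add_sub_cancel_left]
      split_ifs <;> simp) hu
    rw [Derivation.commutator_apply, sub_eq_iff_eq_add', hℓ] at h
    rw [Derivation.coeFn_coe, Derivation.coeFn_coe, h]
    congr 1
    split_ifs <;> simp
  finite d := by
    have : Finite {a : σ →₀ ℕ // Finsupp.weight w a = d} := (finite_weight hw hfin d).to_subtype
    exact Module.Finite.of_basis (weightBasis w d)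
  nonneg {d u} hu h0 := by
    obtain ⟨a, ha⟩ := ne_zero_iff.1 h0
    rw [← hu ha]
    exact weight_nonneg (fun s => (hw s).le) a

end NonnegativeWeights

/-! ### Functions on matrices invariant under unitriangular row and column operations -/

section Path

variable {σ : Type*}

theorem exists_polynomial_eval_line (f : MvPolynomial σ ℚ) (x y : σ → ℚ) :
    ∃ g : Polynomial ℚ, ∀ s : ℚ, g.eval s = eval (fun v => x v + s * y v) f := by
  induction f using MvPolynomial.induction_on with
  | C c => exact ⟨Polynomial.C c, by simp⟩
  | add p q hp hq =>
    obtain ⟨g, hg⟩ := hp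
    obtain ⟨h, hh⟩ := hq
    exact ⟨g + h, fun s => by simp [hg, hh]⟩
  | mul_X p v hp =>
    obtain ⟨g, hg⟩ := hp
    exact ⟨g * (Polynomial.C (x v) + Polynomial.X * Polynomial.C (y v)), fun s => by
      simp [hg, mul_comm s]⟩

theorem polynomial_eq_of_eval_ne_zero {g h : Polynomial ℚ} (hgh : ∀ s ≠ 0, g.eval s = h.eval s) :
    g = h :=
  Polynomial.eq_of_infinite_eval_eq g h (Set.infinite_of_finite_compl (by
    refine (Set.finite_singleton (0 : ℚ)).subset fun s hs => ?_
    by_contra h0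
    exact hs (hgh s h0)))

/-- The derivative of a polynomial function along a line is given by a derivation, if this is so for
the coordinate functions. -/
theorem exists_polynomial_derivative (D : Derivation ℚ (MvPolynomial σ ℚ) (MvPolynomial σ ℚ))
    (x y : σ → ℚ) (hD : ∀ v, ∀ s : ℚ, eval (fun v => x v + s * y v) (D (X v)) = y v)
    (f : MvPolynomial σ ℚ) :
    ∃ g : Polynomial ℚ, (∀ s : ℚ, g.eval s = eval (fun v => x v + s * y v) f) ∧
      ∀ s : ℚ, g.derivative.eval s = eval (fun v => x v + s * y v) (D f) := by
  induction f using MvPolynomial.induction_on with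
  | C c => exact ⟨Polynomial.C c, by simp, by simp⟩
  | add p q hp hq =>
    obtain ⟨g, hg, hg'⟩ := hp
    obtain ⟨h, hh, hh'⟩ := hq
    exact ⟨g + h, fun s => by simp [hg, hh], fun s => by simp [hg', hh']⟩
  | mul_X p v hp =>
    obtain ⟨g, hg, hg'⟩ := hp
    refine ⟨g * (Polynomial.C (x v) + Polynomial.X * Polynomial.C (y v)), fun s => by
      simp [hg, mul_comm s], fun s => ?_⟩
    rw [Derivation.leibniz, smul_eq_mul, smul_eq_mul, (eval _).map_add, (eval _).map_mul,
      (eval _).map_mul, hD, ← hg', ← hg, eval_X, Polynomial.derivative_mul]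
    simp
    ring

theorem eval_add_of_derivation_eq_zero
    (D : Derivation ℚ (MvPolynomial σ ℚ) (MvPolynomial σ ℚ)) (x y : σ → ℚ)
    (hD : ∀ v, ∀ s : ℚ, eval (fun v => x v + s * y v) (D (X v)) = y v)
    {f : MvPolynomial σ ℚ} (hf : D f = 0) : eval (fun v => x v + y v) f = eval x f := by
  obtain ⟨g, hg, hg'⟩ := exists_polynomial_derivative D x y hD f
  have h0 : g.derivative = 0 := Polynomial.funext fun s => by rw [hg', hf]; simp
  have h1 := Polynomial.derivative_eq_zero.1 h0
  rw [Polynomial.natDegree_eq_zero] at h1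
  obtain ⟨c, rfl⟩ := h1
  have h2 := hg 0
  have h3 := hg 1
  simp only [zero_mul, add_zero, one_mul, Polynomial.eval_C] at h2 h3
  rw [← h3, h2]

theorem derivation_eq_zero_of_eval
    (D : Derivation ℚ (MvPolynomial σ ℚ) (MvPolynomial σ ℚ)) (y : (σ → ℚ) → σ → ℚ)
    (hD : ∀ x v, ∀ s : ℚ, eval (fun v => x v + s * y x v) (D (X v)) = y x v)
    {f : MvPolynomial σ ℚ} (hf : ∀ x, ∀ s : ℚ, eval (fun v => x v + s * y x v) f = eval x f) :
    D f = 0 := by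
  refine MvPolynomial.funext fun x => ?_
  obtain ⟨g, hg, hg'⟩ := exists_polynomial_derivative D x (y x) (hD x) f
  have h0 : g = Polynomial.C (eval x f) := Polynomial.funext fun s => by rw [hg, hf]; simp
  have := hg' 0
  rw [h0] at this
  simpa using this.symm

end Path

section Matrices

variable {k : ℕ}

/-- Polynomials in the entries of a square matrix with rows and columns `0, …, k`. -/
abbrev MatPoly (k : ℕ) : Type := MvPolynomial (Fin (k + 1) × Fin (k + 1)) ℚ

/-- The value of a polynomial at a matrix. -/
noncomputable def evalMat (A : Fin (k + 1) → Fin (k + 1) → ℚ) : MatPoly k →+* ℚ :=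
  eval fun v => A v.1 v.2

/-- The weight of the matrix entries under the torus acting on the rows. -/
def rowWeight (v : Fin (k + 1) × Fin (k + 1)) : ℕ → ℤ := Pi.single (v.1 : ℕ) 1

/-- The weight of the matrix entries under the torus acting on the columns. -/
def colWeight (v : Fin (k + 1) × Fin (k + 1)) : ℕ → ℤ := Pi.single (v.2 : ℕ) 1

/-- The derivation corresponding to adding to each row `r` the multiple `t r` of row `p`. -/
noncomputable def rowDer (p : Fin (k + 1)) (t : Fin (k + 1) → ℚ) :
    Derivation ℚ (MatPoly k) (MatPoly k) :=
  mkDerivation ℚ fun v => C (t v.1) * X (p, v.2)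

/-- The derivation corresponding to adding to each column `c` the multiple `t c` of column `p`. -/
noncomputable def colDer (p : Fin (k + 1)) (t : Fin (k + 1) → ℚ) :
    Derivation ℚ (MatPoly k) (MatPoly k) :=
  mkDerivation ℚ fun v => C (t v.2) * X (v.1, p)

/-- Invariance under adding multiples of a row to later rows with index less than `m`. -/
def RowInvariant (m : ℕ) (f : MatPoly k) : Prop :=
  ∀ A (p : Fin (k + 1)) (t : Fin (k + 1) → ℚ), (∀ r, t r ≠ 0 → p < r ∧ (r : ℕ) < m) →
    evalMat (fun r c => A r c + t r * A p c) f = evalMat A f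

/-- Invariance under adding multiples of a column to later columns. -/
def ColInvariant (f : MatPoly k) : Prop :=
  ∀ A (p : Fin (k + 1)) (t : Fin (k + 1) → ℚ), (∀ c, t c ≠ 0 → p < c) →
    evalMat (fun r c => A r c + t c * A r p) f = evalMat A f

theorem RowInvariant.mono {m m' : ℕ} (h : m ≤ m') {f : MatPoly k} (hf : RowInvariant m' f) :
    RowInvariant m f :=
  fun A p t ht => hf A p t fun r hr => ⟨(ht r hr).1, (ht r hr).2.trans_le h⟩

theorem rowInvariant_iff {m : ℕ} {f : MatPoly k} : RowInvariant m f ↔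
    ∀ (p : Fin (k + 1)) (t : Fin (k + 1) → ℚ), (∀ r, t r ≠ 0 → p < r ∧ (r : ℕ) < m) →
      rowDer p t f = 0 := by
  have hp : ∀ {p : Fin (k + 1)} {t : Fin (k + 1) → ℚ}, (∀ r, t r ≠ 0 → p < r ∧ (r : ℕ) < m) →
      t p = 0 := fun {p t} ht => by
    by_contra h
    exact lt_irrefl _ (ht p h).1
  constructor
  · intro hf p t ht
    refine derivation_eq_zero_of_eval _ (fun x v => t v.1 * x (p, v.2))
      (fun x v s => by simp [rowDer, hp ht]) fun x s => ?_
    have := hf (fun r c => x (r, c)) p (fun r => s * t r) fun r hr =>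
      ht r (right_ne_zero_of_mul hr)
    simpa [evalMat, mul_assoc] using this
  · intro hf A p t ht
    have := eval_add_of_derivation_eq_zero _ (fun v => A v.1 v.2) (fun v => t v.1 * A p v.2)
      (fun v s => by simp [rowDer, hp ht]) (hf p t ht)
    exact this

theorem colInvariant_iff {f : MatPoly k} : ColInvariant f ↔
    ∀ (p : Fin (k + 1)) (t : Fin (k + 1) → ℚ), (∀ c, t c ≠ 0 → p < c) → colDer p t f = 0 := by
  have hp : ∀ {p : Fin (k + 1)} {t : Fin (k + 1) → ℚ}, (∀ c, t c ≠ 0 → p < c) →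
      t p = 0 := fun {p t} ht => by
    by_contra h
    exact lt_irrefl _ (ht p h)
  constructor
  · intro hf p t ht
    refine derivation_eq_zero_of_eval _ (fun x v => t v.2 * x (v.1, p))
      (fun x v s => by simp [colDer, hp ht]) fun x s => ?_
    have := hf (fun r c => x (r, c)) p (fun c => s * t c) fun c hc =>
      ht c (right_ne_zero_of_mul hc)
    simpa [evalMat, mul_assoc] using this
  · intro hf A p t ht
    have := eval_add_of_derivation_eq_zero _ (fun v => A v.1 v.2) (fun v => t v.2 * A v.1 p)
      (fun v s => by simp [colDer, hp ht]) (hf p t ht)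
    exact this

theorem rowDer_single_succ (p q r : Fin (k + 1)) (hqr : q < r) (hpq : p < q) :
    rowDer p (Pi.single r 1) =
      ⁅rowDer p (Pi.single q 1), rowDer q (Pi.single r 1)⁆ := by
  refine MvPolynomial.derivation_ext (R := ℚ) fun v => ?_
  have h1 : p ≠ r := (hpq.trans hqr).ne
  rw [Derivation.commutator_apply]
  simp only [rowDer, mkDerivation_X, Derivation.leibniz, derivation_C, add_zero,
    smul_eq_mul, Pi.single_eq_same, Pi.single_eq_of_ne h1, C_0, zero_mul, mul_zero, C_1, one_mul,
    sub_zero]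

/-- Invariance under the elementary operations on adjacent rows suffices. -/
theorem rowInvariant_of_adjacent {m : ℕ} {f : MatPoly k}
    (h : ∀ i : Fin k, (i : ℕ) + 1 < m → rowDer i.castSucc (Pi.single i.succ 1) f = 0) :
    RowInvariant m f := by
  have key : ∀ n : ℕ, ∀ p r : Fin (k + 1), p < r → (r : ℕ) < m → (r : ℕ) = p + n →
      rowDer p (Pi.single r 1) f = 0 := by
    intro n
    induction n with
    | zero => intro p r hpr _ hn; exact absurd hn (by have := Fin.lt_def.1 hpr; omega)
    | succ n ih =>
      intro p r hpr hr hn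
      have hpr' := Fin.lt_def.1 hpr
      obtain ⟨q, rfl⟩ : ∃ q : Fin k, q.succ = r := Fin.exists_succ_eq.2 fun h0 => by
        rw [h0, Fin.val_zero] at hpr'
        omega
      rw [Fin.val_succ] at hr hn
      have hadj := h q hr
      by_cases hn0 : n = 0
      · have : p = q.castSucc := Fin.ext (by rw [Fin.val_castSucc]; omega)
        rw [this]
        exact hadj
      · have h1 : p < q.castSucc := Fin.lt_def.2 (by rw [Fin.val_castSucc]; omega)
        have h2 := ih p _ h1 (by rw [Fin.val_castSucc]; omega) (by rw [Fin.val_castSucc]; omega)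
        rw [rowDer_single_succ p _ _ Fin.castSucc_lt_succ h1, Derivation.commutator_apply, hadj,
          h2, map_zero, map_zero, sub_zero]
  rw [rowInvariant_iff]
  intro p t ht
  have hsum : rowDer p t = ∑ r, t r • rowDer p (Pi.single r 1) := by
    refine MvPolynomial.derivation_ext (R := ℚ) fun v => ?_
    have happ : ∀ (s : Finset (Fin (k + 1))) (g : MatPoly k),
        (∑ r ∈ s, t r • rowDer p (Pi.single r 1)) g =
          ∑ r ∈ s, t r • rowDer p (Pi.single r 1) g := by
      intro s g
      rw [← Derivation.coeFnAddMonoidHom_apply, map_sum, Finset.sum_apply]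
      rfl
    rw [happ, Finset.sum_eq_single v.1]
    · simp [rowDer, MvPolynomial.smul_eq_C_mul]
    · intro r _ hr
      simp [rowDer, Pi.single_eq_of_ne hr.symm]
    · simp
  rw [hsum, ← Derivation.coeFnAddMonoidHom_apply, map_sum, Finset.sum_apply]
  refine Finset.sum_eq_zero fun r _ => ?_
  rw [Derivation.coeFnAddMonoidHom_apply, Derivation.smul_apply]
  by_cases hr : t r = 0
  · rw [hr, zero_smul]
  · have := Fin.lt_def.1 (ht r hr).1
    rw [key (r - p) p r (ht r hr).1 (ht r hr).2 (by omega), smul_zero]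

end Matrices

section Elimination

variable {k : ℕ}

theorem weight_rowWeight (a : Fin (k + 1) × Fin (k + 1) →₀ ℕ) (r : Fin (k + 1)) :
    Finsupp.weight rowWeight a (r : ℕ) = ∑ c, (a (r, c) : ℤ) := by
  rw [Finsupp.weight_apply, Finsupp.sum_fintype _ _ (fun v => zero_smul ℕ (rowWeight v)),
    Finset.sum_apply, Fintype.sum_prod_type, Finset.sum_eq_single r]
  · simp [rowWeight]
  · intro s _ hs
    refine Finset.sum_eq_zero fun c _ => ?_
    simp [rowWeight, Fin.val_inj, hs.symm]
  · simp

theorem weight_colWeight (a : Fin (k + 1) × Fin (k + 1) →₀ ℕ) (c : Fin (k + 1)) :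
    Finsupp.weight colWeight a (c : ℕ) = ∑ r, (a (r, c) : ℤ) := by
  rw [Finsupp.weight_apply, Finsupp.sum_fintype _ _ (fun v => zero_smul ℕ (colWeight v)),
    Finset.sum_apply, Fintype.sum_prod_type]
  refine Finset.sum_congr rfl fun r _ => ?_
  rw [Finset.sum_eq_single c]
  · simp [colWeight]
  · intro s _ hs
    simp [colWeight, Fin.val_inj, hs.symm]
  · simp

/-- The state of Gaussian elimination after `m` steps: off the diagonal, and outside the last row, the
first `m` rows and the first `m` columns vanish. -/
def Cleared (A : Fin (k + 1) → Fin (k + 1) → ℚ) (m : ℕ) : Prop :=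
  ∀ r c : Fin (k + 1), (r : ℕ) < k → r ≠ c → ((r : ℕ) < m ∨ (c : ℕ) < m) → A r c = 0

/-- The only monomial of row weight `ρ` and column weight `ν` which does not vanish on the matrices
whose rows other than the last one are diagonal. -/
noncomputable def normalMonomial (k : ℕ) (ρ ν : ℕ → ℤ) : Fin (k + 1) × Fin (k + 1) →₀ ℕ :=
  Finsupp.equivFunOnFinite.symm fun v =>
    if (v.1 : ℕ) < k then if v.1 = v.2 then (ρ v.1).toNat else 0
    else if (v.2 : ℕ) < k then (ν v.2 - ρ v.2).toNat else (ν v.2).toNat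

/-- The normal monomial is the only one with given weights whose variables off the diagonal all lie in
the last row: its exponents on the diagonal are the row weights, and the last row makes up for the
column weights. -/
theorem eq_normalMonomial {ρ ν : ℕ → ℤ} {a : Fin (k + 1) × Fin (k + 1) →₀ ℕ}
    (hρ : Finsupp.weight rowWeight a = ρ) (hν : Finsupp.weight colWeight a = ν)
    (ha : ∀ r c : Fin (k + 1), (r : ℕ) < k → r ≠ c → a (r, c) = 0) :
    a = normalMonomial k ρ ν ∧ ∀ c < k, ρ c ≤ ν c := by
  have h1 : ∀ r : Fin (k + 1), (r : ℕ) < k → ρ r = a (r, r) := by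
    intro r hr
    rw [← hρ, weight_rowWeight, Finset.sum_eq_single r]
    · intro c _ hc
      rw [ha r c hr hc.symm, Nat.cast_zero]
    · simp
  have h2 : ∀ c : Fin (k + 1), (c : ℕ) < k → ν c = a (c, c) + a (Fin.last k, c) := by
    intro c hc
    have hne : c ≠ Fin.last k := fun h => by rw [h, Fin.val_last] at hc; omega
    rw [← hν, weight_colWeight, ← Finset.sum_subset (Finset.subset_univ {c, Fin.last k}),
      Finset.sum_pair hne]
    intro r _ hr
    simp only [Finset.mem_insert, Finset.mem_singleton, not_or] at hr
    rw [ha r c (Fin.val_lt_last hr.2) hr.1, Nat.cast_zero]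
  have h3 : ν k = a (Fin.last k, Fin.last k) := by
    have := weight_colWeight a (Fin.last k)
    rw [Fin.val_last] at this
    rw [← hν, this, Finset.sum_eq_single (Fin.last k)]
    · intro r _ hr
      rw [ha r _ (Fin.val_lt_last hr) hr, Nat.cast_zero]
    · simp
  constructor
  · ext ⟨r, c⟩
    simp only [normalMonomial, Finsupp.equivFunOnFinite_symm_apply_apply]
    by_cases hr : (r : ℕ) < k
    · rw [if_pos hr]
      by_cases hrc : r = c
      · rw [if_pos hrc, h1 r hr, ← hrc, Int.toNat_natCast]
      · rw [if_neg hrc, ha r c hr hrc]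
    · rw [if_neg hr]
      have hr' : r = Fin.last k := Fin.ext (by rw [Fin.val_last]; omega)
      by_cases hc : (c : ℕ) < k
      · rw [if_pos hc, h2 c hc, h1 c hc, hr', add_sub_cancel_left, Int.toNat_natCast]
      · have hc' : c = Fin.last k := Fin.ext (by rw [Fin.val_last]; omega)
        rw [if_neg hc, hc', Fin.val_last, h3, hr', Int.toNat_natCast]
  · intro c hc
    have e1 := h1 ⟨c, by omega⟩ hc
    have e2 := h2 ⟨c, by omega⟩ hc
    dsimp only at e1 e2
    rw [e1, e2]
    omega

variable {ρ ν : ℕ → ℤ} {f : MatPoly k}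

theorem evalMat_eq_of_cleared (hρ : IsWeightedHomogeneous rowWeight f ρ)
    (hν : IsWeightedHomogeneous colWeight f ν) {A : Fin (k + 1) → Fin (k + 1) → ℚ}
    (hA : ∀ r c : Fin (k + 1), (r : ℕ) < k → r ≠ c → A r c = 0) :
    evalMat A f = coeff (normalMonomial k ρ ν) f *
      ∏ v : Fin (k + 1) × Fin (k + 1), A v.1 v.2 ^ normalMonomial k ρ ν v := by
  rw [evalMat, eval_eq', Finset.sum_eq_single (normalMonomial k ρ ν)]
  · intro a ha hne
    have ha' := mem_support_iff.1 ha
    obtain ⟨r, c, hr, hrc, h0⟩ : ∃ r c : Fin (k + 1), (r : ℕ) < k ∧ r ≠ c ∧ a (r, c) ≠ 0 := by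
      by_contra! hcon
      exact hne (eq_normalMonomial (hρ ha') (hν ha') hcon).1
    rw [Finset.prod_eq_zero (Finset.mem_univ (r, c)), mul_zero]
    dsimp only
    rw [hA r c hr hrc, zero_pow h0]
  · intro h
    rw [notMem_support_iff.1 h, zero_mul]

/-- Gaussian elimination: an invariant polynomial which vanishes on the matrices whose rows other
than the last one are diagonal vanishes. -/
theorem evalMat_eq_zero_of_cleared (hrow : RowInvariant k f) (hcol : ColInvariant f)
    (h : ∀ A : Fin (k + 1) → Fin (k + 1) → ℚ, Cleared A k → evalMat A f = 0)
    (A : Fin (k + 1) → Fin (k + 1) → ℚ) : evalMat A f = 0 := by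
  suffices H : ∀ j ≤ k, ∀ A : Fin (k + 1) → Fin (k + 1) → ℚ, Cleared A (k - j) →
      evalMat A f = 0 from H k le_rfl A fun r c _ _ hm => by omega
  intro j
  induction j with
  | zero => intro _; exact h
  | succ j ih =>
    intro hj A hA
    obtain ⟨p, hp⟩ : ∃ p : Fin (k + 1), (p : ℕ) = k - (j + 1) := ⟨⟨k - (j + 1), by omega⟩, rfl⟩
    have hpk : (p : ℕ) < k := by omega
    have hsucc : k - j = p + 1 := by omega
    rw [← hp] at hA
    -- first assume that the pivot does not vanish
    have hpiv : ∀ A : Fin (k + 1) → Fin (k + 1) → ℚ, Cleared A p → A p p ≠ 0 →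
        evalMat A f = 0 := by
      intro A hA h0
      set t : Fin (k + 1) → ℚ := fun c => if p < c then -(A p c / A p p) else 0 with ht
      set A1 : Fin (k + 1) → Fin (k + 1) → ℚ := fun r c => A r c + t c * A r p with hA1
      set s : Fin (k + 1) → ℚ := fun r => if p < r ∧ (r : ℕ) < k then -(A r p / A p p) else 0
        with hs
      have e1 : evalMat A1 f = evalMat A f := hcol A p t fun c hc => by
        by_contra hpc
        exact hc (if_neg hpc)
      have e2 : evalMat (fun r c => A1 r c + s r * A1 p c) f = evalMat A1 f :=
        hrow A1 p s fun r hr => by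
          by_contra hpr
          exact hr (if_neg hpr)
      rw [← e1, ← e2]
      refine ih (by omega) _ ?_
      have hA1p : ∀ r, A1 r p = A r p := fun r => by simp [hA1, ht]
      rw [hsucc]
      intro r c hr hrc hm
      by_cases hlt : (r : ℕ) < p ∨ (c : ℕ) < p
      · have h1 : A r c = 0 := hA r c hr hrc hlt
        rcases hlt with hlt | hlt
        · have h2 : A r p = 0 := hA r p hr (fun h => by rw [h] at hlt; omega) (Or.inl hlt)
          have h3 : s r = 0 := if_neg fun h => by have := Fin.lt_def.1 h.1; omega
          simp [hA1, h1, h2, h3]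
        · have h2 : t c = 0 := if_neg fun h => by have := Fin.lt_def.1 h; omega
          have h3 : A p c = 0 := hA p c hpk (fun h => by rw [h] at hlt; omega) (Or.inr hlt)
          simp [hA1, h1, h2, h3]
      · push Not at hlt
        by_cases hrp : r = p
        · subst hrp
          have h1 : r < c := Fin.lt_def.2 (lt_of_le_of_ne hlt.2 (fun h => hrc (Fin.ext h)))
          have h2 : s r = 0 := if_neg fun h => lt_irrefl _ h.1
          simp only [hA1, h2, ht, if_pos h1]
          field_simp
          ring
        · have hcp : c = p := Fin.ext (by
            have : (r : ℕ) ≠ p := fun h => hrp (Fin.ext h)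
            omega)
          have h1 : p < r := Fin.lt_def.2 (lt_of_le_of_ne hlt.1 (fun h => hrp (Fin.ext h.symm)))
          simp only [hcp, hA1p, hs, if_pos (And.intro h1 hr)]
          field_simp
          ring
    by_cases h0 : A p p = 0
    · -- perturb the pivot
      obtain ⟨g, hg⟩ := exists_polynomial_eval_line f (fun v => A v.1 v.2)
        (fun v => if v.1 = p ∧ v.2 = p then 1 else 0)
      have hg0 : g = 0 := polynomial_eq_of_eval_ne_zero fun s hs => by
        rw [hg, Polynomial.eval_zero]
        refine hpiv (fun r c => A r c + s * if r = p ∧ c = p then 1 else 0) ?_ ?_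
        · intro r c hr hrc hm
          dsimp only
          rw [hA r c hr hrc hm, if_neg, mul_zero, add_zero]
          rintro ⟨rfl, rfl⟩
          exact hrc rfl
        · simp [h0, hs]
      have := hg 0
      rw [hg0] at this
      simpa [evalMat] using this.symm
    · exact hpiv A hA h0

/-- An invariant polynomial is determined by its coefficient at the normal monomial. -/
theorem eq_zero_of_coeff_normalMonomial (hρ : IsWeightedHomogeneous rowWeight f ρ)
    (hν : IsWeightedHomogeneous colWeight f ν) (hrow : RowInvariant k f) (hcol : ColInvariant f)
    (h : coeff (normalMonomial k ρ ν) f = 0) : f = 0 := by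
  refine MvPolynomial.funext fun x => ?_
  rw [map_zero]
  refine evalMat_eq_zero_of_cleared hrow hcol (fun A hA => ?_) fun r c => x (r, c)
  rw [evalMat_eq_of_cleared hρ hν fun r c hr hrc => hA r c hr hrc (Or.inl hr), h, zero_mul]

theorem normalMonomial_weights (hρ : IsWeightedHomogeneous rowWeight f ρ)
    (hν : IsWeightedHomogeneous colWeight f ν) (h : coeff (normalMonomial k ρ ν) f ≠ 0) :
    (∀ c < k, ρ c ≤ ν c) ∧
      ∀ c : Fin (k + 1), ∑ r, (normalMonomial k ρ ν (r, c) : ℤ) = ν c := by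
  refine ⟨(eq_normalMonomial (hρ h) (hν h) fun r c hr hrc => ?_).2, fun c => ?_⟩
  · simp [normalMonomial, hr, hrc]
  · conv_rhs => rw [← hν h]
    rw [weight_colWeight]

end Elimination

section Constraints

variable {k : ℕ} {ρ ν : ℕ → ℤ} {f : MatPoly k}

theorem normalMonomial_of_ne {r c : Fin (k + 1)} (hr : (r : ℕ) < k) (hrc : r ≠ c) :
    normalMonomial k ρ ν (r, c) = 0 := by
  simp [normalMonomial, hr, hrc]

/-- The lower interlacing inequality. The matrix which is the identity except for a block with rows
`(t, 1)`, `(1, 0)` on the diagonal has the eliminated form with entries `t`, `-1/t`; as the value of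
`f` depends polynomially on `t`, there can be no negative power of `t`. -/
theorem le_of_coeff_normalMonomial (hρ : IsWeightedHomogeneous rowWeight f ρ)
    (hν : IsWeightedHomogeneous colWeight f ν) (hrow : RowInvariant k f) (hcol : ColInvariant f)
    (h : coeff (normalMonomial k ρ ν) f ≠ 0) {j : ℕ} (hj : j < k) : ν (j + 1) ≤ ρ j := by
  classical
  obtain ⟨p, hp⟩ : ∃ p : Fin (k + 1), (p : ℕ) = j := ⟨⟨j, by omega⟩, rfl⟩
  obtain ⟨q, hq⟩ : ∃ q : Fin (k + 1), (q : ℕ) = j + 1 := ⟨⟨j + 1, by omega⟩, rfl⟩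
  have hpk : (p : ℕ) < k := by omega
  have hpq : p ≠ q := fun h => by rw [h, hq] at hp; omega
  have hlt : p < q := Fin.lt_def.2 (by omega)
  set a := normalMonomial k ρ ν with ha
  set n : ℕ := ∑ r, a (r, q) with hn
  have hnν : (n : ℤ) = ν (j + 1) := by
    have := (normalMonomial_weights hρ hν h).2 q
    rw [hq] at this
    rw [← this, hn]
    push_cast
    rfl
  have hpρ : (a (p, p) : ℤ) = ρ j := by
    have h1 : 0 ≤ ρ j := by
      rw [← hρ h, ← hp]
      exact weight_nonneg (fun v => Pi.single_nonneg.2 zero_le_one) _ _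
    have h2 : a (p, p) = (ρ j).toNat := by simp [ha, normalMonomial, hp, hj]
    rw [h2, Int.toNat_of_nonneg h1]
  rw [← hnν, ← hpρ]
  by_contra! hcon
  have hcon' : a (p, p) < n := by exact_mod_cast hcon
  let N : Fin (k + 1) → Fin (k + 1) → ℚ := fun r c =>
    if (r : ℕ) < k then
      if r = c then (if r = p ∨ r = q then 0 else 1)
      else if (r = p ∧ c = q) ∨ (r = q ∧ c = p) then 1 else 0
    else if c = q then 0 else 1
  obtain ⟨g, hg⟩ := exists_polynomial_eval_line f (fun v => N v.1 v.2)
    (fun v => if v.1 = p ∧ v.2 = p then 1 else 0)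
  have key : ∀ t : ℚ, t ≠ 0 → g.eval t = coeff a f * (t ^ a (p, p) * (-t⁻¹) ^ n) := by
    intro t ht
    set A : Fin (k + 1) → Fin (k + 1) → ℚ :=
      fun r c => N r c + t * if r = p ∧ c = p then 1 else 0 with hA
    set u : Fin (k + 1) → ℚ := fun c => if c = q then -t⁻¹ else 0 with hu
    set s : Fin (k + 1) → ℚ := fun r => if r = q ∧ (r : ℕ) < k then -t⁻¹ else 0 with hs
    set A1 : Fin (k + 1) → Fin (k + 1) → ℚ := fun r c => A r c + u c * A r p with hA1
    set Z : Fin (k + 1) → Fin (k + 1) → ℚ := fun r c =>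
      if (r : ℕ) < k then (if r = c then (if r = p then t else if r = q then -t⁻¹ else 1) else 0)
      else if c = q then -t⁻¹ else 1 with hZ
    have e0 : g.eval t = evalMat A f := hg t
    have e1 : evalMat A1 f = evalMat A f := hcol A p u fun c hc => by
      have : c = q := by
        by_contra h
        exact hc (if_neg h)
      rw [this]; exact hlt
    have e2 : evalMat (fun r c => A1 r c + s r * A1 p c) f = evalMat A1 f :=
      hrow A1 p s fun r hr => by
        have : r = q ∧ (r : ℕ) < k := by
          by_contra h
          exact hr (if_neg h)
        exact ⟨this.1 ▸ hlt, this.2⟩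
    have e3 : (fun r c => A1 r c + s r * A1 p c) = Z := by
      funext r c
      have hqp : q ≠ p := hpq.symm
      simp only [hA1, hA, hZ, hs, hu, N]
      by_cases hr : (r : ℕ) < k
      · by_cases hrq : r = q
        · subst hrq
          by_cases hcp : c = p
          · subst hcp
            simp [hr, hpk, hpq, hqp, ht]
          · by_cases hcq : c = r
            · subst hcq
              simp [hr, hpk, hpq, hqp, ht]
            · simp [hr, hpk, hpq, hqp, hcp, hcq, Ne.symm hcq, Ne.symm hcp]
        · by_cases hrp : r = p
          · subst hrp
            by_cases hcp : c = r
            · subst hcp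
              simp [hr, hpq]
            · by_cases hcq : c = q
              · subst hcq
                simp [hr, hpq, hqp, ht]
              · simp [hr, hpq, hcp, hcq, Ne.symm hcp]
          · by_cases hcq : c = q
            · simp [hr, hrq, hrp, hcq]
            · simp [hr, hrq, hrp, hcq]
      · have hrp : r ≠ p := fun h => hr (h ▸ hpk)
        by_cases hcq : c = q
        · simp [hr, hrp, hcq, hpq]
        · simp [hr, hrp, hcq]
    rw [e0, ← e1, ← e2, e3, evalMat_eq_of_cleared hρ hν fun r c hr hrc => by simp [hZ, hr, hrc]]
    congr 1
    rw [Fintype.prod_prod_type_right, Fintype.prod_eq_mul p q hpq]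
    · congr 1
      · rw [Fintype.prod_eq_single p]
        · simp [hZ, hpk, ha]
        · intro r hr
          by_cases hrk : (r : ℕ) < k
          · rw [normalMonomial_of_ne hrk hr, pow_zero]
          · simp [hZ, hrk, hpq]
      · rw [hn, ← Finset.prod_pow_eq_pow_sum]
        refine Finset.prod_congr rfl fun r _ => ?_
        by_cases hrk : (r : ℕ) < k
        · by_cases hrq : r = q
          · simp [hZ, hrq, hpq.symm, ha]
          · rw [normalMonomial_of_ne hrk hrq, pow_zero, pow_zero]
        · simp [hZ, hrk, ha]
    · rintro c ⟨hcp, hcq⟩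
      refine Finset.prod_eq_one fun r _ => ?_
      by_cases hrk : (r : ℕ) < k
      · by_cases hrc : r = c
        · simp [hZ, hrc, hcp, hcq]
        · rw [normalMonomial_of_ne hrk hrc, pow_zero]
      · simp [hZ, hrk, hcq]
  have hpoly : g * Polynomial.X ^ (n - a (p, p)) = Polynomial.C (coeff a f * (-1) ^ n) :=
    polynomial_eq_of_eval_ne_zero fun t ht => by
      have e : t ^ n = t ^ a (p, p) * t ^ (n - a (p, p)) := by
        rw [← pow_add]; congr 1; omega
      rw [Polynomial.eval_mul, key t ht, Polynomial.eval_pow, Polynomial.eval_X,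
        Polynomial.eval_C, neg_pow, inv_pow]
      field_simp
      rw [e]
  have := congrArg (Polynomial.eval 0) hpoly
  rw [Polynomial.eval_mul, Polynomial.eval_pow, Polynomial.eval_X, zero_pow (by omega), mul_zero,
    Polynomial.eval_C] at this
  exact h ((mul_eq_zero.1 this.symm).resolve_right (pow_ne_zero _ (by norm_num)))

/-- A polynomial which is invariant under the operations on all rows has equal row and column
weights. -/
theorem weight_eq_of_rowInvariant (hρ : IsWeightedHomogeneous rowWeight f ρ)
    (hν : IsWeightedHomogeneous colWeight f ν) (hrow : RowInvariant (k + 1) f)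
    (h : coeff (normalMonomial k ρ ν) f ≠ 0) {j : ℕ} (hj : j < k) : ρ j = ν j := by
  classical
  obtain ⟨p, hp⟩ : ∃ p : Fin (k + 1), (p : ℕ) = j := ⟨⟨j, by omega⟩, rfl⟩
  have hpk : (p : ℕ) < k := by omega
  let A : Fin (k + 1) → Fin (k + 1) → ℚ := fun r c =>
    if (r : ℕ) < k then (if r = c then 1 else 0) else 1
  let t : Fin (k + 1) → ℚ := fun r => if r = Fin.last k then -1 else 0
  have e := hrow A p t fun r hr => by
    have : r = Fin.last k := by
      by_contra h
      exact hr (if_neg h)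
    rw [this]
    exact ⟨Fin.lt_def.2 (by rw [Fin.val_last]; exact hpk), by rw [Fin.val_last]; omega⟩
  have hA : ∀ r c : Fin (k + 1), (r : ℕ) < k → r ≠ c → A r c = 0 := fun r c hr hrc => by
    simp [A, hr, hrc]
  have hlast : ∀ r : Fin (k + 1), (r : ℕ) < k → t r = 0 := fun r hr => by
    refine if_neg fun h => ?_
    rw [h, Fin.val_last] at hr
    omega
  rw [evalMat_eq_of_cleared hρ hν hA, evalMat_eq_of_cleared hρ hν (fun r c hr hrc => by
    rw [hA r c hr hrc, hlast r hr]; simp)] at e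
  have e' := mul_left_cancel₀ h e
  rw [Finset.prod_eq_one (f := fun v => A v.1 v.2 ^ normalMonomial k ρ ν v)] at e'
  · have h0 : normalMonomial k ρ ν (Fin.last k, p) = 0 := by
      by_contra h0
      rw [Finset.prod_eq_zero (Finset.mem_univ (Fin.last k, p))] at e'
      · exact zero_ne_one e'
      · have : A (Fin.last k) p + t (Fin.last k) * A p p = 0 := by simp [A, t, hpk]
        dsimp only
        rw [this, zero_pow h0]
    have h1 : normalMonomial k ρ ν (Fin.last k, p) = (ν j - ρ j).toNat := by
      simp [normalMonomial, hp, hj]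
    have h2 := (normalMonomial_weights hρ hν h).1 j hj
    rw [h1] at h0
    omega
  · rintro ⟨r, c⟩ _
    by_cases hr : (r : ℕ) < k
    · by_cases hrc : r = c
      · simp [A, hrc]
      · rw [normalMonomial_of_ne hr hrc, pow_zero]
    · simp [A, hr]

end Constraints

/-! ### Products of minors -/

section Minors

variable {k : ℕ}

/-- The rows of the minor `minor j l`. -/
def minorRow (j l : Fin (k + 1)) (i : Fin ((j : ℕ) + 1)) : Fin (k + 1) :=
  if (i : ℕ) < j then Fin.castLE j.2 i else l

/-- The minor of the generic matrix with rows `0, …, j - 1, l` and columns `0, …, j`. -/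
noncomputable def minor (j l : Fin (k + 1)) : MatPoly k :=
  Matrix.det (Matrix.of fun i c : Fin ((j : ℕ) + 1) =>
    (X (minorRow j l i, Fin.castLE j.2 c) : MatPoly k))

theorem evalMat_minor (A : Fin (k + 1) → Fin (k + 1) → ℚ) (j l : Fin (k + 1)) :
    evalMat A (minor j l) = Matrix.det (Matrix.of fun i c : Fin ((j : ℕ) + 1) =>
      A (minorRow j l i) (Fin.castLE j.2 c)) := by
  rw [minor, RingHom.map_det]
  congr 1
  ext i c
  simp [evalMat]

theorem colInvariant_minor (j l : Fin (k + 1)) : ColInvariant (minor j l) := by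
  intro A p t ht
  rw [evalMat_minor, evalMat_minor]
  have htp : t p = 0 := by
    by_contra h
    exact lt_irrefl _ (ht p h)
  by_cases hp : (p : ℕ) < j + 1
  · rw [← Matrix.det_transpose, ← Matrix.det_transpose (Matrix.of _)]
    exact Matrix.det_eq_of_forall_row_eq_smul_add_const (fun c => t (Fin.castLE j.2 c)) ⟨p, hp⟩ htp
      fun c i => rfl
  · congr 1
    ext i c
    have : t (Fin.castLE j.2 c) = 0 := by
      by_contra h
      have h1 := Fin.lt_def.1 (ht _ h)
      have h2 := c.2
      rw [Fin.val_castLE] at h1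
      omega
    simp [this]

theorem rowInvariant_minor {m : ℕ} {j l : Fin (k + 1)} (hl : l = j ∨ m ≤ l) :
    RowInvariant m (minor j l) := by
  intro A p t ht
  rw [evalMat_minor, evalMat_minor]
  have htp : t p = 0 := by
    by_contra h
    exact lt_irrefl _ (ht p h).1
  have hrow : ∀ i : Fin ((j : ℕ) + 1), t (minorRow j l i) ≠ 0 → (p : ℕ) < j := by
    intro i hi
    have h1 := ht _ hi
    rw [minorRow] at h1
    have h2 := Fin.lt_def.1 h1.1
    split_ifs at h1 h2 with h
    · rw [Fin.val_castLE] at h2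
      omega
    · rcases hl with rfl | hl
      · exact h2
      · exact absurd h1.2 (by omega)
  by_cases hp : (p : ℕ) < j
  · have hpr : minorRow j l ⟨p, by omega⟩ = p := by
      rw [minorRow, if_pos hp]
      rfl
    refine Matrix.det_eq_of_forall_row_eq_smul_add_const (fun i => t (minorRow j l i))
      ⟨p, by omega⟩ (by rw [hpr, htp]) fun i c => ?_
    simp only [Matrix.of_apply, hpr]
  · congr 1
    ext i c
    have : t (minorRow j l i) = 0 := by
      by_contra h
      exact hp (hrow i h)
    simp [this]

theorem isWeightedHomogeneous_minor {w : Fin (k + 1) × Fin (k + 1) → ℕ → ℤ}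
    (x y : Fin (k + 1) → ℕ → ℤ) (hw : ∀ v, w v = x v.1 + y v.2) (j l : Fin (k + 1)) :
    IsWeightedHomogeneous w (minor j l)
      (∑ i : Fin ((j : ℕ) + 1), (x (minorRow j l i) + y (Fin.castLE j.2 i))) := by
  rw [minor, Matrix.det_apply]
  refine IsWeightedHomogeneous.sum _ _ _ fun τ _ => ?_
  rw [Units.smul_def]
  refine Submodule.smul_of_tower_mem (weightedHomogeneousSubmodule ℚ w _) _ ?_
  rw [mem_weightedHomogeneousSubmodule, Finset.sum_add_distrib,
    ← Equiv.sum_comp τ (fun i => x (minorRow j l i)), ← Finset.sum_add_distrib]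
  refine IsWeightedHomogeneous.prod _ _ _ fun i _ => ?_
  have := isWeightedHomogeneous_X ℚ w (minorRow j l (τ i), Fin.castLE j.2 i)
  rwa [hw] at this

/-- The sum of the first `n` unit vectors. -/
def firstOnes (n : ℕ) : ℕ → ℤ := ∑ i ∈ Finset.range n, Pi.single i 1

theorem firstOnes_succ (n : ℕ) : firstOnes (n + 1) = firstOnes n + Pi.single n 1 :=
  Finset.sum_range_succ _ _

theorem rowWeight_minor (j l : Fin (k + 1)) :
    IsWeightedHomogeneous rowWeight (minor j l) (firstOnes j + Pi.single (l : ℕ) 1) := by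
  have := isWeightedHomogeneous_minor (w := rowWeight) (fun r => Pi.single (r : ℕ) 1) 0
    (fun v => by simp [rowWeight]) j l
  convert this using 1
  rw [Fin.sum_univ_castSucc]
  simp [firstOnes, minorRow, Finset.sum_range]

theorem colWeight_minor (j l : Fin (k + 1)) :
    IsWeightedHomogeneous colWeight (minor j l) (firstOnes (j + 1)) := by
  have := isWeightedHomogeneous_minor (w := colWeight) 0 (fun r => Pi.single (r : ℕ) 1)
    (fun v => by simp [colWeight]) j l
  convert this using 1
  simp [firstOnes, Finset.sum_range]

theorem evalMat_minor_eq_one {j l : Fin (k + 1)} (hl : l = j ∨ l = Fin.last k) :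
    evalMat (fun r c : Fin (k + 1) => if (r : ℕ) < k then if r = c then (1 : ℚ) else 0 else 1)
      (minor j l) = 1 := by
  rw [evalMat_minor, Matrix.det_of_isLowerTriangular, Finset.prod_eq_one]
  · intro i _
    rw [Matrix.of_apply, minorRow]
    by_cases hi : (i : ℕ) < j
    · simp [hi]
    · have hij : Fin.castLE j.2 i = j := Fin.ext (by rw [Fin.val_castLE]; omega)
      rw [if_neg hi, hij]
      rcases hl with rfl | rfl <;> simp
  · intro i c hic
    have hic' : (i : ℕ) < c := hic
    have hi : (i : ℕ) < j := by omega
    have hj := j.2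
    rw [Matrix.of_apply, minorRow, if_pos hi, if_pos (by rw [Fin.val_castLE]; omega), if_neg]
    intro h
    have := Fin.ext_iff.1 h
    rw [Fin.val_castLE, Fin.val_castLE] at this
    omega

/-- The product of minors which is, for interlacing `ν` and `ρ` and `ρ k = 0`, the `gl_k`-highest
weight vector of weight `ρ 0, …, ρ (k - 1)` in the irreducible module of highest weight `ν`. -/
noncomputable def minorProduct (k : ℕ) (ν ρ : ℕ → ℤ) : MatPoly k :=
  (∏ j : Fin k, (minor j.castSucc j.castSucc ^ (ρ j - ν (j + 1)).toNat *
    minor j.succ (Fin.last k) ^ (ν (j + 1) - ρ (j + 1)).toNat)) *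
    minor 0 (Fin.last k) ^ (ν 0 - ρ 0).toNat

/-- The coordinates of a weight up to `k`. -/
def trunc (k : ℕ) (ν : ℕ → ℤ) : ℕ → ℤ := ∑ j ∈ Finset.range (k + 1), ν j • Pi.single j 1

theorem trunc_apply (ν : ℕ → ℤ) (i : ℕ) : trunc k ν i = if i ≤ k then ν i else 0 := by
  rw [trunc, Finset.sum_apply]
  simp [Pi.single_apply]

section Weights

variable {ν ρ : ℕ → ℤ}

theorem rowWeight_sum (n : ℕ) (x : ℕ → ℤ) :
    ∑ j ∈ Finset.range n, ((ρ j - ν (j + 1)) • (firstOnes j + Pi.single j 1) +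
      (ν (j + 1) - ρ (j + 1)) • (firstOnes (j + 1) + x)) + (ν 0 - ρ 0) • (firstOnes 0 + x) =
    ∑ j ∈ Finset.range n, ρ j • Pi.single j 1 - ρ n • firstOnes n +
      (∑ j ∈ Finset.range (n + 1), (ν j - ρ j)) • x := by
  induction n with
  | zero => simp [firstOnes]
  | succ n ih =>
    rw [Finset.sum_range_succ, add_right_comm, ih,
      Finset.sum_range_succ (fun j => ρ j • (Pi.single j 1 : ℕ → ℤ)) n,
      Finset.sum_range_succ (fun j => ν j - ρ j) (n + 1), firstOnes_succ]
    module

theorem colWeight_sum (n : ℕ) :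
    ∑ j ∈ Finset.range n, ((ρ j - ν (j + 1)) • firstOnes (j + 1) +
      (ν (j + 1) - ρ (j + 1)) • firstOnes (j + 1 + 1)) + (ν 0 - ρ 0) • firstOnes (0 + 1) =
    ∑ j ∈ Finset.range (n + 1), ν j • Pi.single j 1 - ρ n • firstOnes (n + 1) := by
  induction n with
  | zero =>
    simp only [firstOnes, Finset.range_zero, Finset.sum_empty, zero_add, Finset.sum_range_one]
    module
  | succ n ih =>
    rw [Finset.sum_range_succ, add_right_comm, ih, Finset.sum_range_succ _ (n + 1),
      firstOnes_succ (n + 1)]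
    module

theorem isWeightedHomogeneous_minorProduct (h1 : ∀ j < k, ν (j + 1) ≤ ρ j) (h2 : ∀ j ≤ k, ρ j ≤ ν j)
    {w : Fin (k + 1) × Fin (k + 1) → ℕ → ℤ}
    (x y : ℕ → ℕ → ℤ)
    (hx : ∀ j : Fin (k + 1), IsWeightedHomogeneous w (minor j j) (x j))
    (hy : ∀ j : Fin (k + 1), IsWeightedHomogeneous w (minor j (Fin.last k)) (y j)) :
    IsWeightedHomogeneous w (minorProduct k ν ρ)
      (∑ j ∈ Finset.range k, ((ρ j - ν (j + 1)) • x j + (ν (j + 1) - ρ (j + 1)) • y (j + 1)) +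
        (ν 0 - ρ 0) • y 0) := by
  have hpow : ∀ {g : MatPoly k} {d : ℕ → ℤ} {n : ℤ}, 0 ≤ n → IsWeightedHomogeneous w g d →
      IsWeightedHomogeneous w (g ^ n.toNat) (n • d) := by
    intro g d n hn hg
    obtain ⟨n, rfl⟩ := Int.eq_ofNat_of_zero_le hn
    rw [Int.toNat_natCast, natCast_zsmul]
    exact hg.pow n
  rw [Finset.sum_range]
  refine IsWeightedHomogeneous.mul (IsWeightedHomogeneous.prod _ _ _ fun j _ => ?_) ?_
  · refine IsWeightedHomogeneous.mul (hpow (sub_nonneg.2 (h1 j j.2)) ?_)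
      (hpow (sub_nonneg.2 (h2 _ j.2)) ?_)
    · exact hx j.castSucc
    · exact hy j.succ
  · exact hpow (sub_nonneg.2 (h2 0 (Nat.zero_le _))) (hy 0)

theorem rowWeight_minorProduct (h1 : ∀ j < k, ν (j + 1) ≤ ρ j) (h2 : ∀ j ≤ k, ρ j ≤ ν j)
    (h0 : ρ k = 0) :
    IsWeightedHomogeneous rowWeight (minorProduct k ν ρ)
      (∑ j ∈ Finset.range k, ρ j • Pi.single j 1 +
        (∑ j ∈ Finset.range (k + 1), ν j - ∑ j ∈ Finset.range k, ρ j) • Pi.single k 1) := by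
  have := isWeightedHomogeneous_minorProduct h1 h2 (w := rowWeight)
    (fun j => firstOnes j + Pi.single j 1) (fun j => firstOnes j + Pi.single k 1)
    (fun j => rowWeight_minor j j) (fun j => by
      have := rowWeight_minor j (Fin.last k)
      rwa [Fin.val_last] at this)
  rw [rowWeight_sum, h0, zero_smul, sub_zero, Finset.sum_sub_distrib,
    Finset.sum_range_succ ρ, h0, add_zero] at this
  exact this

theorem colWeight_minorProduct (h1 : ∀ j < k, ν (j + 1) ≤ ρ j) (h2 : ∀ j ≤ k, ρ j ≤ ν j)
    (h0 : ρ k = 0) :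
    IsWeightedHomogeneous colWeight (minorProduct k ν ρ) (trunc k ν) := by
  have := isWeightedHomogeneous_minorProduct h1 h2 (w := colWeight)
    (fun j => firstOnes (j + 1)) (fun j => firstOnes (j + 1))
    (fun j => colWeight_minor j j) (fun j => colWeight_minor j _)
  rw [colWeight_sum, h0, zero_smul, sub_zero] at this
  exact this

end Weights

theorem minorProduct_ne_zero (ν ρ : ℕ → ℤ) : minorProduct k ν ρ ≠ 0 := by
  intro h
  have := congrArg
    (evalMat fun r c : Fin (k + 1) => if (r : ℕ) < k then if r = c then (1 : ℚ) else 0 else 1) h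
  simp only [minorProduct, map_mul, map_prod, map_pow, evalMat_minor_eq_one (Or.inl rfl),
    evalMat_minor_eq_one (Or.inr rfl), map_zero] at this
  simp at this

theorem evalMat_minorProduct_congr {ν ρ : ℕ → ℤ} {A A' : Fin (k + 1) → Fin (k + 1) → ℚ}
    (h1 : ∀ j, evalMat A (minor j j) = evalMat A' (minor j j))
    (h2 : ∀ j : Fin (k + 1), ν j ≠ ρ j →
      evalMat A (minor j (Fin.last k)) = evalMat A' (minor j (Fin.last k))) :
    evalMat A (minorProduct k ν ρ) = evalMat A' (minorProduct k ν ρ) := by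
  have h3 : ∀ j : Fin (k + 1), evalMat A (minor j (Fin.last k)) ^ (ν j - ρ j).toNat =
      evalMat A' (minor j (Fin.last k)) ^ (ν j - ρ j).toNat := by
    intro j
    by_cases h : ν j = ρ j
    · rw [h, sub_self, Int.toNat_zero, pow_zero, pow_zero]
    · rw [h2 j h]
  simp only [minorProduct, map_mul, map_prod, map_pow, h1]
  congr 1
  · refine Finset.prod_congr rfl fun j _ => ?_
    congr 1
    exact h3 j.succ
  · exact h3 0

theorem colInvariant_minorProduct (ν ρ : ℕ → ℤ) : ColInvariant (minorProduct k ν ρ) :=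
  fun A p t ht => evalMat_minorProduct_congr (fun j => colInvariant_minor j j A p t ht)
    fun j _ => colInvariant_minor j _ A p t ht

theorem rowInvariant_minorProduct (ν ρ : ℕ → ℤ) : RowInvariant k (minorProduct k ν ρ) :=
  fun A p t ht => evalMat_minorProduct_congr
    (fun j => rowInvariant_minor (Or.inl rfl) A p t ht)
    fun j _ => rowInvariant_minor (Or.inr (by rw [Fin.val_last])) A p t ht

theorem rowInvariant_minorProduct_self {ν ρ : ℕ → ℤ} (h : ∀ j < k, ρ j = ν j) :
    RowInvariant (k + 1) (minorProduct k ν ρ) :=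
  fun A p t ht => evalMat_minorProduct_congr
    (fun j => rowInvariant_minor (Or.inl rfl) A p t ht)
    fun j hj => by
      have : j = Fin.last k := by
        by_contra hne
        exact hj (h j (Fin.val_lt_last hne)).symm
      rw [this]
      exact rowInvariant_minor (Or.inl rfl) A p t ht

end Minors

section RowModule

variable {k : ℕ}

/-- The raising operators on the rows of a matrix. -/
def rowUp (i : Fin k) : (Fin (k + 1) × Fin (k + 1)) ≃. (Fin (k + 1) × Fin (k + 1)) where
  toFun v := if v.1 = i.succ then some (i.castSucc, v.2) else none
  invFun v := if v.1 = i.castSucc then some (i.succ, v.2) else none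
  inv := by
    rintro ⟨a, b⟩ ⟨c, d⟩
    simp only [Option.ite_none_right_eq_some, Option.some.injEq, Prod.mk.injEq]
    grind

theorem rowUp_apply (i : Fin k) (v : Fin (k + 1) × Fin (k + 1)) :
    rowUp i v = if v.1 = i.succ then some (i.castSucc, v.2) else none := rfl

theorem rowUp_symm_apply (i : Fin k) (v : Fin (k + 1) × Fin (k + 1)) :
    (rowUp i).symm v = if v.1 = i.castSucc then some (i.succ, v.2) else none := rfl

/-- The polynomials in matrix entries as a module for the row operations. -/
noncomputable def rowModule (k : ℕ) : ContravariantModule k (MatPoly k) :=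
  polynomialModule k rowWeight rowUp (fun v => by rw [rowWeight, Pi.single_pos]; exact one_pos)
    (fun _ => Set.toFinite _)
    (fun i s t h => by
      rw [rowUp_apply, Option.ite_none_right_eq_some] at h
      obtain ⟨h1, h2⟩ := h
      rw [← Option.some.inj h2, rowWeight, rowWeight, h1, root, Fin.val_succ, Fin.val_castSucc]
      abel)
    (fun i j s => by
      have hi := Fin.val_castSucc i
      by_cases hij : i = j
      · subst hij
        simp only [rowUp_apply, rowUp_symm_apply, if_true]
        by_cases h1 : s.1 = i.castSucc
        · have h2 : s.1 ≠ i.succ := fun h => by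
            have := Fin.ext_iff.1 (h1.symm.trans h)
            rw [Fin.val_castSucc, Fin.val_succ] at this
            omega
          rw [if_pos h1, if_neg h2, optX_some, optX_none, shift_X, map_zero, rowUp_apply,
            if_pos rfl, optX_some, ← h1, rowWeight, h1, Fin.val_castSucc]
          simp [← h1]
        · by_cases h2 : s.1 = i.succ
          · rw [if_neg h1, if_pos h2, optX_some, optX_none, shift_X, map_zero, rowUp_symm_apply,
              if_pos rfl, optX_some, ← h2, rowWeight, h2, Fin.val_succ]
            simp [← h2]
          · have h3 : (s.1 : ℕ) ≠ i := fun h => h1 (Fin.ext h)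
            have h4 : (s.1 : ℕ) ≠ i + 1 := fun h => h2 (Fin.ext h)
            rw [if_neg h1, if_neg h2, optX_none, map_zero, map_zero, rowWeight,
              Pi.single_eq_of_ne h3.symm, Pi.single_eq_of_ne h4.symm]
            simp
      · have hs : j.succ ≠ i.succ := fun h => hij (Fin.succ_injective _ h).symm
        have hc : i.castSucc ≠ j.castSucc := fun h => hij (Fin.castSucc_injective _ h)
        rw [if_neg hij, add_zero, rowUp_apply, rowUp_symm_apply]
        split_ifs <;> simp [rowUp_apply, rowUp_symm_apply, hs, hc])

theorem rowModule_E (i : Fin k) (f : MatPoly k) :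
    (rowModule k).E i f = rowDer i.castSucc (Pi.single i.succ 1) f := by
  have : shift (rowUp i) = rowDer i.castSucc (Pi.single i.succ 1) := by
    refine MvPolynomial.derivation_ext (R := ℚ) fun v => ?_
    rw [shift_X, rowUp_apply, rowDer, mkDerivation_X]
    by_cases h : v.1 = i.succ
    · simp [h]
    · simp [h]
  exact congrArg (fun D : Derivation ℚ (MatPoly k) (MatPoly k) => D f) this

/-- The polynomials of column weight `κ` which are invariant under adding multiples of columns to
later columns. -/
noncomputable def colHighest (k : ℕ) (κ : ℕ → ℤ) : Submodule ℚ (MatPoly k) :=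
  weightedHomogeneousSubmodule ℚ colWeight κ ⊓
    ⨅ x : {x : Fin (k + 1) × (Fin (k + 1) → ℚ) // ∀ c, x.2 c ≠ 0 → x.1 < c},
      LinearMap.ker (colDer x.1.1 x.1.2 : MatPoly k →ₗ[ℚ] MatPoly k)

theorem mem_colHighest {κ : ℕ → ℤ} {f : MatPoly k} :
    f ∈ colHighest k κ ↔ IsWeightedHomogeneous colWeight f κ ∧ ColInvariant f := by
  rw [colHighest, Submodule.mem_inf, mem_weightedHomogeneousSubmodule, colInvariant_iff]
  simp

theorem derivation_mem_colHighest {κ : ℕ → ℤ} (p : (Fin (k + 1) × Fin (k + 1)) ≃.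
      (Fin (k + 1) × Fin (k + 1))) (q : Fin (k + 1) → Option (Fin (k + 1)))
    (hp : ∀ v, p v = (q v.1).map fun r => (r, v.2)) {f : MatPoly k} (hf : f ∈ colHighest k κ) :
    shift p f ∈ colHighest k κ := by
  rw [mem_colHighest] at hf ⊢
  constructor
  · rw [← add_zero κ]
    refine derivation_isWeightedHomogeneous _ (fun v => ?_) hf.1
    rw [shift_X, hp, add_zero]
    cases q v.1 with
    | none => exact isWeightedHomogeneous_zero ℚ _ _
    | some r => exact isWeightedHomogeneous_X ℚ colWeight (r, v.2)
  · rw [colInvariant_iff] at hf ⊢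
    intro c t ht
    have h : ⁅colDer c t, shift p⁆ = 0 := by
      refine MvPolynomial.derivation_ext (R := ℚ) fun v => ?_
      rw [Derivation.commutator_apply, shift_X, hp, colDer, mkDerivation_X, Derivation.leibniz,
        shift_X, hp, derivation_C]
      cases q v.1 <;> simp
    have h' := congrArg (fun D : Derivation ℚ (MatPoly k) (MatPoly k) => D f) h
    simp only [Derivation.commutator_apply, hf.2 c t ht, map_zero, sub_zero,
      Derivation.coe_zero, Pi.zero_apply] at h'
    exact h'

theorem E_mem_colHighest {κ : ℕ → ℤ} (i : Fin k) {f : MatPoly k} (hf : f ∈ colHighest k κ) :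
    (rowModule k).E i f ∈ colHighest k κ :=
  derivation_mem_colHighest (rowUp i) (fun r => if r = i.succ then some i.castSucc else none)
    (fun v => by rw [rowUp_apply]; split_ifs <;> rfl) hf

theorem F_mem_colHighest {κ : ℕ → ℤ} (i : Fin k) {f : MatPoly k} (hf : f ∈ colHighest k κ) :
    (rowModule k).F i f ∈ colHighest k κ :=
  derivation_mem_colHighest (rowUp i).symm
    (fun r => if r = i.castSucc then some i.succ else none)
    (fun v => by rw [rowUp_symm_apply]; split_ifs <;> rfl) hf

theorem act_mem_colHighest {κ : ℕ → ℤ} (c : Words k) {f : MatPoly k} (hf : f ∈ colHighest k κ) :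
    (rowModule k).act c f ∈ colHighest k κ := by
  induction c using Finsupp.induction_linear with
  | zero => simp
  | add a b ha hb => simpa using Submodule.add_mem _ ha hb
  | single w q =>
    rw [ContravariantModule.act_single]
    refine Submodule.smul_mem _ _ ?_
    induction w with
    | nil => exact hf
    | cons i w ih => exact F_mem_colHighest i ih

theorem rowInvariant_iff_E {m : ℕ} {f : MatPoly k} :
    RowInvariant m f ↔ ∀ i : Fin k, (i : ℕ) + 1 < m → (rowModule k).E i f = 0 := by
  constructor
  · intro h i hi
    rw [rowModule_E]
    refine rowInvariant_iff.1 h _ _ fun r hr => ?_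
    have : r = i.succ := by
      by_contra h
      exact hr (Pi.single_eq_of_ne h _)
    rw [this]
    exact ⟨Fin.castSucc_lt_succ, by rwa [Fin.val_succ]⟩
  · intro h
    exact rowInvariant_of_adjacent fun i hi => by rw [← rowModule_E]; exact h i hi

/-- For given weights, there is at most one invariant polynomial up to scalars. -/
theorem exists_eq_smul {ρ ν : ℕ → ℤ} {f g : MatPoly k} (hf : IsWeightedHomogeneous rowWeight f ρ)
    (hf' : RowInvariant k f) (hfc : f ∈ colHighest k ν) (hg : IsWeightedHomogeneous rowWeight g ρ)
    (hg' : RowInvariant k g) (hgc : g ∈ colHighest k ν) (h0 : g ≠ 0) : ∃ s : ℚ, f = s • g := by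
  have hgcol := mem_colHighest.1 hgc
  have hc : coeff (normalMonomial k ρ ν) g ≠ 0 := fun h =>
    h0 (eq_zero_of_coeff_normalMonomial hg hgcol.1 hg' hgcol.2 h)
  set s := coeff (normalMonomial k ρ ν) f / coeff (normalMonomial k ρ ν) g with hs
  refine ⟨s, sub_eq_zero.1 ?_⟩
  have hmem := mem_colHighest.1 (Submodule.sub_mem _ hfc (Submodule.smul_mem _ s hgc))
  refine eq_zero_of_coeff_normalMonomial (ρ := ρ) ?_ hmem.1 ?_ hmem.2 ?_
  · exact Submodule.sub_mem (weightedHomogeneousSubmodule ℚ rowWeight ρ) hf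
      (Submodule.smul_mem _ s hg)
  · rw [rowInvariant_iff_E] at hf' hg' ⊢
    intro i hi
    rw [map_sub, map_smul, hf' i hi, hg' i hi, smul_zero, sub_zero]
  · rw [coeff_sub, coeff_smul, smul_eq_mul, hs, div_mul_cancel₀ _ hc, sub_self]

theorem weight_rowWeight_of_lt (a : Fin (k + 1) × Fin (k + 1) →₀ ℕ) {j : ℕ} (hj : k < j) :
    Finsupp.weight rowWeight a j = 0 := by
  rw [Finsupp.weight_apply, Finsupp.sum, Finset.sum_apply]
  refine Finset.sum_eq_zero fun v _ => ?_
  have : j ≠ v.1 := by have := v.1.2; omega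
  simp [rowWeight, this]

/-- Both sums are the degree. -/
theorem sum_weight_eq (a : Fin (k + 1) × Fin (k + 1) →₀ ℕ) :
    ∑ j ∈ Finset.range (k + 1), Finsupp.weight rowWeight a j =
      ∑ j ∈ Finset.range (k + 1), Finsupp.weight colWeight a j := by
  rw [Finset.sum_range, Finset.sum_range]
  simp only [weight_rowWeight, weight_colWeight]
  exact Finset.sum_comm

theorem gaps_trunc (ν : ℕ → ℤ) : gaps k (trunc k ν) = gaps k ν := by
  funext i
  have := i.2
  rw [gaps, gaps, trunc_apply, trunc_apply, if_pos (by omega), if_pos (by omega)]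

/-- The coordinates of a weight before `k`. -/
def cut (k : ℕ) (ρ : ℕ → ℤ) : ℕ → ℤ := fun j => if j < k then ρ j else 0

/-- The invariant polynomial of row weight `e` and column weight `ν`. -/
theorem minorProduct_mem {ν e : ℕ → ℤ} (h1 : ∀ j < k, ν (j + 1) ≤ e j ∧ e j ≤ ν j)
    (h0 : 0 ≤ ν k)
    (hsum : ∑ j ∈ Finset.range (k + 1), ν j = ∑ j ∈ Finset.range (k + 1), e j) :
    IsWeightedHomogeneous rowWeight (minorProduct k ν (cut k e)) (trunc k e) ∧
      minorProduct k ν (cut k e) ∈ colHighest k (trunc k ν) := by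
  have hlow : ∀ j < k, ν (j + 1) ≤ cut k e j := fun j hj => by
    rw [cut, if_pos hj]; exact (h1 j hj).1
  have hup : ∀ j ≤ k, cut k e j ≤ ν j := fun j hj => by
    rw [cut]
    split_ifs with h
    · exact (h1 j h).2
    · rwa [le_antisymm hj (not_lt.1 h)]
  have hk : cut k e k = 0 := if_neg (lt_irrefl k)
  refine ⟨?_, mem_colHighest.2 ⟨colWeight_minorProduct hlow hup hk,
    colInvariant_minorProduct _ _⟩⟩
  have := rowWeight_minorProduct hlow hup hk
  have hs : ∑ j ∈ Finset.range k, cut k e j = ∑ j ∈ Finset.range k, e j :=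
    Finset.sum_congr rfl fun j hj => if_pos (Finset.mem_range.1 hj)
  have hs' : ∑ j ∈ Finset.range k, cut k e j • (Pi.single j 1 : ℕ → ℤ) =
      ∑ j ∈ Finset.range k, e j • (Pi.single j 1 : ℕ → ℤ) :=
    Finset.sum_congr rfl fun j hj => by rw [cut, if_pos (Finset.mem_range.1 hj)]
  rw [hsum, hs, hs', Finset.sum_range_succ e, add_sub_cancel_left] at this
  rw [trunc, Finset.sum_range_succ]
  exact this

theorem wordWeight_of_lt (w : List (Fin k)) {j : ℕ} (hj : k < j) : wordWeight w j = 0 := by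
  induction w with
  | nil => rfl
  | cons i w ih =>
    have h1 : j ≠ i := by omega
    have h2 : j ≠ i + 1 := by omega
    rw [wordWeight_cons, Pi.add_apply, ih, root, Pi.sub_apply, Pi.single_eq_of_ne h1,
      Pi.single_eq_of_ne h2]
    rfl

theorem sum_wordWeight (w : List (Fin k)) :
    ∑ j ∈ Finset.range (k + 1), wordWeight w j = 0 := by
  induction w with
  | nil => simp
  | cons i w ih =>
    have h1 : (i : ℕ) ∈ Finset.range (k + 1) := Finset.mem_range.2 (by omega)
    have h2 : (i : ℕ) + 1 ∈ Finset.range (k + 1) := Finset.mem_range.2 (by omega)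
    simp only [wordWeight_cons, Pi.add_apply, Finset.sum_add_distrib, ih, root, Pi.sub_apply,
      Finset.sum_sub_distrib, Pi.single_apply, Finset.sum_ite_eq', h1, h2, if_true]
    rfl

section Dominant

variable {ν e : ℕ → ℤ}

/-- The highest weight vector that generates `colHighest`. -/
theorem minorProduct_mem_highest (h0 : 0 ≤ ν k) (hd : ∀ i < k, ν (i + 1) ≤ ν i) :
    minorProduct k ν (cut k ν) ∈ (rowModule k).highest (trunc k ν) ∧
      minorProduct k ν (cut k ν) ∈ colHighest k (trunc k ν) := by
  have h := minorProduct_mem (fun j hj => ⟨hd j hj, le_rfl⟩) h0 rfl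
  refine ⟨(ContravariantModule.mem_highest _).2 ⟨h.1, fun i => ?_⟩, h.2⟩
  exact rowInvariant_iff_E.1 (rowInvariant_minorProduct_self fun j hj => if_pos hj) i
    (Nat.succ_lt_succ i.2)

/-- `colHighest` is a cyclic module: its highest weight vectors are the multiples of `minorProduct`,
as both the weights and, for given weights, the invariant polynomial are determined. -/
theorem exists_act_minorProduct_eq (h0 : 0 ≤ ν k) (hd : ∀ i < k, ν (i + 1) ≤ ν i) {f : MatPoly k}
    (hf : f ∈ (rowModule k).generated (colHighest k (trunc k ν)) e) :
    ∃ c ∈ Finsupp.supported ℚ ℚ {w : List (Fin k) | trunc k ν - wordWeight w = e},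
      (rowModule k).act c (minorProduct k ν (cut k ν)) = f := by
  obtain ⟨hv, hvC⟩ := minorProduct_mem_highest h0 hd
  rw [ContravariantModule.mem_highest] at hv
  refine (Submodule.span_le (p := (Finsupp.supported ℚ ℚ
    {w : List (Fin k) | trunc k ν - wordWeight w = e}).map
      ((rowModule k).act.flip (minorProduct k ν (cut k ν))))).2 ?_ hf
  rintro _ ⟨ν', v', ⟨hv', hvC'⟩, w, rfl, rfl⟩
  rw [SetLike.mem_coe, ContravariantModule.mem_highest] at hv'
  by_cases h : v' = 0
  · rw [h, map_zero]
    exact Submodule.zero_mem _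
  have hrow : RowInvariant (k + 1) v' := rowInvariant_iff_E.2 fun i _ => hv'.2 i
  have hcol := mem_colHighest.1 hvC'
  have hW : IsWeightedHomogeneous rowWeight v' ν' := hv'.1
  have hc : coeff (normalMonomial k ν' (trunc k ν)) v' ≠ 0 := fun h' =>
    h (eq_zero_of_coeff_normalMonomial hW hcol.1 (hrow.mono (Nat.le_succ k)) hcol.2 h')
  have hsum : ∑ j ∈ Finset.range (k + 1), ν' j = ∑ j ∈ Finset.range (k + 1), trunc k ν j := by
    conv_lhs => rw [← hW hc]
    conv_rhs => rw [← hcol.1 hc]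
    exact sum_weight_eq _
  have heq : ν' = trunc k ν := by
    have hlt : ∀ j < k, ν' j = trunc k ν j := fun j hj =>
      weight_eq_of_rowInvariant hW hcol.1 hrow hc hj
    funext j
    rcases lt_trichotomy j k with hj | rfl | hj
    · exact hlt j hj
    · rw [Finset.sum_range_succ, Finset.sum_range_succ,
        Finset.sum_congr rfl fun i hi => hlt i (Finset.mem_range.1 hi)] at hsum
      exact add_left_cancel hsum
    · rw [trunc_apply, if_neg (not_le.2 hj), ← hW hc, weight_rowWeight_of_lt _ hj]
  subst heq
  obtain ⟨s, hs⟩ := exists_eq_smul hW (hrow.mono (Nat.le_succ k)) hvC' hv.1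
    (rowInvariant_iff_E.2 fun i _ => hv.2 i) hvC (minorProduct_ne_zero _ _)
  refine ⟨Finsupp.single w s, Finsupp.single_mem_supported ℚ _ rfl, ?_⟩
  rw [LinearMap.flip_apply, ContravariantModule.act_single, hs, map_smul]

/-- The universal combinations of words may be tested on the highest weight vector `minorProduct`. -/
theorem act_minorProduct_of_admissible (h0 : 0 ≤ ν k) (hd : ∀ i < k, ν (i + 1) ≤ ν i)
    (he : ν - trunc k ν = e - trunc k e) {a : Words k} (ha : Admissible k ν e a) :
    IsWeightedHomogeneous rowWeight ((rowModule k).act a (minorProduct k ν (cut k ν)))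
        (trunc k e) ∧
      RowInvariant k ((rowModule k).act a (minorProduct k ν (cut k ν))) ∧
      (rowModule k).act a (minorProduct k ν (cut k ν)) ∈ colHighest k (trunc k ν) := by
  obtain ⟨hv, hvC⟩ := minorProduct_mem_highest h0 hd
  rw [ContravariantModule.mem_highest] at hv
  refine ⟨?_, rowInvariant_iff_E.2 fun i hi => ?_, act_mem_colHighest a hvC⟩
  · rw [ContravariantModule.act, Finsupp.linearCombination_apply, Finsupp.sum, LinearMap.sum_apply]
    refine Submodule.sum_mem (weightedHomogeneousSubmodule ℚ rowWeight (trunc k e)) fun w hw => ?_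
    have h1 : ν - wordWeight w = e := (Finsupp.mem_supported ℚ a).1 ha.1 hw
    have h2 : trunc k ν - wordWeight w = trunc k e := by
      rw [← h1] at he ⊢
      rw [← sub_eq_zero] at he ⊢
      rw [← neg_eq_zero, ← he]
      abel
    have h3 := (rowModule k).lower_mem hv.1 w
    rw [h2] at h3
    exact Submodule.smul_mem _ _ h3
  · rw [ContravariantModule.E_act _ hv.1 hv.2, ContravariantModule.act_eq_zero_iff _ hv.1 hv.2
      (minorProduct_ne_zero _ _), gaps_trunc]
    exact ha.2 i hi

/-- Whenever the weights interlace, there is exactly one combination of words, up to scalars and the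
radical, that leads from highest weight vectors of weight `ν` to `gl_k`-highest weight vectors of
weight `e`. -/
theorem exists_admissible (h : Interlace k ν e) :
    ∃ c, Admissible k ν e c ∧ ¬ Null (gaps k ν) c ∧
      ∀ a, Admissible k ν e a → ∃ s : ℚ, Null (gaps k ν) (a - s • c) := by
  obtain ⟨h1, h0, htail, hsum⟩ := h
  have hd : ∀ i < k, ν (i + 1) ≤ ν i := fun i hi => (h1 i hi).1.trans (h1 i hi).2
  have he : ν - trunc k ν = e - trunc k e := by
    funext j
    rw [Pi.sub_apply, Pi.sub_apply, trunc_apply, trunc_apply]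
    split_ifs with hj
    · rw [sub_self, sub_self]
    · rw [htail j (not_le.1 hj)]
  obtain ⟨hv, hvC⟩ := minorProduct_mem_highest h0 hd
  rw [ContravariantModule.mem_highest] at hv
  have hnull : ∀ c, (rowModule k).act c (minorProduct k ν (cut k ν)) = 0 ↔
      Null (gaps k ν) c := fun c => by
    rw [ContravariantModule.act_eq_zero_iff _ hv.1 hv.2 (minorProduct_ne_zero _ _), gaps_trunc]
  obtain ⟨hf, hfC⟩ := minorProduct_mem h1 h0 hsum
  obtain ⟨c, hc, hcf⟩ := exists_act_minorProduct_eq h0 hd ((rowModule k).mem_generated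
    (fun i u hu => E_mem_colHighest i hu) (fun i u hu => F_mem_colHighest i hu) hf hfC)
  refine ⟨c, ⟨?_, fun i hi => ?_⟩, ?_, fun a ha => ?_⟩
  · refine Finsupp.supported_mono (fun w hw => ?_) hc
    have hw' : trunc k ν - wordWeight w = trunc k e := hw
    have : ν - wordWeight w = (ν - trunc k ν) + (trunc k ν - wordWeight w) := by abel
    rw [Set.mem_ofPred_eq, this, hw', he, sub_add_cancel]
  · rw [← hnull, ← gaps_trunc, ← ContravariantModule.E_act _ hv.1 hv.2, hcf]
    exact rowInvariant_iff_E.1 (rowInvariant_minorProduct _ _) i hi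
  · rw [← hnull, hcf]
    exact minorProduct_ne_zero _ _
  · obtain ⟨ha1, ha2, ha3⟩ := act_minorProduct_of_admissible h0 hd he ha
    obtain ⟨s, hs⟩ := exists_eq_smul ha1 ha2 ha3 hf (rowInvariant_minorProduct _ _) hfC
      (minorProduct_ne_zero _ _)
    refine ⟨s, (hnull _).1 ?_⟩
    rw [map_sub, map_smul, LinearMap.sub_apply, LinearMap.smul_apply, hcf, hs, sub_self]

/-- Only weights which interlace contribute to the branching. -/
theorem null_of_admissible (hν : 0 ≤ ν) (hd : ∀ i < k, ν (i + 1) ≤ ν i)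
    (h : ¬ Interlace k ν e) {a : Words k} (ha : Admissible k ν e a) : Null (gaps k ν) a := by
  by_cases hne : a = 0
  · rw [hne]
    intro w
    simp
  obtain ⟨w, hw⟩ := Finsupp.support_nonempty_iff.2 hne
  have hw' : ν - wordWeight w = e := (Finsupp.mem_supported ℚ a).1 ha.1 hw
  have htail : ∀ j, k < j → ν j = e j := fun j hj => by
    rw [← hw', Pi.sub_apply, wordWeight_of_lt w hj, sub_zero]
  have hsum : ∑ j ∈ Finset.range (k + 1), ν j = ∑ j ∈ Finset.range (k + 1), e j := by
    rw [← hw']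
    simp only [Pi.sub_apply, Finset.sum_sub_distrib, sum_wordWeight, sub_zero]
  have he : ν - trunc k ν = e - trunc k e := by
    funext j
    rw [Pi.sub_apply, Pi.sub_apply, trunc_apply, trunc_apply]
    split_ifs with hj
    · rw [sub_self, sub_self]
    · rw [htail j (not_le.1 hj)]
  obtain ⟨hv, hvC⟩ := minorProduct_mem_highest (hν k) hd
  rw [ContravariantModule.mem_highest] at hv
  obtain ⟨ha1, ha2, ha3⟩ := act_minorProduct_of_admissible (hν k) hd he ha
  rw [← gaps_trunc, ← ContravariantModule.act_eq_zero_iff _ hv.1 hv.2 (minorProduct_ne_zero ν _)]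
  by_contra h0
  have hcol := mem_colHighest.1 ha3
  have hc : coeff (normalMonomial k (trunc k e) (trunc k ν))
      ((rowModule k).act a (minorProduct k ν (cut k ν))) ≠ 0 := fun h' =>
    h0 (eq_zero_of_coeff_normalMonomial ha1 hcol.1 ha2 hcol.2 h')
  refine h ⟨fun j hj => ⟨?_, ?_⟩, hν k, htail, hsum⟩
  · have := le_of_coeff_normalMonomial ha1 hcol.1 ha2 hcol.2 hc hj
    rwa [trunc_apply, trunc_apply, if_pos (show j + 1 ≤ k from hj), if_pos hj.le] at this
  · have := (normalMonomial_weights ha1 hcol.1 hc).1 j hj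
    rwa [trunc_apply, trunc_apply, if_pos hj.le, if_pos hj.le] at this

end Dominant

end RowModule

/-! ### Branching from `gl_{k+1}` to `gl_k` -/

namespace ContravariantModule

variable {k : ℕ} {U : Type*} [AddCommGroup U] [Module ℚ U] (M : ContravariantModule k U)

theorem act_mem_of_supported {ν e : ℕ → ℤ} {v : U} (hv : v ∈ M.W ν) {c : Words k}
    (hc : c ∈ Finsupp.supported ℚ ℚ {w | ν - wordWeight w = e}) : M.act c v ∈ M.W e := by
  rw [act, Finsupp.linearCombination_apply, Finsupp.sum, LinearMap.sum_apply]
  refine Submodule.sum_mem _ fun w hw => ?_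
  rw [LinearMap.smul_apply]
  have : ν - wordWeight w = e := (Finsupp.mem_supported ℚ c).1 hc hw
  rw [← this]
  exact Submodule.smul_mem _ _ (M.lower_mem hv w)

theorem act_mem_subHighest {ν e : ℕ → ℤ} {v : U} (hv : v ∈ M.highest ν) {c : Words k}
    (hc : Admissible k ν e c) : M.act c v ∈ M.subHighest e := by
  by_cases h0 : v = 0
  · simp [h0]
  rw [mem_highest] at hv
  refine M.mem_subHighest.2 ⟨M.act_mem_of_supported hv.1 hc.1, fun i hi => ?_⟩
  rw [M.E_act hv.1 hv.2, M.act_eq_zero_iff hv.1 hv.2 h0]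
  exact hc.2 i hi

/-- The orthogonal projection of a `gl_k`-highest weight vector to the submodule generated by a
highest weight vector is again a `gl_k`-highest weight vector. -/
theorem exists_admissible_projection {ν e : ℕ → ℤ} {u v : U} (hu : u ∈ M.subHighest e)
    (hv : v ∈ M.highest ν) (h0 : v ≠ 0) :
    ∃ a, Admissible k ν e a ∧ ∀ w, M.form (M.lower w v) (u - M.act a v) = 0 := by
  set S : Submodule ℚ U := (Finsupp.supported ℚ ℚ {w : List (Fin k) | ν - wordWeight w = e}).map
    (M.act.flip v) with hS
  have hvW := (M.mem_highest.1 hv).1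
  have hvE := (M.mem_highest.1 hv).2
  have hSW : S ≤ M.W e := by
    rintro _ ⟨c, hc, rfl⟩
    exact M.act_mem_of_supported hvW hc
  have : FiniteDimensional ℚ S := Submodule.finiteDimensional_of_le hSW
  obtain ⟨_, ⟨a, ha, rfl⟩, hperp⟩ := M.exists_projection S u
  have ha' : M.act a v ∈ M.W e := hSW ⟨a, ha, rfl⟩
  have huW := (M.mem_subHighest.1 hu).1
  have key : ∀ w, M.form (M.lower w v) (u - M.act a v) = 0 := by
    intro w
    by_cases hw : ν - wordWeight w = e
    · refine hperp _ ⟨Finsupp.single w 1, Finsupp.single_mem_supported ℚ _ hw, ?_⟩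
      simp [act_single]
    · exact M.form_orth hw (M.lower_mem hvW w) (Submodule.sub_mem _ huW ha')
  refine ⟨a, ⟨ha, fun i hi => ?_⟩, key⟩
  rw [← M.act_eq_zero_iff hvW hvE h0]
  refine M.eq_zero_of_orthogonal_lower fun w => ?_
  rw [← M.E_act hvW hvE, ← M.adj', ← lower_cons]
  have h1 := key (i :: w)
  rw [map_sub, sub_eq_zero] at h1
  rw [← h1, lower_cons, adj', (M.mem_subHighest.1 hu).2 i hi, map_zero]

/-- The branching rule: the multiplicities of the highest weights for `gl_k` are obtained from those
for `gl_{k+1}` by summing over the interlacing weights. -/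
theorem finrank_subHighest (e : ℕ → ℤ) (T : Finset (ℕ → ℤ)) (hT : ∀ ν, ν ∈ T ↔ Interlace k ν e) :
    Module.finrank ℚ (M.subHighest e) = ∑ ν ∈ T, Module.finrank ℚ (M.highest ν) := by
  classical
  have hc : ∀ ν : T, ∃ c, Admissible k ν e c ∧ ¬ Null (gaps k ν) c ∧
      ∀ a, Admissible k ν e a → ∃ s : ℚ, Null (gaps k ν) (a - s • c) :=
    fun ν => exists_admissible ((hT ν).1 ν.2)
  choose c hcA hcN hcU using hc
  -- `Ψ` applies to a highest weight vector of weight `ν` the essentially unique combination of words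
  -- that leads from `ν` to `e`
  let Ψ : ((ν : T) → M.highest ν) →ₗ[ℚ] U :=
    ∑ ν : T, M.act (c ν) ∘ₗ (M.highest ν).subtype ∘ₗ LinearMap.proj ν
  have hΨ : ∀ x, Ψ x = ∑ ν : T, M.act (c ν) (x ν : U) := fun x => by
    simp [Ψ, LinearMap.sum_apply]
  have hmem : ∀ x, Ψ x ∈ M.subHighest e := fun x => by
    rw [hΨ]
    exact Submodule.sum_mem _ fun ν _ => M.act_mem_subHighest (x ν).2 (hcA ν)
  let Φ : ((ν : T) → M.highest ν) →ₗ[ℚ] M.subHighest e := Ψ.codRestrict _ hmem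
  have hinj : Function.Injective Φ := by
    rw [injective_iff_map_eq_zero]
    intro x hx
    have hx' : Ψ x = 0 := congrArg Subtype.val hx
    funext ν
    by_contra hne
    have hne' : (x ν : U) ≠ 0 := fun h => hne (Subtype.ext h)
    refine hcN ν ?_
    have hxν := M.mem_highest.1 (x ν).2
    rw [← M.act_eq_zero_iff hxν.1 hxν.2 hne']
    refine M.eq_zero_of_form_self ?_
    have h1 : M.form (M.act (c ν) (x ν)) (Ψ x) = 0 := by rw [hx', map_zero]
    rw [hΨ, map_sum, Finset.sum_eq_single ν] at h1
    · exact h1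
    · intro ν' _ hν'
      exact M.form_act_act_eq_zero (fun h => hν' (Subtype.ext h.symm)) (x ν).2 (x ν').2 _ _
    · simp
  have hsurj : Function.Surjective Φ := by
    rintro ⟨u, hu⟩
    have : FiniteDimensional ℚ (LinearMap.range Ψ) :=
      Submodule.finiteDimensional_of_le (S₂ := M.subHighest e) (by
        rintro _ ⟨x, rfl⟩; exact hmem x)
    obtain ⟨_, ⟨x, rfl⟩, hperp⟩ := M.exists_projection (LinearMap.range Ψ) u
    refine ⟨x, Subtype.ext ?_⟩
    have hu' : u - Ψ x ∈ M.subHighest e := Submodule.sub_mem _ hu (hmem x)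
    rw [eq_comm, ← sub_eq_zero]
    set u' := u - Ψ x with hu'_def
    -- `u'` is orthogonal to all submodules generated by highest weight vectors, hence to itself
    have hgen : ∀ y ∈ M.generated ⊤ e, M.form y u' = 0 := by
      intro y hy
      induction hy using Submodule.span_induction with
      | zero => simp
      | add a b _ _ ha hb => simp [ha, hb]
      | smul a b _ hb => simp [hb]
      | mem y hy =>
        obtain ⟨ν, v, ⟨hv, -⟩, w, -, rfl⟩ := hy
        by_cases h0 : v = 0
        · simp [h0]
        have hvm := M.mem_highest.1 hv
        obtain ⟨a, ha, haw⟩ := M.exists_admissible_projection hu' hv h0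
        suffices h : M.act a v = 0 by simpa [h] using haw w
        by_cases hI : Interlace k ν e
        · obtain ⟨s, hs⟩ := hcU ⟨ν, (hT ν).2 hI⟩ a ha
          rw [← M.act_eq_zero_iff hvm.1 hvm.2 h0, map_sub, map_smul, LinearMap.sub_apply,
            LinearMap.smul_apply, sub_eq_zero] at hs
          have h1 : M.form (M.act a v) u' = 0 := by
            rw [hs]
            have := hperp (Ψ (Pi.single ⟨ν, (hT ν).2 hI⟩ ⟨v, hv⟩)) ⟨_, rfl⟩
            rw [hΨ, Finset.sum_eq_single ⟨ν, (hT ν).2 hI⟩] at this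
            · simpa using Or.inr this
            · intro ν' _ hν'
              simp [Pi.single_eq_of_ne hν']
            · simp
          have h2 : ∀ y ∈ Submodule.span ℚ (Set.range fun w => M.lower w v),
              M.form y (u' - M.act a v) = 0 := by
            intro y hy
            induction hy using Submodule.span_induction with
            | mem y hy => obtain ⟨w, rfl⟩ := hy; exact haw w
            | zero => simp
            | add x y _ _ hx hy => rw [map_add, LinearMap.add_apply, hx, hy, add_zero]
            | smul q x _ hx => rw [map_smul, LinearMap.smul_apply, hx, smul_zero]
          have h3 := h2 _ (M.act_mem_span a v)
          rw [map_sub, h1, zero_sub, neg_eq_zero] at h3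
          exact M.eq_zero_of_form_self h3
        · rw [M.act_eq_zero_iff hvm.1 hvm.2 h0]
          exact null_of_admissible (M.nonneg hvm.1 h0)
            (fun i hi => M.dominant hv h0 ⟨i, hi⟩) hI ha
    exact M.eq_zero_of_form_self (hgen u' (M.mem_generated (fun _ _ _ => Submodule.mem_top)
      (fun _ _ _ => Submodule.mem_top) (M.mem_subHighest.1 hu').1 Submodule.mem_top))
  rw [← (LinearEquiv.ofBijective Φ ⟨hinj, hsurj⟩).finrank_eq, Module.finrank_pi_fintype,
    Finset.sum_coe_sort T fun ν => Module.finrank ℚ (M.highest ν)]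

end ContravariantModule

/-! ### Chains of horizontal and vertical strips -/

/-- The skew shape `lam / mu` is a horizontal strip (for `true`), with at most one cell in each
column, or a vertical strip (for `false`), with at most one cell in each row. -/
def IsStrip : Bool → YoungDiagram → YoungDiagram → Prop
  | true, lam, mu => mu ≤ lam ∧ ∀ i j, (i + 1, j) ∈ lam → (i, j) ∈ mu
  | false, lam, mu => mu ≤ lam ∧ ∀ i j, (i, j + 1) ∈ lam → (i, j) ∈ mu

theorem IsStrip.le {b : Bool} {lam mu : YoungDiagram} (h : IsStrip b lam mu) : mu ≤ lam := by
  cases b <;> exact h.1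

theorem isStrip_self (b : Bool) (lam : YoungDiagram) : IsStrip b lam lam := by
  cases b
  · exact ⟨le_rfl, fun i j h => lam.up_left_mem le_rfl (Nat.le_succ j) h⟩
  · exact ⟨le_rfl, fun i j h => lam.up_left_mem (Nat.le_succ i) le_rfl h⟩

theorem finite_le (lam : YoungDiagram) : {mu : YoungDiagram | mu ≤ lam}.Finite := by
  refine Set.Finite.subset (Set.Finite.preimage (f := YoungDiagram.cells) (fun a _ b _ h =>
    YoungDiagram.ext h) lam.cells.powerset.finite_toSet) fun mu hmu => ?_
  exact Finset.mem_coe.2 (Finset.mem_powerset.2 hmu)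

/-- The diagrams obtained from `lam` by removing a strip of size `n`. -/
noncomputable def strips (b : Bool) (lam : YoungDiagram) (n : ℕ) : Finset YoungDiagram :=
  ((finite_le lam).subset (t := {mu | IsStrip b lam mu ∧ lam.card = mu.card + n})
    fun _ h => h.1.le).toFinset

theorem mem_strips {b : Bool} {lam mu : YoungDiagram} {n : ℕ} :
    mu ∈ strips b lam n ↔ IsStrip b lam mu ∧ lam.card = mu.card + n := by
  rw [strips, Set.Finite.mem_toFinset]
  exact Iff.rfl

theorem strips_zero (b : Bool) (lam : YoungDiagram) : strips b lam 0 = {lam} := by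
  ext mu
  rw [mem_strips, Finset.mem_singleton]
  constructor
  · rintro ⟨h1, h2⟩
    exact YoungDiagram.ext (Finset.eq_of_subset_of_card_le h1.le h2.le)
  · rintro rfl
    exact ⟨isStrip_self b mu, rfl⟩

open Classical in
/-- The number of ways to exhaust `lam` by removing strips of given kinds and sizes. -/
noncomputable def stripCount : List (Bool × ℕ) → YoungDiagram → ℕ
  | [], lam => if lam = ⊥ then 1 else 0
  | x :: L, lam => ∑ mu ∈ strips x.1 lam x.2, stripCount L mu

theorem stripCount_cons (x : Bool × ℕ) (L : List (Bool × ℕ)) (lam : YoungDiagram) :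
    stripCount (x :: L) lam = ∑ mu ∈ strips x.1 lam x.2, stripCount L mu := rfl

theorem stripCount_drop (pre post : List (Bool × ℕ)) (b : Bool) (lam : YoungDiagram) :
    stripCount (pre ++ (b, 0) :: post) lam = stripCount (pre ++ post) lam := by
  induction pre generalizing lam with
  | nil => rw [List.nil_append, stripCount_cons, strips_zero, Finset.sum_singleton]; rfl
  | cons x pre ih => simp only [List.cons_append, stripCount_cons, ih]

theorem card_eq_of_stripCount_ne_zero {L : List (Bool × ℕ)} {lam : YoungDiagram}
    (h : stripCount L lam ≠ 0) : lam.card = (L.map Prod.snd).sum := by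
  induction L generalizing lam with
  | nil =>
    rw [stripCount] at h
    have : lam = ⊥ := by
      by_contra h'
      exact h (if_neg h')
    rw [this]
    rfl
  | cons x L ih =>
    rw [stripCount_cons] at h
    obtain ⟨mu, hmu, hne⟩ := Finset.exists_ne_zero_of_sum_ne_zero h
    rw [(mem_strips.1 hmu).2, ih hne, List.map_cons, List.sum_cons, add_comm]

/-! #### Transposition -/

theorem card_transpose (lam : YoungDiagram) : lam.transpose.card = lam.card :=
  Finset.card_map _

theorem isStrip_transpose {b : Bool} {lam mu : YoungDiagram} :
    IsStrip (!b) lam.transpose mu.transpose ↔ IsStrip b lam mu := by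
  cases b
  · simp only [IsStrip, YoungDiagram.mem_transpose, Bool.not_false, YoungDiagram.transpose_le_iff,
      Prod.swap_prod_mk]
    exact and_congr Iff.rfl forall_comm
  · simp only [IsStrip, YoungDiagram.mem_transpose, Bool.not_true, YoungDiagram.transpose_le_iff,
      Prod.swap_prod_mk]
    exact and_congr Iff.rfl forall_comm

theorem stripCount_transpose (L : List (Bool × ℕ)) (lam : YoungDiagram) :
    stripCount (L.map fun x => (!x.1, x.2)) lam.transpose = stripCount L lam := by
  induction L generalizing lam with
  | nil =>
    have : lam.transpose = ⊥ ↔ lam = ⊥ := by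
      rw [YoungDiagram.transpose_eq_iff_eq_transpose]
      rfl
    rw [List.map_nil, stripCount, stripCount]
    by_cases h : lam = ⊥
    · rw [if_pos h, if_pos (this.2 h)]
    · rw [if_neg h, if_neg fun h' => h (this.1 h')]
  | cons x L ih =>
    rw [List.map_cons, stripCount_cons, stripCount_cons]
    refine (Finset.sum_bij (fun mu _ => mu.transpose) ?_ ?_ ?_ ?_).symm
    · intro mu hmu
      rw [mem_strips] at hmu ⊢
      rwa [isStrip_transpose, card_transpose, card_transpose]
    · intro mu _ mu' _ h
      exact YoungDiagram.transpose_eq_iff.1 h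
    · intro mu hmu
      refine ⟨mu.transpose, ?_, YoungDiagram.transpose_transpose mu⟩
      rw [mem_strips] at hmu ⊢
      rw [← isStrip_transpose, YoungDiagram.transpose_transpose, card_transpose,
        ← card_transpose lam]
      exact hmu
    · intro mu _
      exact (ih mu).symm

/-! #### The sign-reversing involution -/

/-- The leftmost cell of the last row where `lam` and `nu` differ. -/
def IsCorner (lam nu : YoungDiagram) (x : ℕ × ℕ) : Prop :=
  x ∈ lam ∧ x ∉ nu ∧ (∀ c, (x.1, c) ∉ nu → x.2 ≤ c) ∧ ∀ r c, x.1 < r → (r, c) ∈ lam → (r, c) ∈ nu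

theorem exists_isCorner {lam nu : YoungDiagram} (h : nu < lam) : ∃ x, IsCorner lam nu x := by
  have hne : (lam.cells \ nu.cells).Nonempty := by
    rw [Finset.sdiff_nonempty]
    exact fun h' => h.not_ge h'
  obtain ⟨⟨r, c⟩, hx, hmax⟩ := Finset.exists_max_image _ Prod.fst hne
  rw [Finset.mem_sdiff, YoungDiagram.mem_cells, YoungDiagram.mem_cells] at hx
  have hc : nu.rowLen r ≤ c := not_lt.1 fun h => hx.2 (YoungDiagram.mem_iff_lt_rowLen.2 h)
  refine ⟨(r, nu.rowLen r), lam.up_left_mem le_rfl hc hx.1,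
    fun h => lt_irrefl _ (YoungDiagram.mem_iff_lt_rowLen.1 h),
    fun c' h' => not_lt.1 fun h => h' (YoungDiagram.mem_iff_lt_rowLen.2 h), fun r' c' hr h' => ?_⟩
  by_contra h''
  have := hmax (r', c') (Finset.mem_sdiff.2 ⟨(YoungDiagram.mem_cells _).2 h',
    fun h => h'' ((YoungDiagram.mem_cells _).1 h)⟩)
  exact absurd this (not_le.2 hr)

open Classical in
/-- Add the cell `x` to `mu`, or remove it. -/
noncomputable def toggle (x : ℕ × ℕ) (mu : YoungDiagram) : YoungDiagram :=
  if h : IsLowerSet (symmDiff mu.cells {x} : Set (ℕ × ℕ)) then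
    ⟨symmDiff mu.cells {x}, by simpa using h⟩ else mu

theorem mem_symmDiff_singleton {mu : YoungDiagram} {x y : ℕ × ℕ} :
    y ∈ (symmDiff mu.cells {x} : Set (ℕ × ℕ)) ↔ (y ∈ mu ↔ y ≠ x) := by
  rw [Set.mem_symmDiff, Set.mem_singleton_iff, Finset.mem_coe, YoungDiagram.mem_cells]
  tauto

theorem mem_toggle {mu : YoungDiagram} {x : ℕ × ℕ}
    (h : IsLowerSet (symmDiff mu.cells {x} : Set (ℕ × ℕ))) {y : ℕ × ℕ} :
    y ∈ toggle x mu ↔ (y ∈ mu ↔ y ≠ x) := by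
  classical
  rw [toggle, dif_pos h, ← YoungDiagram.mem_cells, ← mem_symmDiff_singleton (mu := mu),
    ← Finset.mem_coe]
  simp

theorem toggle_toggle {mu : YoungDiagram} {x : ℕ × ℕ}
    (h : IsLowerSet (symmDiff mu.cells {x} : Set (ℕ × ℕ))) : toggle x (toggle x mu) = mu := by
  have h' : IsLowerSet (symmDiff (toggle x mu).cells {x} : Set (ℕ × ℕ)) := by
    have : (symmDiff (toggle x mu).cells {x} : Set (ℕ × ℕ)) = mu.cells := by
      ext y
      rw [mem_symmDiff_singleton, mem_toggle h, Finset.mem_coe, YoungDiagram.mem_cells]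
      tauto
    rw [this]
    exact mu.isLowerSet
  ext y
  rw [YoungDiagram.mem_cells, YoungDiagram.mem_cells, mem_toggle h', mem_toggle h]
  tauto

theorem card_toggle {mu : YoungDiagram} {x : ℕ × ℕ}
    (h : IsLowerSet (symmDiff mu.cells {x} : Set (ℕ × ℕ))) :
    (toggle x mu).card = mu.card + 1 ∨ mu.card = (toggle x mu).card + 1 := by
  classical
  by_cases hx : x ∈ mu
  · right
    have : (toggle x mu).cells = mu.cells.erase x := by
      ext y
      rw [YoungDiagram.mem_cells, mem_toggle h, Finset.mem_erase, YoungDiagram.mem_cells]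
      by_cases hy : y = x
      · simp [hy, hx]
      · simp [hy]
    rw [YoungDiagram.card, YoungDiagram.card, this, Finset.card_erase_add_one
      ((YoungDiagram.mem_cells _).2 hx)]
  · left
    have : (toggle x mu).cells = insert x mu.cells := by
      ext y
      rw [YoungDiagram.mem_cells, mem_toggle h, Finset.mem_insert, YoungDiagram.mem_cells]
      by_cases hy : y = x
      · simp [hy, hx]
      · simp [hy]
    rw [YoungDiagram.card, YoungDiagram.card, this, Finset.card_insert_of_notMem
      (fun h => hx ((YoungDiagram.mem_cells _).1 h))]

/-- Between `lam` and `nu`, the corner may belong to the intermediate diagram or not: neither choice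
violates the conditions on the strips. -/
theorem toggle_strips {lam mu nu : YoungDiagram} {x : ℕ × ℕ} (hx : IsCorner lam nu x)
    (h1 : IsStrip true lam mu) (h2 : IsStrip false mu nu) :
    IsLowerSet (symmDiff mu.cells {x} : Set (ℕ × ℕ)) ∧ IsStrip true lam (toggle x mu) ∧
      IsStrip false (toggle x mu) nu := by
  obtain ⟨r, c⟩ := x
  obtain ⟨hlam, hnu, hleft, hlast⟩ := hx
  dsimp only at hleft hlast
  obtain ⟨hle1, h1⟩ := h1
  obtain ⟨hle2, h2⟩ := h2
  -- no cell of `mu` lies to the right of the corner, no cell of `lam` lies below it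
  have hright : ∀ c', (r, c') ∈ mu → c' ≤ c := by
    intro c' hc'
    by_contra! hlt
    exact hnu (h2 r c (mu.up_left_mem le_rfl hlt hc'))
  have hbelow : ∀ r' c', r < r' → c ≤ c' → (r', c') ∉ lam := by
    intro r' c' hr hc h
    exact hnu (nu.up_left_mem hr.le hc (hlast r' c' hr h))
  have hlow : IsLowerSet (symmDiff mu.cells {(r, c)} : Set (ℕ × ℕ)) := by
    rintro ⟨a, b⟩ ⟨a', b'⟩ hab h
    rw [mem_symmDiff_singleton] at h ⊢
    have ha : a' ≤ a := hab.1
    have hb : b' ≤ b := hab.2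
    by_cases hmu : (r, c) ∈ mu
    · have h3 : (a, b) ≠ (r, c) := fun h' => by
        rw [h'] at h
        exact (h.1 hmu) rfl
      have h4 := h.2 h3
      refine ⟨fun _ h' => ?_, fun _ => mu.up_left_mem ha hb h4⟩
      obtain ⟨rfl, rfl⟩ := Prod.mk.inj h'
      rcases ha.lt_or_eq with hlt | rfl
      · exact hbelow a b hlt hb (hle1 h4)
      · exact h3 (by rw [le_antisymm (hright b h4) hb])
    · by_cases h3 : (a, b) = (r, c)
      · obtain ⟨rfl, rfl⟩ := Prod.mk.inj h3
        by_cases h4 : (a', b') = (a, b)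
        · rw [h4]
          exact ⟨fun h => absurd h hmu, fun h => absurd rfl h⟩
        · refine ⟨fun _ => h4, fun _ => ?_⟩
          rcases ha.lt_or_eq with hlt | rfl
          · obtain ⟨d, rfl⟩ := Nat.exists_eq_add_of_lt hlt
            exact mu.up_left_mem (by omega) hb (h1 (a' + d) b hlam)
          · have hlt : b' < b := lt_of_le_of_ne hb fun h => h4 (by rw [h])
            refine hle2 ?_
            by_contra h5
            exact absurd (hleft b' h5) (not_le.2 hlt)
      · have h4 := h.2 h3
        have h5 := mu.up_left_mem ha hb h4
        exact ⟨fun _ h' => hmu (h' ▸ h5), fun _ => h5⟩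
  refine ⟨hlow, ⟨fun y hy => ?_, fun a b hab => ?_⟩, ⟨fun y hy => ?_, fun a b hab => ?_⟩⟩
  · rw [mem_toggle hlow] at hy
    by_cases h : y = (r, c)
    · rw [h]; exact hlam
    · exact hle1 (hy.2 h)
  · rw [mem_toggle hlow]
    refine ⟨fun _ h => ?_, fun _ => h1 a b hab⟩
    obtain ⟨rfl, rfl⟩ := Prod.mk.inj h
    exact hbelow _ _ (Nat.lt_succ_self a) le_rfl hab
  · rw [mem_toggle hlow]
    exact ⟨fun _ h => hnu (h ▸ hy), fun _ => hle2 hy⟩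
  · rw [mem_toggle hlow] at hab
    by_cases h : (a, b + 1) = (r, c)
    · obtain ⟨rfl, rfl⟩ := Prod.mk.inj h
      by_contra h'
      exact absurd (hleft b h') (by omega)
    · exact h2 a b (hab.2 h)

/-- The relation `∑ (-1)^i h_j e_i = 0` for `i + j = K > 0`, in terms of strips: toggling the corner of
`lam / nu` in the intermediate diagram changes the sign. -/
theorem sum_stripCount_eq_zero (pre post : List (Bool × ℕ)) {K : ℕ} (hK : 0 < K)
    (lam : YoungDiagram) : ∑ i ∈ Finset.range (K + 1),
      (-1 : ℤ) ^ i * stripCount (pre ++ (true, K - i) :: (false, i) :: post) lam = 0 := by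
  classical
  induction pre generalizing lam with
  | cons x pre ih =>
    simp only [List.cons_append, stripCount_cons, Nat.cast_sum, Finset.mul_sum]
    rw [Finset.sum_comm]
    exact Finset.sum_eq_zero fun mu _ => ih mu
  | nil =>
    simp only [List.nil_append, stripCount_cons, Nat.cast_sum, Finset.mul_sum]
    simp only [Finset.sum_sigma']
    let g : (Σ _ : ℕ, Σ _ : YoungDiagram, YoungDiagram) →
        Σ _ : ℕ, Σ _ : YoungDiagram, YoungDiagram :=
      fun t => ⟨(toggle (Classical.epsilon (IsCorner lam t.2.2)) t.2.1).card - t.2.2.card,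
        toggle (Classical.epsilon (IsCorner lam t.2.2)) t.2.1, t.2.2⟩
    have key : ∀ i mu nu, i ∈ Finset.range (K + 1) ∧ mu ∈ strips true lam (K - i) ∧
        nu ∈ strips false mu i ↔ IsStrip true lam mu ∧ IsStrip false mu nu ∧
          mu.card = nu.card + i ∧ lam.card = nu.card + K := by
      intro i mu nu
      rw [Finset.mem_range, mem_strips, mem_strips]
      constructor
      · rintro ⟨h1, ⟨h2, h3⟩, h4, h5⟩
        exact ⟨h2, h4, h5, by omega⟩
      · rintro ⟨h1, h2, h3, h4⟩
        have h5 := Finset.card_le_card h1.le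
        have h6 := Finset.card_le_card h2.le
        change mu.card ≤ lam.card at h5
        change nu.card ≤ mu.card at h6
        exact ⟨by omega, ⟨h1, by omega⟩, h2, h3⟩
    have hcorner : ∀ {i mu nu}, IsStrip true lam mu ∧ IsStrip false mu nu ∧
          mu.card = nu.card + i ∧ lam.card = nu.card + K →
          IsCorner lam nu (Classical.epsilon (IsCorner lam nu)) := by
      rintro i mu nu ⟨h1, h2, h3, h4⟩
      refine Classical.epsilon_spec (exists_isCorner (lt_of_le_of_ne (h2.le.trans h1.le) ?_))
      rintro rfl
      omega
    refine Finset.sum_involution (fun t _ => g t) ?_ ?_ ?_ ?_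
    · rintro ⟨i, mu, nu⟩ ht
      simp only [Finset.mem_sigma, key] at ht
      obtain ⟨hlow, h1, h2⟩ := toggle_strips (hcorner ht) ht.1 ht.2.1
      have h3 := Finset.card_le_card h2.le
      rw [← YoungDiagram.card, ← YoungDiagram.card] at h3
      simp only [g]
      rw [← add_mul]
      rcases card_toggle hlow with h | h
      · have : (toggle (Classical.epsilon (IsCorner lam nu)) mu).card - nu.card = i + 1 := by omega
        rw [this, pow_succ]
        ring
      · have : i = (toggle (Classical.epsilon (IsCorner lam nu)) mu).card - nu.card + 1 := by omega
        conv_lhs => rw [this, pow_succ]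
        ring
    · rintro ⟨i, mu, nu⟩ ht _ h
      simp only [Finset.mem_sigma, key] at ht
      obtain ⟨hlow, -, -⟩ := toggle_strips (hcorner ht) ht.1 ht.2.1
      simp only [g, Sigma.mk.injEq, heq_eq_eq, and_true] at h
      rcases card_toggle hlow with h' | h' <;> rw [h.2] at h' <;> omega
    · rintro ⟨i, mu, nu⟩ ht
      simp only [g, Finset.mem_sigma, key] at ht ⊢
      obtain ⟨hlow, h1, h2⟩ := toggle_strips (hcorner ht) ht.1 ht.2.1
      have h3 := Finset.card_le_card h2.le
      rw [← YoungDiagram.card, ← YoungDiagram.card] at h3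
      exact ⟨h1, h2, by omega, ht.2.2.2⟩
    · rintro ⟨i, mu, nu⟩ ht
      simp only [Finset.mem_sigma, key] at ht
      obtain ⟨hlow, -, -⟩ := toggle_strips (hcorner ht) ht.1 ht.2.1
      simp only [g, toggle_toggle hlow, Sigma.mk.injEq, heq_eq_eq, and_true]
      omega

/-! ### The symmetric algebra of an exterior power -/

section Letters

variable {m : ℕ}

/-- The basis of the `m`-th exterior power: `S` stands for the product of the `x_j`, `j ∈ S`. -/
abbrev Letters (m : ℕ) : Type := {S : Finset ℕ // S.card = m}

/-- The weight of a basis vector. -/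
def letterWeight (S : Letters m) : ℕ → ℤ := fun j => if j ∈ S.1 then 1 else 0

/-- Replace `p` by `q`. -/
def replaceLetter (p q : ℕ) (S : Letters m) : Option (Letters m) :=
  if h : p ∈ S.1 ∧ q ∉ S.1 then
    some ⟨insert q (S.1.erase p), by
      rw [Finset.card_insert_of_notMem fun hq => h.2 (Finset.mem_of_mem_erase hq),
        Finset.card_erase_add_one h.1, S.2]⟩
  else none

theorem replaceLetter_eq_some {p q : ℕ} {S T : Letters m} :
    replaceLetter p q S = some T ↔ p ∈ S.1 ∧ q ∉ S.1 ∧ T.1 = insert q (S.1.erase p) := by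
  rw [replaceLetter]
  split_ifs with h
  · rw [Option.some.injEq, Subtype.ext_iff]
    exact ⟨fun h' => ⟨h.1, h.2, h'.symm⟩, fun h' => h'.2.2.symm⟩
  · simp only [false_iff]
    exact fun h' => h ⟨h'.1, h'.2.1⟩

theorem replaceLetter_bind_comm {i j : ℕ} (hij : i ≠ j) (S : Letters m) :
    (replaceLetter j (j + 1) S).bind (replaceLetter (i + 1) i) =
      (replaceLetter (i + 1) i S).bind (replaceLetter j (j + 1)) := by
  have key : ∀ {p q p' q' : ℕ}, p' ≠ q → q' ≠ p → ∀ {T : Letters m},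
      T ∈ (replaceLetter p q S).bind (replaceLetter p' q') →
      T ∈ (replaceLetter p' q' S).bind (replaceLetter p q) := by
    intro p q p' q' hp hq T hT
    rw [Option.mem_def, Option.bind_eq_some_iff] at hT
    obtain ⟨U, hU, hT⟩ := hT
    rw [replaceLetter_eq_some] at hU hT
    obtain ⟨a1, a2, a3⟩ := hU
    obtain ⟨b1, b2, b3⟩ := hT
    rw [a3] at b1 b2 b3
    have b1' : p' ∈ S.1 := by grind
    have b2' : q' ∉ S.1 := by grind
    obtain ⟨V, hV⟩ : ∃ V, replaceLetter p' q' S = some V := by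
      rw [replaceLetter, dif_pos ⟨b1', b2'⟩]
      exact ⟨_, rfl⟩
    rw [Option.mem_def, Option.bind_eq_some_iff]
    refine ⟨V, hV, ?_⟩
    rw [replaceLetter_eq_some] at hV ⊢
    obtain ⟨-, -, hV⟩ := hV
    rw [hV, b3]
    refine ⟨by grind, by grind, ?_⟩
    ext x
    grind
  ext T
  exact ⟨key (by omega) (by omega), key (by omega) (by omega)⟩

theorem replaceLetter_bind_self {p q : ℕ} (hpq : p ≠ q) (S : Letters m) :
    (replaceLetter p q S).bind (replaceLetter q p) =
      if p ∈ S.1 ∧ q ∉ S.1 then some S else none := by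
  ext T
  rw [Option.bind_eq_some_iff]
  constructor
  · rintro ⟨U, hU, hT⟩
    rw [replaceLetter_eq_some] at hU hT
    rw [if_pos ⟨hU.1, hU.2.1⟩, Option.some.injEq, Subtype.ext_iff, hT.2.2, hU.2.2]
    ext x
    grind
  · intro h
    split_ifs at h with h'
    obtain rfl := Option.some.inj h
    refine ⟨_, dif_pos h', ?_⟩
    rw [replaceLetter_eq_some]
    refine ⟨by simp, by simp [hpq], ?_⟩
    ext x
    grind

/-- The raising operator, which replaces `i + 1` by `i`. -/
def letterUp (i : ℕ) : Letters m ≃. Letters m where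
  toFun := replaceLetter (i + 1) i
  invFun := replaceLetter i (i + 1)
  inv := by
    intro S T
    rw [replaceLetter_eq_some, replaceLetter_eq_some]
    constructor
    · rintro ⟨h1, h2, h3⟩
      rw [h3]
      refine ⟨by simp, by simp, ?_⟩
      ext x
      grind
    · rintro ⟨h1, h2, h3⟩
      rw [h3]
      refine ⟨by simp, by simp, ?_⟩
      ext x
      grind

theorem shift_optX {σ : Type*} (p : σ ≃. σ) (o : Option σ) :
    shift p (optX o) = optX (o.bind p) := by
  cases o <;> simp

theorem weight_letterWeight_apply (a : Letters m →₀ ℕ) (j : ℕ) :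
    Finsupp.weight letterWeight a j = ∑ S ∈ a.support, (a S : ℤ) * if j ∈ S.1 then 1 else 0 := by
  rw [Finsupp.weight_apply, Finsupp.sum, Finset.sum_apply]
  exact Finset.sum_congr rfl fun S _ => by simp [letterWeight]

/-- The symmetric algebra of the `m`-th exterior power of the standard representation, as a module
for the `k` first simple roots. -/
noncomputable def letterModule (hm : 0 < m) (k : ℕ) :
    ContravariantModule k (MvPolynomial (Letters m) ℚ) :=
  polynomialModule k letterWeight (fun i => letterUp i)
    (fun S => by
      obtain ⟨j, hj⟩ := Finset.card_pos.1 (hm.trans_eq S.2.symm)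
      refine Pi.lt_def.2 ⟨fun i => ?_, j, ?_⟩
      · rw [letterWeight]
        split_ifs <;> simp
      · simp [letterWeight, hj])
    (fun a => by
      refine Set.Finite.subset (Set.Finite.preimage (f := Subtype.val)
        Subtype.val_injective.injOn
        (a.support.biUnion Subtype.val).powerset.finite_toSet) fun S hS => ?_
      refine Finset.mem_coe.2 (Finset.mem_powerset.2 fun j hj => ?_)
      have h1 : letterWeight S j ≤ _ := hS j
      rw [letterWeight, if_pos hj, weight_letterWeight_apply] at h1
      by_contra hcon
      rw [Finset.sum_eq_zero] at h1
      · exact absurd h1 (by norm_num)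
      · intro T hT
        rw [if_neg fun h => hcon (Finset.mem_biUnion.2 ⟨T, hT, h⟩), mul_zero])
    (fun i S T h => by
      obtain ⟨h1, h2, h3⟩ := replaceLetter_eq_some.1 h
      funext j
      simp only [letterWeight, h3, root, Pi.add_apply, Pi.sub_apply, Pi.single_apply,
        Finset.mem_insert, Finset.mem_erase]
      grind)
    (fun i j S => by
      rw [shift_optX, shift_optX]
      change optX ((replaceLetter j (j + 1) S).bind (replaceLetter (i + 1) i)) =
        optX ((replaceLetter (i + 1) i S).bind (replaceLetter j (j + 1))) + _
      by_cases hij : i = j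
      · subst hij
        rw [if_pos rfl, replaceLetter_bind_self (Nat.succ_ne_self _).symm,
          replaceLetter_bind_self (Nat.succ_ne_self _), letterWeight, letterWeight]
        by_cases h1 : (i : ℕ) ∈ S.1 <;> by_cases h2 : (i : ℕ) + 1 ∈ S.1 <;> simp [h1, h2]
      · rw [if_neg hij, add_zero, replaceLetter_bind_comm fun h => hij (Fin.ext h)])

theorem highest_eq_subHighest (hm : 0 < m) (k : ℕ) (e : ℕ → ℤ) :
    (letterModule hm k).highest e = (letterModule hm (k + 1)).subHighest e := by
  ext f
  rw [ContravariantModule.mem_highest, ContravariantModule.mem_subHighest]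
  refine and_congr Iff.rfl ⟨fun h i hi => ?_, fun h i => ?_⟩
  · exact h ⟨i, Nat.lt_of_succ_lt_succ hi⟩
  · exact h ⟨i, i.2.trans (Nat.lt_succ_self k)⟩ (Nat.succ_lt_succ i.2)

/-- The highest weight vectors of weight `lam`. -/
noncomputable def highestSpace (m : ℕ) (lam : YoungDiagram) :
    Submodule ℚ (MvPolynomial (Letters m) ℚ) :=
  weightedHomogeneousSubmodule ℚ letterWeight (fun j => (lam.rowLen j : ℤ)) ⊓
    ⨅ i : ℕ, LinearMap.ker
      (shift (letterUp (m := m) i) : MvPolynomial (Letters m) ℚ →ₗ[ℚ] MvPolynomial (Letters m) ℚ)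

/-- The multiplicity of `lam` in the symmetric algebra of the `m`-th exterior power. -/
noncomputable def multiplicity (m : ℕ) (lam : YoungDiagram) : ℕ :=
  Module.finrank ℚ (highestSpace m lam)

theorem mem_highestSpace {lam : YoungDiagram} {f : MvPolynomial (Letters m) ℚ} :
    f ∈ highestSpace m lam ↔
      IsWeightedHomogeneous letterWeight f (fun j => (lam.rowLen j : ℤ)) ∧
        ∀ i, shift (letterUp i) f = 0 := by
  rw [highestSpace, Submodule.mem_inf, mem_weightedHomogeneousSubmodule]
  simp

theorem finiteDimensional_highestSpace (hm : 0 < m) (lam : YoungDiagram) :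
    FiniteDimensional ℚ (highestSpace m lam) :=
  have := (letterModule hm 0).finite fun j => (lam.rowLen j : ℤ)
  Submodule.finiteDimensional_of_le (S₂ := (letterModule hm 0).W fun j => (lam.rowLen j : ℤ))
    fun _ hf => (mem_highestSpace.1 hf).1

/-- Raising operators beyond the last row kill all vectors of the weight, for lack of weights. -/
theorem subHighest_eq_highestSpace (hm : 0 < m) {k : ℕ} {lam : YoungDiagram}
    (hk : lam.rowLen k = 0) :
    (letterModule hm k).subHighest (fun j => (lam.rowLen j : ℤ)) = highestSpace m lam := by
  ext f
  rw [ContravariantModule.mem_subHighest, mem_highestSpace]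
  refine and_congr_right fun hf => ⟨fun h i => ?_, fun h i _ => h i⟩
  by_cases hi : i + 1 < k
  · exact h ⟨i, by omega⟩ hi
  · by_contra h0
    have h1 := (letterModule hm (i + 1)).E_mem (i := ⟨i, Nat.lt_succ_self i⟩) hf
    have h2 := (letterModule hm (i + 1)).nonneg h1 h0 (i + 1)
    have h3 : lam.rowLen (i + 1) = 0 :=
      Nat.eq_zero_of_le_zero (hk ▸ lam.rowLen_anti k (i + 1) (by omega))
    simp [root, h3] at h2

end Letters

/-! ### Branching along chains of strips -/

section Chains

theorem exists_rowLen {f : ℕ → ℕ} (hf : Antitone f) {n : ℕ} (hn : f n = 0) :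
    ∃ lam : YoungDiagram, ∀ i, lam.rowLen i = f i := by
  refine ⟨⟨(Finset.range n ×ˢ Finset.range (f 0)).filter fun c => c.2 < f c.1, ?_⟩, fun i => ?_⟩
  · rintro ⟨a, b⟩ ⟨a', b'⟩ ⟨ha, hb⟩ h
    simp only [Finset.coe_filter, Finset.mem_product, Finset.mem_range, Set.mem_ofPred_eq] at h ⊢
    dsimp only at ha hb
    have := hf ha
    omega
  · refine eq_of_forall_lt_iff fun j => ?_
    rw [← YoungDiagram.mem_iff_lt_rowLen, ← YoungDiagram.mem_cells]
    simp only [Finset.mem_filter, Finset.mem_product, Finset.mem_range, and_iff_right_iff_imp]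
    intro h
    refine ⟨?_, h.trans_le (hf (Nat.zero_le i))⟩
    by_contra! hi
    have := hf hi
    omega

theorem ext_rowLen {lam mu : YoungDiagram} (h : ∀ i, lam.rowLen i = mu.rowLen i) : lam = mu := by
  ext ⟨i, j⟩
  rw [YoungDiagram.mem_cells, YoungDiagram.mem_cells, YoungDiagram.mem_iff_lt_rowLen,
    YoungDiagram.mem_iff_lt_rowLen, h]

theorem card_eq_sum_rowLen {lam : YoungDiagram} {n : ℕ} (hn : lam.rowLen n = 0) :
    lam.card = ∑ i ∈ Finset.range n, lam.rowLen i := by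
  have h1 : ∀ k, partialSum lam k = ∑ i ∈ Finset.range k, lam.rowLen i := by
    intro k
    induction k with
    | zero => simp [partialSum]
    | succ k ih => rw [partialSum_succ, ih, Finset.sum_range_succ]
  rw [← h1, partialSum, YoungDiagram.card, Finset.filter_true_of_mem]
  rintro ⟨i, j⟩ hij
  rw [YoungDiagram.mem_cells, YoungDiagram.mem_iff_lt_rowLen] at hij
  by_contra! h
  have := lam.rowLen_anti n i h
  omega

theorem isStrip_true_iff {lam mu : YoungDiagram} :
    IsStrip true lam mu ↔ ∀ i, mu.rowLen i ≤ lam.rowLen i ∧ lam.rowLen (i + 1) ≤ mu.rowLen i := by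
  constructor
  · rintro ⟨h1, h2⟩ i
    constructor
    · refine le_of_forall_lt fun j hj => ?_
      rw [← YoungDiagram.mem_iff_lt_rowLen] at hj ⊢
      exact h1 hj
    · refine le_of_forall_lt fun j hj => ?_
      rw [← YoungDiagram.mem_iff_lt_rowLen] at hj ⊢
      exact h2 i j hj
  · intro h
    refine ⟨?_, fun i j hij => ?_⟩
    · rintro ⟨i, j⟩ hij
      have hij' : (i, j) ∈ mu := hij
      change (i, j) ∈ lam
      rw [YoungDiagram.mem_iff_lt_rowLen] at hij' ⊢
      exact hij'.trans_le (h i).1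
    · rw [YoungDiagram.mem_iff_lt_rowLen] at hij ⊢
      exact hij.trans_le (h i).2

theorem finite_card_eq (s : ℕ) : {lam : YoungDiagram | lam.card = s}.Finite := by
  refine Set.Finite.subset (Set.Finite.preimage (f := YoungDiagram.cells) (fun a _ b _ h =>
    YoungDiagram.ext h) (Finset.range s ×ˢ Finset.range s).powerset.finite_toSet)
    fun lam hlam => ?_
  refine Finset.mem_coe.2 (Finset.mem_powerset.2 ?_)
  rintro ⟨i, j⟩ hij
  rw [YoungDiagram.mem_cells] at hij
  have h1 : lam.colLen j ≤ lam.card := by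
    rw [YoungDiagram.colLen_eq_card]
    exact Finset.card_filter_le _ _
  have h2 : lam.rowLen i ≤ lam.card := by
    rw [YoungDiagram.rowLen_eq_card]
    exact Finset.card_filter_le _ _
  have h3 := YoungDiagram.mem_iff_lt_rowLen.1 hij
  have h4 := YoungDiagram.mem_iff_lt_colLen.1 hij
  have h5 : lam.card = s := hlam
  rw [Finset.mem_product, Finset.mem_range, Finset.mem_range]
  dsimp only
  omega

/-- The partitions of `s`. -/
noncomputable def partitionsOf (s : ℕ) : Finset YoungDiagram := (finite_card_eq s).toFinset

theorem mem_partitionsOf {s : ℕ} {lam : YoungDiagram} : lam ∈ partitionsOf s ↔ lam.card = s := by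
  rw [partitionsOf, Set.Finite.mem_toFinset]
  exact Iff.rfl

/-- The list of the first `k` exponents of a monomial, in descending order of the variables, all of
them marked with `b`. -/
def exponents (b : Bool) (d : ℕ → ℕ) : ℕ → List (Bool × ℕ)
  | 0 => []
  | k + 1 => (b, d k) :: exponents b d k

theorem map_not_exponents (d : ℕ → ℕ) (k : ℕ) :
    (exponents false d k).map (fun x => (!x.1, x.2)) = exponents true d k := by
  induction k with
  | zero => rfl
  | succ k ih => rw [exponents, exponents, List.map_cons, ih]; rfl

theorem sum_exponents (b : Bool) (d : ℕ → ℕ) (k : ℕ) :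
    ((exponents b d k).map Prod.snd).sum = ∑ j ∈ Finset.range k, d j := by
  induction k with
  | zero => rfl
  | succ k ih => rw [exponents, List.map_cons, List.sum_cons, ih, Finset.sum_range_succ, add_comm]

theorem rowLen_eq_zero_of_stripCount_ne_zero {d : ℕ → ℕ} {k : ℕ} {lam : YoungDiagram}
    (h : stripCount (exponents true d k) lam ≠ 0) : lam.rowLen k = 0 := by
  induction k generalizing lam with
  | zero =>
    have h1 := card_eq_of_stripCount_ne_zero h
    have h2 : lam.rowLen 0 ≤ lam.card := by
      rw [YoungDiagram.rowLen_eq_card]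
      exact Finset.card_filter_le _ _
    exact Nat.eq_zero_of_le_zero (h2.trans h1.le)
  | succ k ih =>
    rw [exponents, stripCount_cons] at h
    obtain ⟨mu, hmu, hne⟩ := Finset.exists_ne_zero_of_sum_ne_zero h
    have := (isStrip_true_iff.1 (mem_strips.1 hmu).1 k).2
    rw [ih hne] at this
    exact Nat.eq_zero_of_le_zero this

/-- The weight whose first `k` coordinates are those of `lam` and the others those of `d`. -/
def mixedWeight (k : ℕ) (lam : YoungDiagram) (d : ℕ → ℕ) : ℕ → ℤ :=
  fun j => if j < k then lam.rowLen j else d j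

/-- The weights that interlace with a mixed weight arise by adding a horizontal strip of the size
prescribed by `d`. -/
theorem interlace_mixedWeight {k : ℕ} {mu : YoungDiagram} (hmu : mu.rowLen k = 0) (d : ℕ → ℕ)
    (nu : ℕ → ℤ) : Interlace k nu (mixedWeight k mu d) ↔
      ∃ lam, mu ∈ strips true lam (d k) ∧ mixedWeight (k + 1) lam d = nu := by
  have hsum : ∑ j ∈ Finset.range k, mixedWeight k mu d j = mu.card := by
    rw [card_eq_sum_rowLen hmu, Nat.cast_sum]
    exact Finset.sum_congr rfl fun j hj => if_pos (Finset.mem_range.1 hj)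
  have hk : mixedWeight k mu d k = d k := if_neg (lt_irrefl k)
  constructor
  · rintro ⟨h1, h2, h3, h4⟩
    have hanti : ∀ j < k, nu (j + 1) ≤ nu j := fun j hj => (h1 j hj).1.trans (h1 j hj).2
    let f : ℕ → ℕ := fun j => if j ≤ k then (nu j).toNat else 0
    have hf : Antitone f := antitone_nat_of_succ_le fun j => by
      simp only [f]
      by_cases hj : j + 1 ≤ k
      · rw [if_pos hj, if_pos (by omega)]
        exact Int.toNat_le_toNat (hanti j hj)
      · rw [if_neg hj]
        exact Nat.zero_le _
    have hnn : ∀ j ≤ k, 0 ≤ nu j := by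
      intro j hj
      rcases hj.lt_or_eq with h | rfl
      · have := (h1 j h).2
        rw [mixedWeight, if_pos h] at this
        exact (Int.natCast_nonneg _).trans this
      · exact h2
    obtain ⟨lam, hlam⟩ := exists_rowLen hf (n := k + 1) (if_neg (by omega))
    have hrow : ∀ j ≤ k, (lam.rowLen j : ℤ) = nu j := fun j hj => by
      rw [hlam]
      simp only [f, if_pos hj]
      exact Int.toNat_of_nonneg (hnn j hj)
    have hlam0 : ∀ j, k < j → lam.rowLen j = 0 := fun j hj => by
      rw [hlam]
      exact if_neg (by omega)
    refine ⟨lam, mem_strips.2 ⟨isStrip_true_iff.2 fun i => ?_, ?_⟩, ?_⟩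
    · by_cases hi : i < k
      · have h5 := h1 i hi
        rw [mixedWeight, if_pos hi, ← hrow i hi.le, ← hrow (i + 1) hi] at h5
        omega
      · have h5 : mu.rowLen i ≤ mu.rowLen k := mu.rowLen_anti k i (not_lt.1 hi)
        rw [hlam0 (i + 1) (by omega)]
        omega
    · have h5 : ∑ j ∈ Finset.range (k + 1), nu j = lam.card := by
        rw [card_eq_sum_rowLen (hlam0 (k + 1) (Nat.lt_succ_self k)), Nat.cast_sum]
        exact Finset.sum_congr rfl fun j hj =>
          (hrow j (Nat.le_of_lt_succ (Finset.mem_range.1 hj))).symm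
      rw [h5, Finset.sum_range_succ, hsum, hk] at h4
      exact_mod_cast h4
    · funext j
      rw [mixedWeight]
      split_ifs with hj
      · exact hrow j (Nat.le_of_lt_succ hj)
      · have h5 := h3 j (by omega)
        rw [mixedWeight, if_neg (by omega)] at h5
        exact h5.symm
  · rintro ⟨lam, hlam, rfl⟩
    obtain ⟨hs, hcard⟩ := mem_strips.1 hlam
    rw [isStrip_true_iff] at hs
    refine ⟨fun j hj => ?_, ?_, fun j hj => ?_, ?_⟩
    · rw [mixedWeight, mixedWeight, mixedWeight, if_pos (by omega), if_pos hj, if_pos (by omega)]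
      have := hs j
      omega
    · rw [mixedWeight, if_pos (Nat.lt_succ_self k)]
      exact Int.natCast_nonneg _
    · rw [mixedWeight, mixedWeight, if_neg (by omega), if_neg (by omega)]
    · have h0 : lam.rowLen (k + 1) = 0 := by
        have := (hs k).2
        omega
      rw [Finset.sum_range_succ (mixedWeight k mu d), hsum, hk, ← Nat.cast_add, ← hcard,
        card_eq_sum_rowLen h0, Nat.cast_sum]
      exact Finset.sum_congr rfl fun j hj => if_pos (Finset.mem_range.1 hj)

/-- The branching rule for mixed weights. -/
theorem finrank_subHighest_mixedWeight {m : ℕ} (hm : 0 < m) {k : ℕ} {mu : YoungDiagram}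
    (hmu : mu.rowLen k = 0) (d : ℕ → ℕ) (T : Finset YoungDiagram)
    (hT : ∀ lam, lam ∈ T ↔ mu ∈ strips true lam (d k)) :
    Module.finrank ℚ ((letterModule hm k).subHighest (mixedWeight k mu d)) = ∑ lam ∈ T,
        Module.finrank ℚ ((letterModule hm (k + 1)).subHighest (mixedWeight (k + 1) lam d)) := by
  classical
  have hinj : ∀ lam, mu ∈ strips true lam (d k) → ∀ lam', mu ∈ strips true lam' (d k) →
      mixedWeight (k + 1) lam d = mixedWeight (k + 1) lam' d → lam = lam' := by
    intro lam h lam' h' heq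
    have h0 : ∀ lam, mu ∈ strips true lam (d k) → ∀ j, k < j → lam.rowLen j = 0 := by
      intro lam h j hj
      have h1 := (isStrip_true_iff.1 (mem_strips.1 h).1 k).2
      have h2 := lam.rowLen_anti (k + 1) j hj
      omega
    refine ext_rowLen fun j => ?_
    by_cases hj : k < j
    · rw [h0 lam h j hj, h0 lam' h' j hj]
    · have := congrFun heq j
      rw [mixedWeight, mixedWeight, if_pos (by omega), if_pos (by omega)] at this
      exact_mod_cast this
  rw [ContravariantModule.finrank_subHighest _ _
    (T.image fun lam => mixedWeight (k + 1) lam d), Finset.sum_image]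
  · exact Finset.sum_congr rfl fun lam _ => by rw [highest_eq_subHighest]
  · intro lam h lam' h'
    exact hinj lam ((hT lam).1 h) lam' ((hT lam').1 h')
  · intro nu
    rw [interlace_mixedWeight hmu, Finset.mem_image]
    exact exists_congr fun lam => and_congr (hT lam) Iff.rfl

/-- Branching `k` times: the dimension of a weight space in terms of the vectors of that weight which are
highest for the first `k` rows, whose weights are joined to the given one by chains of strips. -/
theorem finrank_eq_sum_stripCount_mixed {m : ℕ} (hm : 0 < m) (d : ℕ → ℕ) (k : ℕ) :
    Module.finrank ℚ ((letterModule hm 0).W fun j => (d j : ℤ)) =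
      ∑ lam ∈ partitionsOf (∑ j ∈ Finset.range k, d j), stripCount (exponents true d k) lam *
        Module.finrank ℚ ((letterModule hm k).subHighest (mixedWeight k lam d)) := by
  classical
  induction k with
  | zero =>
    rw [Finset.sum_eq_single ⊥]
    · have h1 : stripCount (exponents true d 0) ⊥ = 1 := if_pos rfl
      have h2 : mixedWeight 0 ⊥ d = fun j => (d j : ℤ) := funext fun j => if_neg (Nat.not_lt_zero j)
      have h3 : (letterModule hm 0).subHighest (fun j => (d j : ℤ)) =
          (letterModule hm 0).W fun j => (d j : ℤ) := by
        ext f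
        rw [ContravariantModule.mem_subHighest]
        exact ⟨fun h => h.1, fun h => ⟨h, fun i => i.elim0⟩⟩
      rw [h1, one_mul, h2, h3]
    · intro lam _ h
      rw [exponents, stripCount, if_neg h, zero_mul]
    · intro h
      exact absurd (mem_partitionsOf.2 rfl) h
  | succ k ih =>
    rw [ih]
    have h1 : ∀ mu ∈ partitionsOf (∑ j ∈ Finset.range k, d j),
        stripCount (exponents true d k) mu *
          Module.finrank ℚ ((letterModule hm k).subHighest (mixedWeight k mu d)) =
        ∑ lam ∈ partitionsOf (∑ j ∈ Finset.range (k + 1), d j),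
          if mu ∈ strips true lam (d k) then stripCount (exponents true d k) mu *
            Module.finrank ℚ ((letterModule hm (k + 1)).subHighest (mixedWeight (k + 1) lam d))
          else 0 := by
      intro mu hmu
      by_cases h0 : stripCount (exponents true d k) mu = 0
      · simp [h0]
      · rw [← Finset.sum_filter, ← Finset.mul_sum, finrank_subHighest_mixedWeight hm
          (rowLen_eq_zero_of_stripCount_ne_zero h0)]
        intro lam
        rw [Finset.mem_filter, mem_partitionsOf, and_iff_right_iff_imp, Finset.sum_range_succ,
          ← mem_partitionsOf.1 hmu]
        exact fun h => (mem_strips.1 h).2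
    rw [Finset.sum_congr rfl h1, Finset.sum_comm]
    refine Finset.sum_congr rfl fun lam hlam => ?_
    rw [← Finset.sum_filter, exponents, stripCount_cons, Finset.sum_mul]
    refine Finset.sum_congr ?_ fun _ _ => rfl
    ext mu
    rw [Finset.mem_filter, mem_partitionsOf, and_iff_right_iff_imp]
    intro h
    have h2 := (mem_strips.1 h).2
    rw [mem_partitionsOf.1 hlam, Finset.sum_range_succ] at h2
    exact (Nat.add_right_cancel h2).symm

/-- The character of the symmetric algebra of the exterior power, in terms of its highest weight
vectors. -/
theorem finrank_eq_sum_stripCount {m : ℕ} (hm : 0 < m) (d : ℕ → ℕ) {k : ℕ}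
    (hd : ∀ j, k ≤ j → d j = 0) :
    Module.finrank ℚ ((letterModule hm 0).W fun j => (d j : ℤ)) =
      ∑ lam ∈ partitionsOf (∑ j ∈ Finset.range k, d j),
        stripCount (exponents true d k) lam * multiplicity m lam := by
  rw [finrank_eq_sum_stripCount_mixed hm d k]
  refine Finset.sum_congr rfl fun lam _ => ?_
  by_cases h0 : stripCount (exponents true d k) lam = 0
  · rw [h0, zero_mul, zero_mul]
  · have hk := rowLen_eq_zero_of_stripCount_ne_zero h0
    have : mixedWeight k lam d = fun j => (lam.rowLen j : ℤ) := by
      funext j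
      rw [mixedWeight]
      split_ifs with hj
      · rfl
      · have h2 := lam.rowLen_anti k j (not_lt.1 hj)
        rw [hk] at h2
        rw [hd j (not_lt.1 hj), Nat.eq_zero_of_le_zero h2]
    rw [this, subHighest_eq_highestSpace hm hk, multiplicity]

end Chains

/-! ### Schur functions and chains of strips -/

section Schur

theorem content_entry_ne_zero {lam : YoungDiagram} (T : SemistandardYoungTableau lam) {i j : ℕ}
    (h : (i, j) ∈ lam) : content T (T i j) ≠ 0 := by
  rw [content_apply]
  exact Finset.card_ne_zero_of_mem (a := (i, j))
    (Finset.mem_filter.2 ⟨(YoungDiagram.mem_cells _).2 h, rfl⟩)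

open Classical in
/-- Extend a tableau of shape `mu` by the entry `k` in the cells of `lam / mu`. -/
noncomputable def extendTableau {lam mu : YoungDiagram} (h : IsStrip true lam mu) (k : ℕ)
    (T : SemistandardYoungTableau mu) (hT : ∀ i j, (i, j) ∈ mu → T i j < k) :
    SemistandardYoungTableau lam where
  entry i j := if (i, j) ∈ mu then T i j else if (i, j) ∈ lam then k else 0
  row_weak' := by
    intro i j j' hj hcell
    by_cases h1 : (i, j') ∈ mu
    · rw [if_pos h1, if_pos (mu.up_left_mem le_rfl hj.le h1)]
      exact T.row_weak hj h1
    · rw [if_neg h1, if_pos hcell]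
      split_ifs with h2 h3
      · exact (hT i j h2).le
      · exact le_rfl
      · exact Nat.zero_le _
  col_strict' := by
    intro i i' j hi hcell
    have h2 : (i, j) ∈ mu := by
      obtain ⟨r, rfl⟩ := Nat.exists_eq_add_of_lt hi
      exact mu.up_left_mem (Nat.le_add_right i r) le_rfl (h.2 (i + r) j hcell)
    rw [if_pos h2]
    by_cases h1 : (i', j) ∈ mu
    · rw [if_pos h1]
      exact T.col_strict hi h1
    · rw [if_neg h1, if_pos hcell]
      exact hT i j h2
  zeros' := by
    intro i j hij
    rw [if_neg fun h' => hij (h.le h'), if_neg hij]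

theorem extendTableau_of_mem {lam mu : YoungDiagram} (h : IsStrip true lam mu) {k : ℕ}
    (T : SemistandardYoungTableau mu) (hT : ∀ i j, (i, j) ∈ mu → T i j < k) {i j : ℕ}
    (hij : (i, j) ∈ mu) : extendTableau h k T hT i j = T i j :=
  if_pos hij

theorem extendTableau_of_notMem {lam mu : YoungDiagram} (h : IsStrip true lam mu) {k : ℕ}
    (T : SemistandardYoungTableau mu) (hT : ∀ i j, (i, j) ∈ mu → T i j < k) {i j : ℕ}
    (hij : (i, j) ∈ lam) (hij' : (i, j) ∉ mu) : extendTableau h k T hT i j = k :=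
  (if_neg hij').trans (if_pos hij)

theorem content_extendTableau {lam mu : YoungDiagram} (h : IsStrip true lam mu) {k : ℕ}
    (T : SemistandardYoungTableau mu) (hT : ∀ i j, (i, j) ∈ mu → T i j < k) :
    content (extendTableau h k T hT) = content T + Finsupp.single k (lam.card - mu.card) := by
  have hsub : mu.cells ⊆ lam.cells := h.le
  rw [content, content, ← Finset.sum_sdiff hsub, add_comm]
  congr 1
  · refine Finset.sum_congr rfl fun c hc => ?_
    rw [extendTableau_of_mem h T hT ((YoungDiagram.mem_cells _).1 hc)]
  · have h1 : ∀ c ∈ lam.cells \ mu.cells,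
        Finsupp.single (extendTableau h k T hT c.1 c.2) 1 = Finsupp.single k 1 := by
      intro c hc
      rw [Finset.mem_sdiff, YoungDiagram.mem_cells, YoungDiagram.mem_cells] at hc
      rw [extendTableau_of_notMem h T hT hc.1 hc.2]
    rw [Finset.sum_congr rfl h1, Finset.sum_const, Finset.card_sdiff_of_subset hsub,
      Finsupp.smul_single, smul_eq_mul, mul_one]

/-- The cells of a tableau with entries below `k`. -/
def shapeBelow {lam : YoungDiagram} (T : SemistandardYoungTableau lam) (k : ℕ) : YoungDiagram where
  cells := lam.cells.filter fun c => T c.1 c.2 < k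
  isLowerSet := by
    rintro ⟨a, b⟩ ⟨a', b'⟩ ⟨ha, hb⟩ h
    rw [Finset.mem_coe, Finset.mem_filter, YoungDiagram.mem_cells] at h ⊢
    have h1 := lam.up_left_mem ha hb h.1
    have h2 := lam.up_left_mem le_rfl hb h.1
    refine ⟨h1, ?_⟩
    exact ((T.col_weak ha h2).trans (T.row_weak_of_le hb h.1)).trans_lt h.2

theorem mem_shapeBelow {lam : YoungDiagram} {T : SemistandardYoungTableau lam} {k i j : ℕ} :
    (i, j) ∈ shapeBelow T k ↔ (i, j) ∈ lam ∧ T i j < k := by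
  rw [← YoungDiagram.mem_cells, shapeBelow, Finset.mem_filter, YoungDiagram.mem_cells]

/-- The restriction of a tableau to its entries below `k`. -/
def restrictTableau {lam : YoungDiagram} (T : SemistandardYoungTableau lam) (k : ℕ) :
    SemistandardYoungTableau (shapeBelow T k) where
  entry i j := if (i, j) ∈ lam ∧ T i j < k then T i j else 0
  row_weak' := by
    intro i j j' hj hcell
    have h1 := (shapeBelow T k).up_left_mem le_rfl hj.le hcell
    rw [mem_shapeBelow] at h1 hcell
    rw [if_pos h1, if_pos hcell]
    exact T.row_weak hj hcell.1
  col_strict' := by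
    intro i i' j hi hcell
    have h1 := (shapeBelow T k).up_left_mem hi.le le_rfl hcell
    rw [mem_shapeBelow] at h1 hcell
    rw [if_pos h1, if_pos hcell]
    exact T.col_strict hi hcell.1
  zeros' := by
    intro i j hij
    rw [mem_shapeBelow] at hij
    rw [if_neg hij]

theorem restrictTableau_apply {lam : YoungDiagram} (T : SemistandardYoungTableau lam) {k i j : ℕ}
    (h : (i, j) ∈ shapeBelow T k) : restrictTableau T k i j = T i j :=
  if_pos (mem_shapeBelow.1 h)

theorem entry_lt_of_content {lam : YoungDiagram} {T : SemistandardYoungTableau lam} {k : ℕ}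
    (h : ∀ v, k ≤ v → content T v = 0) (i j : ℕ) (hij : (i, j) ∈ lam) : T i j < k := by
  by_contra! h'
  exact content_entry_ne_zero T hij (h _ h')

theorem isStrip_shapeBelow {lam : YoungDiagram} {T : SemistandardYoungTableau lam} {k : ℕ}
    (h : ∀ i j, (i, j) ∈ lam → T i j < k + 1) : IsStrip true lam (shapeBelow T k) := by
  refine ⟨fun c hc => (Finset.mem_filter.1 hc).1, fun i j hij => mem_shapeBelow.2
    ⟨lam.up_left_mem (Nat.le_succ i) le_rfl hij, ?_⟩⟩
  have h1 := T.col_strict (Nat.lt_succ_self i) hij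
  have h2 := h (i + 1) j hij
  exact h1.trans_le (Nat.le_of_lt_succ h2)

theorem extendTableau_restrictTableau {lam : YoungDiagram} {T : SemistandardYoungTableau lam}
    {k : ℕ} (h : ∀ i j, (i, j) ∈ lam → T i j < k + 1) :
    extendTableau (isStrip_shapeBelow h) k (restrictTableau T k) (fun i j hij => by
      rw [restrictTableau_apply T hij]; exact (mem_shapeBelow.1 hij).2) = T := by
  ext i j
  by_cases h1 : (i, j) ∈ shapeBelow T k
  · rw [extendTableau_of_mem _ _ _ h1, restrictTableau_apply T h1]
  · by_cases h2 : (i, j) ∈ lam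
    · rw [extendTableau_of_notMem _ _ _ h2 h1]
      have h3 := h i j h2
      have h4 : ¬ T i j < k := fun h' => h1 (mem_shapeBelow.2 ⟨h2, h'⟩)
      omega
    · rw [SemistandardYoungTableau.zeros _ h2, SemistandardYoungTableau.zeros _ h2]

theorem shapeBelow_extendTableau {lam mu : YoungDiagram} (h : IsStrip true lam mu) {k : ℕ}
    (T : SemistandardYoungTableau mu) (hT : ∀ i j, (i, j) ∈ mu → T i j < k) :
    shapeBelow (extendTableau h k T hT) k = mu := by
  ext ⟨i, j⟩
  rw [YoungDiagram.mem_cells, YoungDiagram.mem_cells, mem_shapeBelow]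
  constructor
  · rintro ⟨h1, h2⟩
    by_contra h3
    rw [extendTableau_of_notMem h T hT h1 h3] at h2
    exact lt_irrefl _ h2
  · intro h1
    rw [extendTableau_of_mem h T hT h1]
    exact ⟨h.le h1, hT i j h1⟩

/-- The branching rule for tableaux, by removing the largest entry. -/
theorem card_tableaux_succ (lam : YoungDiagram) (d : ℕ →₀ ℕ) {k : ℕ}
    (hd : ∀ j, k + 1 ≤ j → d j = 0) :
    Nat.card {T : SemistandardYoungTableau lam // content T = d} =
      ∑ mu ∈ strips true lam (d k),
        Nat.card {T : SemistandardYoungTableau mu // content T = d.erase k} := by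
  have herase : ∀ j, k ≤ j → d.erase k j = 0 := fun j hj => by
    rcases hj.lt_or_eq with h | rfl
    · rw [Finsupp.erase_ne h.ne', hd j h]
    · exact Finsupp.erase_same
  have hlt : ∀ {mu : YoungDiagram} {T : SemistandardYoungTableau mu}, content T = d.erase k →
      ∀ i j, (i, j) ∈ mu → T i j < k := fun h =>
    entry_lt_of_content fun v hv => by rw [h, herase v hv]
  let φ : (Σ mu : strips true lam (d k),
      {T : SemistandardYoungTableau mu.1 // content T = d.erase k}) →
      {T : SemistandardYoungTableau lam // content T = d} := fun t =>
    ⟨extendTableau (mem_strips.1 t.1.2).1 k t.2.1 (hlt t.2.2), by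
      rw [content_extendTableau, t.2.2, (mem_strips.1 t.1.2).2, Nat.add_sub_cancel_left,
        Finsupp.erase_add_single]⟩
  have hφ : Function.Bijective φ := by
    constructor
    · rintro ⟨⟨mu, hmu⟩, T, hT⟩ ⟨⟨mu', hmu'⟩, T', hT'⟩ h
      have h1 : extendTableau (mem_strips.1 hmu).1 k T (hlt hT) =
        extendTableau (mem_strips.1 hmu').1 k T' (hlt hT') := congrArg Subtype.val h
      have h2 := congrArg (fun T => shapeBelow T k) h1
      rw [shapeBelow_extendTableau, shapeBelow_extendTableau] at h2
      subst h2
      have h3 : T = T' := by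
        ext i j
        by_cases hij : (i, j) ∈ mu
        · rw [← extendTableau_of_mem (mem_strips.1 hmu).1 T (hlt hT) hij, h1,
            extendTableau_of_mem _ _ _ hij]
        · rw [T.zeros hij, T'.zeros hij]
      subst h3
      rfl
    · rintro ⟨T, hT⟩
      have h1 : ∀ i j, (i, j) ∈ lam → T i j < k + 1 :=
        entry_lt_of_content fun v hv => by rw [hT, hd v hv]
      have h2 : ∀ i j, (i, j) ∈ shapeBelow T k → restrictTableau T k i j < k := fun i j hij => by
        rw [restrictTableau_apply T hij]; exact (mem_shapeBelow.1 hij).2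
      have h3 := content_extendTableau (isStrip_shapeBelow h1) _ h2
      rw [extendTableau_restrictTableau h1, hT] at h3
      have h4 : content (restrictTableau T k) k = 0 := by
        rw [content_apply, Finset.card_eq_zero, Finset.filter_eq_empty_iff]
        intro c hc
        exact (h2 c.1 c.2 ((YoungDiagram.mem_cells _).1 hc)).ne
      have h5 : d k = lam.card - (shapeBelow T k).card := by
        have := DFunLike.congr_fun h3 k
        rwa [Finsupp.add_apply, h4, zero_add, Finsupp.single_eq_same] at this
      have h6 : content (restrictTableau T k) = d.erase k := by
        ext v
        by_cases hv : v = k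
        · rw [hv, h4, Finsupp.erase_same]
        · have := DFunLike.congr_fun h3 v
          rw [Finsupp.add_apply, Finsupp.single_eq_of_ne hv, add_zero] at this
          rw [← this, Finsupp.erase_ne hv]
      have h7 : (shapeBelow T k).card ≤ lam.card :=
        Finset.card_le_card (isStrip_shapeBelow h1).le
      exact ⟨⟨⟨shapeBelow T k, mem_strips.2 ⟨isStrip_shapeBelow h1, by omega⟩⟩,
        restrictTableau T k, h6⟩, Subtype.ext (extendTableau_restrictTableau h1)⟩
  have : ∀ mu : strips true lam (d k),
      Finite {T : SemistandardYoungTableau mu.1 // content T = d.erase k} :=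
    fun mu => finite_content _ _
  rw [← Nat.card_eq_of_bijective φ hφ, Nat.card_sigma]
  exact Finset.sum_coe_sort (strips true lam (d k)) fun mu =>
    Nat.card {T : SemistandardYoungTableau mu // content T = d.erase k}

theorem exponents_congr (b : Bool) {d d' : ℕ → ℕ} {k : ℕ} (h : ∀ j < k, d j = d' j) :
    exponents b d k = exponents b d' k := by
  induction k with
  | zero => rfl
  | succ k ih =>
    rw [exponents, exponents, h k (Nat.lt_succ_self k), ih fun j hj => h j (hj.trans k.lt_succ_self)]

theorem coeff_schur (lam : YoungDiagram) (d : ℕ →₀ ℕ) {k : ℕ} (hd : ∀ j, k ≤ j → d j = 0) :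
    MvPowerSeries.coeff d (schur lam) = stripCount (exponents true d k) lam := by
  change Nat.card {T : SemistandardYoungTableau lam // content T = d} = _
  induction k generalizing lam d with
  | zero =>
    have hd0 : d = 0 := Finsupp.ext fun j => hd j (Nat.zero_le j)
    rw [exponents, stripCount]
    split_ifs with h
    · subst h
      rw [Nat.card_eq_one_iff_unique]
      refine ⟨⟨fun T T' => Subtype.ext (SemistandardYoungTableau.ext fun i j => ?_)⟩,
        ⟨⟨SemistandardYoungTableau.highestWeight ⊥, ?_⟩⟩⟩
      · rw [T.1.zeros (YoungDiagram.notMem_bot _), T'.1.zeros (YoungDiagram.notMem_bot _)]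
      · rw [hd0]
        rfl
    · rw [Nat.card_eq_zero]
      left
      refine ⟨fun T => h ?_⟩
      refine YoungDiagram.ext (Finset.eq_empty_of_forall_notMem fun c hc => ?_)
      refine content_entry_ne_zero T.1 (i := c.1) (j := c.2) ((YoungDiagram.mem_cells _).1 hc) ?_
      rw [T.2]
      exact hd _ (Nat.zero_le _)
  | succ k ih =>
    rw [card_tableaux_succ lam d hd, exponents, stripCount_cons]
    refine Finset.sum_congr rfl fun mu _ => ?_
    rw [ih mu (d.erase k), exponents_congr true fun j hj => Finsupp.erase_ne hj.ne]
    intro j hj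
    rcases hj.lt_or_eq with h | rfl
    · rw [Finsupp.erase_ne h.ne', hd j h]
    · exact Finsupp.erase_same

end Schur

/-! ### Multisets of blocks with even and odd letters -/

section Super

/-- A block of size `m` in even letters (for `true`) and odd letters (for `false`): odd letters are
used at most once. -/
def IsBlock (m : ℕ) (b : ℕ → Bool) (w : ℕ →₀ ℕ) : Prop :=
  w.degree = m ∧ ∀ i, b i = false → w i ≤ 1

/-- The number of odd letters of a block. -/
noncomputable def oddDegree (b : ℕ → Bool) : (ℕ →₀ ℕ) →+ ℕ :=
  Finsupp.weight fun i => if b i then 0 else 1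

/-- The product of the blocks of a multiset. -/
noncomputable abbrev blockProduct : ((ℕ →₀ ℕ) →₀ ℕ) →+ (ℕ →₀ ℕ) :=
  Finsupp.weight (id : (ℕ →₀ ℕ) → ℕ →₀ ℕ)

/-- A multiset of blocks, given by multiplicities, in which a block with an odd number of odd letters
occurs at most once. -/
def IsSuperMultiset (m : ℕ) (b : ℕ → Bool) (c : (ℕ →₀ ℕ) →₀ ℕ) : Prop :=
  ∀ w, c w ≠ 0 → IsBlock m b w ∧ (Odd (oddDegree b w) → c w ≤ 1)

/-- The number of super multisets of blocks with a given product. If all letters are even this is a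
coefficient of `h_n ∘ h_m`, if all are odd and `m` is even one of `h_n ∘ e_m`. -/
noncomputable def superCount (m : ℕ) (b : ℕ → Bool) (d : ℕ →₀ ℕ) : ℕ :=
  {c | IsSuperMultiset m b c ∧ blockProduct c = d}.ncard

theorem smul_le_blockProduct (c : (ℕ →₀ ℕ) →₀ ℕ) (w : ℕ →₀ ℕ) : c w • w ≤ blockProduct c := by
  rw [Finsupp.weight_apply]
  by_cases h : w ∈ c.support
  · exact Finset.single_le_sum (f := fun w => c w • id w) (fun _ _ => zero_le) h
  · rw [Finsupp.notMem_support_iff.1 h, zero_smul]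
    exact zero_le

theorem le_blockProduct {c : (ℕ →₀ ℕ) →₀ ℕ} {w : ℕ →₀ ℕ} (h : c w ≠ 0) : w ≤ blockProduct c := by
  refine le_trans ?_ (smul_le_blockProduct c w)
  intro i
  rw [Finsupp.smul_apply, smul_eq_mul]
  exact Nat.le_mul_of_pos_left _ (Nat.pos_of_ne_zero h)

theorem finite_superMultisets {m : ℕ} (hm : 0 < m) (b : ℕ → Bool) (d : ℕ →₀ ℕ) :
    {c | IsSuperMultiset m b c ∧ blockProduct c = d}.Finite := by
  classical
  refine ((Finset.Iic d).finsupp fun _ => Finset.range (d.degree + 1)).finite_toSet.subset ?_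
  rintro c ⟨hc, rfl⟩
  rw [Finset.mem_coe, Finset.mem_finsupp_iff]
  refine ⟨fun w hw => Finset.mem_coe.2 (Finset.mem_Iic.2
    (le_blockProduct (Finsupp.mem_support_iff.1 hw))), fun w _ => ?_⟩
  rw [Finset.mem_range, Nat.lt_succ_iff]
  by_cases h : c w = 0
  · rw [h]; exact Nat.zero_le _
  · have h1 := Finsupp.degree_mono (smul_le_blockProduct c w)
    rw [map_nsmul, (hc w h).1.1, smul_eq_mul] at h1
    exact (Nat.le_mul_of_pos_right _ hm).trans h1

/-- The names of the letters do not matter, nor do letters which do not occur. -/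
theorem superCount_relabel {m : ℕ} {b b' : ℕ → Bool} {d : ℕ →₀ ℕ} {e : ℕ → ℕ}
    (he : Function.Injective e) (hb : ∀ i, d i ≠ 0 → b' (e i) = b i) :
    superCount m b' (d.mapDomain e) = superCount m b d := by
  classical
  have hE : Function.Injective (Finsupp.mapDomain e : (ℕ →₀ ℕ) → ℕ →₀ ℕ) :=
    Finsupp.mapDomain_injective he
  have hprod : ∀ c : (ℕ →₀ ℕ) →₀ ℕ,
      blockProduct (c.mapDomain (Finsupp.mapDomain e)) = (blockProduct c).mapDomain e := by
    intro c
    induction c using Finsupp.induction_linear with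
    | zero => simp
    | add x y hx hy => rw [Finsupp.mapDomain_add, map_add, map_add, hx, hy, Finsupp.mapDomain_add]
    | single w n =>
      rw [Finsupp.mapDomain_single, Finsupp.weight_single, Finsupp.weight_single,
        Finsupp.mapDomain_smul]
      rfl
  have hblock : ∀ w ≤ d, (IsBlock m b' (w.mapDomain e) ↔ IsBlock m b w) ∧
      oddDegree b' (w.mapDomain e) = oddDegree b w := by
    intro w hw
    have hw' : ∀ i, w i ≠ 0 → b' (e i) = b i := fun i hi => hb i fun h => hi
      (Nat.eq_zero_of_le_zero ((hw i).trans h.le))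
    constructor
    · rw [IsBlock, IsBlock, Finsupp.degree_mapDomain]
      refine and_congr Iff.rfl ⟨fun h i hi => ?_, fun h i hi => ?_⟩
      · by_cases h0 : w i = 0
        · rw [h0]; exact Nat.zero_le _
        · have := h (e i) (by rw [hw' i h0, hi])
          rwa [Finsupp.mapDomain_apply he] at this
      · by_cases hr : i ∈ Set.range e
        · obtain ⟨i, rfl⟩ := hr
          rw [Finsupp.mapDomain_apply he]
          by_cases h0 : w i = 0
          · rw [h0]; exact Nat.zero_le _
          · exact h i (by rw [← hw' i h0, hi])
        · rw [Finsupp.mapDomain_of_notMem_range _ _ hr]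
          exact Nat.zero_le _
    · rw [oddDegree, oddDegree, Finsupp.weight_apply, Finsupp.weight_apply,
        Finsupp.sum_mapDomain_index_inj he]
      refine Finset.sum_congr rfl fun i hi => ?_
      dsimp only
      rw [hw' i (Finsupp.mem_support_iff.1 hi)]
  have himage : {c | IsSuperMultiset m b' c ∧ blockProduct c = d.mapDomain e} =
      Finsupp.mapDomain (Finsupp.mapDomain e) ''
        {c | IsSuperMultiset m b c ∧ blockProduct c = d} := by
    ext c'
    constructor
    · rintro ⟨hc, hd⟩
      have hsupp : (c'.support : Set (ℕ →₀ ℕ)) ⊆ Set.range (Finsupp.mapDomain e) := by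
        intro w hw
        have hle : w ≤ d.mapDomain e := hd ▸ le_blockProduct (Finsupp.mem_support_iff.1 hw)
        refine ⟨w.comapDomain e he.injOn, Finsupp.mapDomain_comapDomain e he w fun i hi => ?_⟩
        by_contra hr
        have := hle i
        rw [Finsupp.mapDomain_of_notMem_range _ _ hr] at this
        exact Finsupp.mem_support_iff.1 hi (Nat.eq_zero_of_le_zero this)
      obtain ⟨c, rfl⟩ : ∃ c, Finsupp.mapDomain (Finsupp.mapDomain e) c = c' :=
        ⟨_, Finsupp.mapDomain_comapDomain _ hE c' hsupp⟩
      rw [hprod] at hd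
      have hd' := hE hd
      refine ⟨c, ⟨fun w hw => ?_, hd'⟩, rfl⟩
      have hle : w ≤ d := hd' ▸ le_blockProduct hw
      have := hc (w.mapDomain e) (by rwa [Finsupp.mapDomain_apply hE])
      rwa [Finsupp.mapDomain_apply hE, (hblock w hle).1, (hblock w hle).2] at this
    · rintro ⟨c, ⟨hc, hd⟩, rfl⟩
      refine ⟨fun w' hw' => ?_, by rw [hprod, hd]⟩
      by_cases hr : w' ∈ Set.range (Finsupp.mapDomain e : (ℕ →₀ ℕ) → ℕ →₀ ℕ)
      · obtain ⟨w, rfl⟩ := hr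
        rw [Finsupp.mapDomain_apply hE] at hw' ⊢
        have hle : w ≤ d := hd ▸ le_blockProduct hw'
        rw [(hblock w hle).1, (hblock w hle).2]
        exact hc w hw'
      · exact absurd (Finsupp.mapDomain_of_notMem_range _ _ hr) hw'
  rw [superCount, superCount, himage]
  exact Set.ncard_image_of_injective _ (Finsupp.mapDomain_injective hE)

/-! #### Exchanging an even and an odd letter -/

/-- Replace the odd letter `q` by the even letter `p`. -/
noncomputable def mergeLetters (p q : ℕ) (w : ℕ →₀ ℕ) : ℕ →₀ ℕ :=
  w.erase q + Finsupp.single p (w q)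

/-- Replace the letter `p`, once, by `q`. -/
noncomputable def exchangeLetter (p q : ℕ) (w : ℕ →₀ ℕ) : ℕ →₀ ℕ :=
  w - Finsupp.single p 1 + Finsupp.single q 1

/-- The blocks with `p` or `q` in a multiset, up to exchanging `p` and `q`. -/
def usedBlocks (p q : ℕ) (c : (ℕ →₀ ℕ) →₀ ℕ) : Set (ℕ →₀ ℕ) :=
  {u | ∃ w, c w ≠ 0 ∧ 0 < w p + w q ∧ mergeLetters p q w = u}

open Classical in
/-- Remove `y` from the multiset and add `x`, or conversely if `y` does not occur. -/
noncomputable def swapBlock (x y : ℕ →₀ ℕ) (c : (ℕ →₀ ℕ) →₀ ℕ) : (ℕ →₀ ℕ) →₀ ℕ :=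
  if c y = 0 then c - Finsupp.single x 1 + Finsupp.single y 1
  else c - Finsupp.single y 1 + Finsupp.single x 1

theorem swapBlock_of_eq {x y : ℕ →₀ ℕ} {c : (ℕ →₀ ℕ) →₀ ℕ} (h : c y = 0) (hx : c x ≠ 0) :
    swapBlock x y c + Finsupp.single x 1 = c + Finsupp.single y 1 := by
  rw [swapBlock, if_pos h, add_right_comm, tsub_add_cancel_of_le]
  exact Finsupp.single_le_iff.2 (Nat.one_le_iff_ne_zero.2 hx)

theorem swapBlock_of_ne {x y : ℕ →₀ ℕ} {c : (ℕ →₀ ℕ) →₀ ℕ} (h : c y ≠ 0) :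
    swapBlock x y c + Finsupp.single y 1 = c + Finsupp.single x 1 := by
  rw [swapBlock, if_neg h, add_right_comm, tsub_add_cancel_of_le]
  exact Finsupp.single_le_iff.2 (Nat.one_le_iff_ne_zero.2 h)

theorem swapBlock_apply_of_ne {x y w : ℕ →₀ ℕ} (c : (ℕ →₀ ℕ) →₀ ℕ) (hx : w ≠ x) (hy : w ≠ y) :
    swapBlock x y c w = c w := by
  rw [swapBlock]
  split_ifs <;> simp [hx, hy]

section Swap

variable {x y : ℕ →₀ ℕ} {c : (ℕ →₀ ℕ) →₀ ℕ}

theorem swapBlock_right (hxy : x ≠ y) (hy : c y ≤ 1) : swapBlock x y c y = 1 - c y := by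
  rw [swapBlock]
  split_ifs with h
  · simp [h, hxy.symm]
  · have : c y = 1 := by omega
    simp [this, hxy.symm]

theorem swapBlock_swapBlock (hxy : x ≠ y) (hy : c y ≤ 1) (h0 : c x ≠ 0 ∨ c y ≠ 0) :
    swapBlock x y (swapBlock x y c) = c := by
  by_cases h : c y = 0
  · have hx : c x ≠ 0 := h0.resolve_right (not_not.2 h)
    have h1 := swapBlock_of_eq h hx
    have h2 := swapBlock_of_ne (x := x) (y := y) (c := swapBlock x y c)
      (by rw [swapBlock_right hxy hy]; omega)
    exact add_right_cancel (h2.trans h1)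
  · have h1 := swapBlock_of_ne (x := x) h
    have h3 : swapBlock x y c x ≠ 0 := by
      have := DFunLike.congr_fun h1 x
      rw [Finsupp.add_apply, Finsupp.add_apply, Finsupp.single_eq_same,
        Finsupp.single_eq_of_ne hxy] at this
      omega
    have h2 := swapBlock_of_eq (x := x) (y := y) (c := swapBlock x y c)
      (by rw [swapBlock_right hxy hy]; omega) h3
    exact add_right_cancel (h2.trans h1)

theorem swapBlock_or (hxy : x ≠ y) (hy : c y ≤ 1) :
    swapBlock x y c x ≠ 0 ∨ swapBlock x y c y ≠ 0 := by
  rw [swapBlock_right hxy hy]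
  by_cases h : c y = 0
  · right; omega
  · left
    have := DFunLike.congr_fun (swapBlock_of_ne (x := x) h) x
    rw [Finsupp.add_apply, Finsupp.add_apply, Finsupp.single_eq_same,
      Finsupp.single_eq_of_ne hxy] at this
    omega

end Swap

section Relation

variable {m p q : ℕ} {b : ℕ → Bool}

theorem eq_or_eq_of_mergeLetters {w : ℕ →₀ ℕ} (hw : w q ≤ 1) :
    w = mergeLetters p q w ∨ w = exchangeLetter p q (mergeLetters p q w) := by
  rcases Nat.le_one_iff_eq_zero_or_eq_one.1 hw with h | h
  · left
    rw [mergeLetters, h, Finsupp.single_zero, add_zero, Finsupp.erase_of_notMem_support]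
    exact Finsupp.notMem_support_iff.2 h
  · right
    rw [exchangeLetter, mergeLetters, h, add_tsub_cancel_right, ← h, Finsupp.erase_add_single]

theorem mergeLetters_eq_self {u : ℕ →₀ ℕ} (h : u q = 0) : mergeLetters p q u = u := by
  rw [mergeLetters, h, Finsupp.single_zero, add_zero, Finsupp.erase_of_notMem_support]
  exact Finsupp.notMem_support_iff.2 h

theorem exchangeLetter_add {u : ℕ →₀ ℕ} (hp : u p ≠ 0) :
    exchangeLetter p q u + Finsupp.single p 1 = u + Finsupp.single q 1 := by
  rw [exchangeLetter, add_right_comm, tsub_add_cancel_of_le]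
  exact Finsupp.single_le_iff.2 (Nat.one_le_iff_ne_zero.2 hp)

theorem mergeLetters_exchangeLetter (hpq : p ≠ q) {u : ℕ →₀ ℕ} (hp : u p ≠ 0) (hq : u q = 0) :
    mergeLetters p q (exchangeLetter p q u) = u := by
  have h := exchangeLetter_add (q := q) hp
  have hq' : exchangeLetter p q u q = 1 := by
    have := DFunLike.congr_fun h q
    simpa [hpq.symm, hq] using this
  rw [mergeLetters, hq']
  have h1 : (exchangeLetter p q u).erase q + Finsupp.single q 1 = exchangeLetter p q u := by
    rw [← hq', Finsupp.erase_add_single]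
  rw [← h1, add_right_comm] at h
  exact add_right_cancel h

/-- A pair of blocks, the first with an even, the second with an odd number of odd letters, which
differ by exchanging `p` and `q`. -/
structure IsSwapPair (m p q : ℕ) (b : ℕ → Bool) (u x y : ℕ →₀ ℕ) : Prop where
  block_left : IsBlock m b x
  block_right : IsBlock m b y
  even : Even (oddDegree b x)
  odd : Odd (oddDegree b y)
  sum : x + Finsupp.single q 1 = y + Finsupp.single p 1 ∨
    y + Finsupp.single q 1 = x + Finsupp.single p 1
  merge_left : mergeLetters p q x = u
  merge_right : mergeLetters p q y = u
  pos_left : 0 < x p + x q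
  pos_right : 0 < y p + y q
  cases : ∀ w, IsBlock m b w → mergeLetters p q w = u → w = x ∨ w = y

/-- A block with `p` or `q` and the block obtained by exchanging these letters form a swap pair, since
the exchange changes the parity of the number of odd letters. -/
theorem exists_isSwapPair (hp : b p = true) (hq : b q = false) {w : ℕ →₀ ℕ} (hw : IsBlock m b w)
    (h0 : 0 < w p + w q) : ∃ x y, IsSwapPair m p q b (mergeLetters p q w) x y := by
  have hpq : p ≠ q := fun h => by rw [h, hq] at hp; exact Bool.noConfusion hp
  set u := mergeLetters p q w with hu
  have huq : u q = 0 := by simp [hu, mergeLetters, hpq.symm]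
  have hup : u p = w p + w q := by simp [hu, mergeLetters, hpq]
  have hup0 : u p ≠ 0 := by omega
  have hub : IsBlock m b u := by
    constructor
    · have h1 : u + Finsupp.single q (w q) = w + Finsupp.single p (w q) := by
        rw [hu, mergeLetters, add_right_comm, Finsupp.erase_add_single]
      have h2 := congrArg Finsupp.degree h1
      rw [map_add, map_add, Finsupp.degree_single, Finsupp.degree_single, hw.1] at h2
      exact add_right_cancel h2
    · intro i hi
      have hip : i ≠ p := fun h => by rw [h, hp] at hi; exact Bool.noConfusion hi
      by_cases hiq : i = q
      · rw [hiq, huq]; exact Nat.zero_le _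
      · have : u i = w i := by simp [hu, mergeLetters, hip, hiq]
        rw [this]
        exact hw.2 i hi
  set v := exchangeLetter p q u with hv
  have hvu : v + Finsupp.single p 1 = u + Finsupp.single q 1 := exchangeLetter_add hup0
  have hvb : IsBlock m b v := by
    constructor
    · have h2 := congrArg Finsupp.degree hvu
      rw [map_add, map_add, Finsupp.degree_single, Finsupp.degree_single, hub.1] at h2
      exact add_right_cancel h2
    · intro i hi
      have hip : i ≠ p := fun h => by rw [h, hp] at hi; exact Bool.noConfusion hi
      have h2 := DFunLike.congr_fun hvu i
      rw [Finsupp.add_apply, Finsupp.add_apply, Finsupp.single_eq_of_ne hip, add_zero] at h2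
      rw [h2]
      by_cases hiq : i = q
      · rw [hiq, huq, Finsupp.single_eq_same]
      · rw [Finsupp.single_eq_of_ne hiq, add_zero]
        exact hub.2 i hi
  have hodd : oddDegree b v = oddDegree b u + 1 := by
    have h2 := congrArg (oddDegree b) hvu
    rw [map_add, map_add, oddDegree, Finsupp.weight_single, Finsupp.weight_single, hp, hq] at h2
    simpa [oddDegree] using h2
  have hvq : v q = 1 := by
    have h2 := DFunLike.congr_fun hvu q
    simpa [hpq.symm, huq] using h2
  have hmu : mergeLetters p q u = u := mergeLetters_eq_self huq
  have hmv : mergeLetters p q v = u := mergeLetters_exchangeLetter hpq hup0 huq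
  have hcases : ∀ z, IsBlock m b z → mergeLetters p q z = u → z = u ∨ z = v := by
    intro z hz hzu
    have := eq_or_eq_of_mergeLetters (p := p) (hz.2 q hq)
    rwa [hzu] at this
  rcases Nat.even_or_odd (oddDegree b u) with h | h
  · exact ⟨u, v, hub, hvb, h, by rw [hodd]; exact h.add_one, Or.inl hvu.symm, hmu, hmv, by omega,
      by omega, hcases⟩
  · exact ⟨v, u, hvb, hub, by rw [hodd]; exact h.add_one, h, Or.inr hvu.symm, hmv, hmu, by omega,
      by omega, fun z hz hzu => (hcases z hz hzu).symm⟩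

open Classical in
/-- The involution: exchange `p` and `q` in some block. The choice depends only on `usedBlocks`, which
the exchange does not change. -/
noncomputable def swapSuper (m p q : ℕ) (b : ℕ → Bool) (c : (ℕ →₀ ℕ) →₀ ℕ) : (ℕ →₀ ℕ) →₀ ℕ :=
  let t := Classical.epsilon fun t : (ℕ →₀ ℕ) × (ℕ →₀ ℕ) =>
    ∃ u ∈ usedBlocks p q c, IsSwapPair m p q b u t.1 t.2
  swapBlock t.1 t.2 c

/-- The properties of the involution: it preserves super multisets, and turns one `p` into `q` or one `q`
into `p`. -/
theorem swapSuper_spec (hp : b p = true) (hq : b q = false) {c : (ℕ →₀ ℕ) →₀ ℕ}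
    (hc : IsSuperMultiset m b c) (h0 : 0 < blockProduct c p + blockProduct c q) :
    IsSuperMultiset m b (swapSuper m p q b c) ∧ swapSuper m p q b (swapSuper m p q b c) = c ∧
      (blockProduct (swapSuper m p q b c) + Finsupp.single p 1 =
          blockProduct c + Finsupp.single q 1 ∨
        blockProduct (swapSuper m p q b c) + Finsupp.single q 1 =
          blockProduct c + Finsupp.single p 1) := by
  have hne : ∃ w, c w ≠ 0 ∧ 0 < w p + w q := by
    by_contra! hcon
    rw [Finsupp.weight_apply, Finsupp.sum_apply, Finsupp.sum_apply, Finsupp.sum, Finsupp.sum,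
      ← Finset.sum_add_distrib, Finset.sum_eq_zero] at h0
    · exact lt_irrefl _ h0
    · intro w hw
      have := hcon w (Finsupp.mem_support_iff.1 hw)
      rw [Finsupp.smul_apply, Finsupp.smul_apply, ← smul_add, id, Nat.eq_zero_of_le_zero this,
        smul_zero]
  set P : (ℕ →₀ ℕ) × (ℕ →₀ ℕ) → Prop := fun t =>
    ∃ u ∈ usedBlocks p q c, IsSwapPair m p q b u t.1 t.2 with hP
  have hex : ∃ t, P t := by
    obtain ⟨w, hw, hw0⟩ := hne
    obtain ⟨x, y, h⟩ := exists_isSwapPair hp hq (hc w hw).1 hw0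
    exact ⟨(x, y), _, ⟨w, hw, hw0, rfl⟩, h⟩
  obtain ⟨x, y, hxy⟩ : ∃ x y, Classical.epsilon P = (x, y) := ⟨_, _, rfl⟩
  have hspec : P (x, y) := hxy ▸ Classical.epsilon_spec hex
  have hswap : swapSuper m p q b c = swapBlock x y c := by
    rw [swapSuper]
    change swapBlock (Classical.epsilon P).1 (Classical.epsilon P).2 c = _
    rw [hxy]
  obtain ⟨u, ⟨w, hw, hw0, hwu⟩, hpair⟩ := hspec
  have hne' : x ≠ y := fun h => by
    have := hpair.even
    rw [h] at this
    exact Nat.not_even_iff_odd.2 hpair.odd this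
  have hy1 : c y ≤ 1 := by
    by_cases h : c y = 0
    · rw [h]; exact Nat.zero_le _
    · exact (hc y h).2 hpair.odd
  have hor : c x ≠ 0 ∨ c y ≠ 0 := by
    rcases hpair.cases w (hc w hw).1 hwu with rfl | rfl
    · exact Or.inl hw
    · exact Or.inr hw
  have hused : usedBlocks p q (swapBlock x y c) = usedBlocks p q c := by
    have key : ∀ c' c'' : (ℕ →₀ ℕ) →₀ ℕ, (∀ z, z ≠ x → z ≠ y → c' z = c'' z) →
        (c'' x ≠ 0 ∨ c'' y ≠ 0) → usedBlocks p q c' ⊆ usedBlocks p q c'' := by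
      rintro c' c'' heq h _ ⟨z, hz, hz0, rfl⟩
      have hu' : u ∈ usedBlocks p q c'' := by
        rcases h with h | h
        · exact ⟨x, h, hpair.pos_left, hpair.merge_left⟩
        · exact ⟨y, h, hpair.pos_right, hpair.merge_right⟩
      by_cases hzx : z = x
      · rw [hzx, hpair.merge_left]; exact hu'
      by_cases hzy : z = y
      · rw [hzy, hpair.merge_right]; exact hu'
      exact ⟨z, by rwa [← heq z hzx hzy], hz0, rfl⟩
    exact Set.Subset.antisymm (key _ _ (fun z h1 h2 => swapBlock_apply_of_ne c h1 h2) hor)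
      (key _ _ (fun z h1 h2 => (swapBlock_apply_of_ne c h1 h2).symm) (swapBlock_or hne' hy1))
  refine ⟨?_, ?_, ?_⟩
  · rw [hswap]
    intro z hz
    by_cases hzx : z = x
    · rw [hzx]
      exact ⟨hpair.block_left, fun h => absurd hpair.even (Nat.not_even_iff_odd.2 h)⟩
    by_cases hzy : z = y
    · rw [hzy, swapBlock_right hne' hy1]
      exact ⟨hpair.block_right, fun _ => Nat.sub_le _ _⟩
    rw [swapBlock_apply_of_ne c hzx hzy] at hz ⊢
    exact hc z hz
  · have h1 : swapSuper m p q b (swapBlock x y c) = swapBlock x y (swapBlock x y c) := by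
      rw [swapSuper, hused]
      change swapBlock (Classical.epsilon P).1 (Classical.epsilon P).2 _ = _
      rw [hxy]
    rw [hswap, h1, swapBlock_swapBlock hne' hy1 hor]
  · rw [hswap]
    have h1 : blockProduct (swapBlock x y c) + x = blockProduct c + y ∨
        blockProduct (swapBlock x y c) + y = blockProduct c + x := by
      by_cases h : c y = 0
      · left
        have := congrArg blockProduct (swapBlock_of_eq h (hor.resolve_right (not_not.2 h)))
        rwa [map_add, map_add, Finsupp.weight_single, Finsupp.weight_single, one_smul,
          one_smul] at this
      · right
        have := congrArg blockProduct (swapBlock_of_ne (x := x) h)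
        rwa [map_add, map_add, Finsupp.weight_single, Finsupp.weight_single, one_smul,
          one_smul] at this
    generalize blockProduct (swapBlock x y c) = A at h1 ⊢
    generalize blockProduct c = B at h1 ⊢
    have hc1 : ∀ s t z z' : ℕ →₀ ℕ, A + z = B + z' → z' + s = z + t → A + s = B + t := by
      intro s t z z' e1 e2
      refine add_right_cancel (b := z) ?_
      rw [add_right_comm, e1, add_assoc, e2, ← add_assoc, add_right_comm]
    rcases h1 with h1 | h1 <;> rcases hpair.sum with h2 | h2
    · exact Or.inl (hc1 _ _ _ _ h1 h2.symm)
    · exact Or.inr (hc1 _ _ _ _ h1 h2)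
    · exact Or.inr (hc1 _ _ _ _ h1 h2)
    · exact Or.inl (hc1 _ _ _ _ h1 h2.symm)

/-- The relation between elementary and complete symmetric functions holds for super multisets, with the
odd letter `q` in the role of the elementary and the even letter `p` in that of the complete ones. -/
theorem sum_superCount_eq_zero (hm : 0 < m) (hp : b p = true) (hq : b q = false) {d : ℕ →₀ ℕ}
    (hdp : d p = 0) (hdq : d q = 0) {K : ℕ} (hK : 0 < K) :
    ∑ i ∈ Finset.range (K + 1), (-1 : ℤ) ^ i *
      superCount m b (d + Finsupp.single p (K - i) + Finsupp.single q i) = 0 := by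
  classical
  have hpq : p ≠ q := fun h => by rw [h, hq] at hp; exact Bool.noConfusion hp
  set X : ℕ → Finset ((ℕ →₀ ℕ) →₀ ℕ) := fun i => (finite_superMultisets hm b
    (d + Finsupp.single p (K - i) + Finsupp.single q i)).toFinset with hX
  have h1 : ∀ i, (superCount m b (d + Finsupp.single p (K - i) + Finsupp.single q i) : ℤ) =
      ∑ _c ∈ X i, 1 := by
    intro i
    rw [Finset.sum_const, nsmul_eq_mul, mul_one, superCount, Set.ncard_eq_toFinset_card _
      (finite_superMultisets hm b _)]
  have key : ∀ i c, i ∈ Finset.range (K + 1) ∧ c ∈ X i ↔ IsSuperMultiset m b c ∧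
      (∀ j, j ≠ p → j ≠ q → blockProduct c j = d j) ∧ blockProduct c p + blockProduct c q = K ∧
        blockProduct c q = i := by
    intro i c
    rw [Finset.mem_range, hX, Set.Finite.mem_toFinset]
    constructor
    · rintro ⟨hi, hc, hd⟩
      rw [hd]
      refine ⟨hc, fun j hjp hjq => by simp [hjp, hjq], ?_, by simp [hdq, hpq.symm]⟩
      simp [hdp, hdq, hpq, hpq.symm]
      omega
    · rintro ⟨hc, hj, hK', rfl⟩
      refine ⟨by omega, hc, ?_⟩
      ext j
      by_cases hjp : j = p
      · subst hjp
        simp [hdp, hpq]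
        omega
      · by_cases hjq : j = q
        · subst hjq
          simp [hdq, hpq.symm]
        · simp [hj j hjp hjq, hjp, hjq]
  simp only [h1, Finset.mul_sum, mul_one]
  rw [Finset.sum_sigma']
  have hg : ∀ {i c}, IsSuperMultiset m b c ∧
      (∀ j, j ≠ p → j ≠ q → blockProduct c j = d j) ∧ blockProduct c p + blockProduct c q = K ∧
        blockProduct c q = i →
      (IsSuperMultiset m b (swapSuper m p q b c) ∧
        (∀ j, j ≠ p → j ≠ q → blockProduct (swapSuper m p q b c) j = d j) ∧
        blockProduct (swapSuper m p q b c) p + blockProduct (swapSuper m p q b c) q = K) ∧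
        swapSuper m p q b (swapSuper m p q b c) = c ∧
        (blockProduct (swapSuper m p q b c) q = i + 1 ∨
          i = blockProduct (swapSuper m p q b c) q + 1) := by
    rintro i c ⟨hc, hj, hK', rfl⟩
    obtain ⟨h2, h3, h4⟩ := swapSuper_spec hp hq hc (by omega)
    rcases h4 with h4 | h4
    · have e1 := DFunLike.congr_fun h4 p
      have e2 := DFunLike.congr_fun h4 q
      simp only [Finsupp.add_apply, Finsupp.single_eq_same, Finsupp.single_eq_of_ne hpq,
        Finsupp.single_eq_of_ne hpq.symm, add_zero] at e1 e2
      refine ⟨⟨h2, fun j hjp hjq => ?_, by omega⟩, h3, Or.inl e2⟩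
      have := DFunLike.congr_fun h4 j
      simpa [hjp, hjq, hj j hjp hjq] using this
    · have e1 := DFunLike.congr_fun h4 p
      have e2 := DFunLike.congr_fun h4 q
      simp only [Finsupp.add_apply, Finsupp.single_eq_same, Finsupp.single_eq_of_ne hpq,
        Finsupp.single_eq_of_ne hpq.symm, add_zero] at e1 e2
      refine ⟨⟨h2, fun j hjp hjq => ?_, by omega⟩, h3, Or.inr e2.symm⟩
      have := DFunLike.congr_fun h4 j
      simpa [hjp, hjq, hj j hjp hjq] using this
  refine Finset.sum_involution (fun t _ => ⟨blockProduct (swapSuper m p q b t.2) q,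
    swapSuper m p q b t.2⟩) ?_ ?_ ?_ ?_
  · rintro ⟨i, c⟩ ht
    replace ht := (key i c).1 (Finset.mem_sigma.1 ht)
    obtain ⟨-, -, h⟩ := hg ht
    dsimp only
    rcases h with h | h
    · rw [h, pow_succ]; ring
    · conv_lhs => rw [h, pow_succ]
      ring
  · rintro ⟨i, c⟩ ht _ h
    replace ht := (key i c).1 (Finset.mem_sigma.1 ht)
    obtain ⟨-, -, h'⟩ := hg ht
    simp only [Sigma.mk.injEq] at h
    omega
  · rintro ⟨i, c⟩ ht
    replace ht := (key i c).1 (Finset.mem_sigma.1 ht)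
    obtain ⟨h, -, -⟩ := hg ht
    exact Finset.mem_sigma.2 <| (key _ _).2 ⟨h.1, h.2.1, h.2.2, rfl⟩
  · rintro ⟨i, c⟩ ht
    replace ht := (key i c).1 (Finset.mem_sigma.1 ht)
    obtain ⟨-, h, -⟩ := hg ht
    simp only [h, Sigma.mk.injEq, heq_eq_eq, and_true]
    exact ht.2.2.2

end Relation

end Super

/-! ### Conjugation -/

section Lists

/-- The kinds of the letters of a list. -/
def letterKind (L : List (Bool × ℕ)) (i : ℕ) : Bool := (L.getD i (true, 0)).1

/-- The exponents of the letters of a list, as a monomial. -/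
noncomputable def letterExponents (L : List (Bool × ℕ)) : ℕ →₀ ℕ :=
  Finsupp.onFinset (Finset.range L.length) (fun i => (L.getD i (true, 0)).2) fun i hi => by
    rw [Finset.mem_range]
    by_contra! h
    exact hi (by rw [List.getD_eq_default _ _ h])

theorem letterExponents_apply (L : List (Bool × ℕ)) (i : ℕ) :
    letterExponents L i = (L.getD i (true, 0)).2 := rfl

/-- The number of super multisets of blocks whose letters and their exponents are given by a list. -/
noncomputable def superCountList (m : ℕ) (L : List (Bool × ℕ)) : ℕ :=
  superCount m (letterKind L) (letterExponents L)

theorem getD_append_cons (pre post : List (Bool × ℕ)) (x : Bool × ℕ) (i : ℕ) :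
    (pre ++ x :: post).getD i (true, 0) = if i < pre.length then pre.getD i (true, 0)
      else if i = pre.length then x else post.getD (i - (pre.length + 1)) (true, 0) := by
  split_ifs with h1 h2
  · rw [List.getD_append _ _ _ _ h1]
  · rw [List.getD_append_right _ _ _ _ (not_lt.1 h1), h2, Nat.sub_self, List.getD_cons_zero]
  · rw [List.getD_append_right _ _ _ _ (not_lt.1 h1)]
    obtain ⟨r, rfl⟩ : ∃ r, i = pre.length + 1 + r := ⟨i - (pre.length + 1), by omega⟩
    rw [Nat.add_sub_cancel_left, add_assoc, Nat.add_sub_cancel_left, add_comm 1,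
      List.getD_cons_succ]

theorem mapDomain_eq_of_forall {d d' : ℕ →₀ ℕ} {e : ℕ → ℕ} (he : Function.Injective e)
    (h1 : ∀ i, d' (e i) = d i) (h2 : ∀ j, j ∉ Set.range e → d' j = 0) : d.mapDomain e = d' := by
  ext j
  by_cases hj : j ∈ Set.range e
  · obtain ⟨i, rfl⟩ := hj
    rw [Finsupp.mapDomain_apply he, h1]
  · rw [Finsupp.mapDomain_of_notMem_range _ _ hj, h2 j hj]

/-- Letters that are not used may be dropped. -/
theorem superCountList_drop (m : ℕ) (pre post : List (Bool × ℕ)) (b : Bool) :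
    superCountList m (pre ++ (b, 0) :: post) = superCountList m (pre ++ post) := by
  set e : ℕ → ℕ := fun i => if i < pre.length then i else i + 1 with he
  have hinj : Function.Injective e := by
    intro i j hij
    simp only [he] at hij
    split_ifs at hij <;> omega
  have hget : ∀ i, (pre ++ (b, 0) :: post).getD (e i) (true, 0) =
      (pre ++ post).getD i (true, 0) := by
    intro i
    rw [getD_append_cons]
    by_cases h : i < pre.length
    · have : e i = i := if_pos h
      rw [this, if_pos h, List.getD_append _ _ _ _ h]
    · have : e i = i + 1 := if_neg h
      rw [this, if_neg (by omega), if_neg (by omega), List.getD_append_right _ _ _ _ (not_lt.1 h)]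
      congr 1
      omega
  rw [superCountList, superCountList, ← superCount_relabel hinj (b := letterKind (pre ++ post))
    (b' := letterKind (pre ++ (b, 0) :: post))]
  · congr 1
    refine (mapDomain_eq_of_forall hinj (fun i => ?_) fun j hj => ?_).symm
    · rw [letterExponents_apply, hget, letterExponents_apply]
    · have : j = pre.length := by
        by_contra hne
        rcases Nat.lt_or_gt_of_ne hne with h | h
        · exact hj ⟨j, if_pos h⟩
        · refine hj ⟨j - 1, ?_⟩
          have : ¬ j - 1 < pre.length := by omega
          simp only [he, if_neg this]
          omega
      rw [letterExponents_apply, getD_append_cons, if_neg (by omega), if_pos this]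
  · intro i _
    rw [letterKind, hget, letterKind]

theorem sum_superCountList_eq_zero {m : ℕ} (hm : 0 < m) (pre post : List (Bool × ℕ)) {K : ℕ}
    (hK : 0 < K) : ∑ i ∈ Finset.range (K + 1),
      (-1 : ℤ) ^ i * superCountList m (pre ++ (true, K - i) :: (false, i) :: post) = 0 := by
  have hget : ∀ j i r, (pre ++ (true, j) :: (false, i) :: post).getD r (true, 0) =
      if r < pre.length then pre.getD r (true, 0) else if r = pre.length then (true, j) else
        if r = pre.length + 1 then (false, i) else
          post.getD (r - (pre.length + 1) - 1) (true, 0) := by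
    intro j i r
    rw [getD_append_cons]
    split_ifs with h1 h2 h3
    · rfl
    · rfl
    · rw [h3, Nat.sub_self, List.getD_cons_zero]
    · obtain ⟨t, rfl⟩ : ∃ t, r = pre.length + 1 + (t + 1) := ⟨r - (pre.length + 2), by omega⟩
      rw [Nat.add_sub_cancel_left, List.getD_cons_succ, Nat.add_sub_cancel]
  set b := letterKind (pre ++ (true, 0) :: (false, 0) :: post) with hb
  set d := letterExponents (pre ++ (true, 0) :: (false, 0) :: post) with hd
  have hkind : ∀ j i, letterKind (pre ++ (true, j) :: (false, i) :: post) = b := by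
    intro j i
    funext r
    rw [hb, letterKind, letterKind, hget, hget]
    split_ifs <;> rfl
  have hexp : ∀ j i, letterExponents (pre ++ (true, j) :: (false, i) :: post) =
      d + Finsupp.single pre.length j + Finsupp.single (pre.length + 1) i := by
    intro j i
    ext r
    rw [hd, Finsupp.add_apply, Finsupp.add_apply, letterExponents_apply, letterExponents_apply,
      hget, hget, Finsupp.single_apply, Finsupp.single_apply]
    split_ifs <;> omega
  have h1 : b pre.length = true := by
    rw [hb, letterKind, hget, if_neg (lt_irrefl _), if_pos rfl]
  have h2 : b (pre.length + 1) = false := by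
    rw [hb, letterKind, hget, if_neg (by omega), if_neg (by omega), if_pos rfl]
  have h3 : d pre.length = 0 := by
    rw [hd, letterExponents_apply, hget, if_neg (lt_irrefl _), if_pos rfl]
  have h4 : d (pre.length + 1) = 0 := by
    rw [hd, letterExponents_apply, hget, if_neg (by omega), if_neg (by omega), if_pos rfl]
  simp only [superCountList, hkind, hexp]
  exact sum_superCount_eq_zero hm h1 h2 h3 h4 hK

/-- A function of lists of even and odd letters which satisfies the relations between elementary and
complete symmetric functions is determined by its values at lists of odd letters. -/
theorem eq_of_eq_on_odd {Φ Ψ : List (Bool × ℕ) → ℤ}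
    (hΦ0 : ∀ pre post b, Φ (pre ++ (b, 0) :: post) = Φ (pre ++ post))
    (hΨ0 : ∀ pre post b, Ψ (pre ++ (b, 0) :: post) = Ψ (pre ++ post))
    (hΦ : ∀ pre post K, 0 < K → ∑ i ∈ Finset.range (K + 1),
      (-1 : ℤ) ^ i * Φ (pre ++ (true, K - i) :: (false, i) :: post) = 0)
    (hΨ : ∀ pre post K, 0 < K → ∑ i ∈ Finset.range (K + 1),
      (-1 : ℤ) ^ i * Ψ (pre ++ (true, K - i) :: (false, i) :: post) = 0)
    {s : ℕ} (hodd : ∀ L : List (Bool × ℕ), (∀ x ∈ L, x.1 = false) → (L.map Prod.snd).sum = s →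
      Φ L = Ψ L) (L : List (Bool × ℕ)) (hL : (L.map Prod.snd).sum = s) : Φ L = Ψ L := by
  obtain ⟨n, hn⟩ : ∃ n, (L.map fun x => bif x.1 then x.2 + 1 else 0).sum = n := ⟨_, rfl⟩
  induction n using Nat.strong_induction_on generalizing L with
  | _ n ih =>
    by_cases hall : ∀ x ∈ L, x.1 = false
    · exact hodd L hall hL
    · push Not at hall
      obtain ⟨⟨c, K⟩, hx, hc⟩ := hall
      have hc' : c = true := by simpa using hc
      subst hc'
      obtain ⟨pre, post, rfl⟩ := List.append_of_mem hx
      simp only [List.map_append, List.map_cons, List.sum_append, List.sum_cons, cond_true] at hL hn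
      rcases Nat.eq_zero_or_pos K with rfl | hK
      · rw [hΦ0, hΨ0]
        refine ih _ ?_ _ ?_ rfl
        · simp only [List.map_append, List.sum_append]
          omega
        · simp only [List.map_append, List.sum_append]
          omega
      · have h1 := hΦ pre post K hK
        have h2 := hΨ pre post K hK
        have e1 := hΦ0 (pre ++ [(true, K)]) post false
        have e2 := hΨ0 (pre ++ [(true, K)]) post false
        simp only [List.append_assoc, List.singleton_append] at e1 e2
        rw [Finset.sum_range_succ', pow_zero, one_mul, Nat.sub_zero, e1] at h1
        rw [Finset.sum_range_succ', pow_zero, one_mul, Nat.sub_zero, e2] at h2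
        have h3 : ∀ i ∈ Finset.range K,
            (-1 : ℤ) ^ (i + 1) * Φ (pre ++ (true, K - (i + 1)) :: (false, i + 1) :: post) =
              (-1 : ℤ) ^ (i + 1) * Ψ (pre ++ (true, K - (i + 1)) :: (false, i + 1) :: post) := by
          intro i hi
          rw [Finset.mem_range] at hi
          congr 1
          refine ih _ ?_ _ ?_ rfl
          · simp only [List.map_append, List.map_cons, List.sum_append, List.sum_cons, cond_true,
              cond_false]
            omega
          · simp only [List.map_append, List.map_cons, List.sum_append, List.sum_cons]
            omega
        rw [Finset.sum_congr rfl h3] at h1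
        exact add_left_cancel (h1.trans h2.symm)

theorem superCountList_exponents (m : ℕ) (b : Bool) {d : ℕ →₀ ℕ} {k : ℕ}
    (hd : ∀ j, k ≤ j → d j = 0) :
    superCountList m (exponents b d k) = superCount m (fun _ => b) d := by
  have hlen : ∀ k, (exponents b d k).length = k := by
    intro k
    induction k with
    | zero => rfl
    | succ k ih => rw [exponents, List.length_cons, ih]
  have hget : ∀ k i, i < k → (exponents b d k).getD i (true, 0) = (b, d (k - 1 - i)) := by
    intro k
    induction k with
    | zero => intro i hi; exact absurd hi (Nat.not_lt_zero i)
    | succ k ih =>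
      intro i hi
      cases i with
      | zero => rfl
      | succ i =>
        rw [exponents, List.getD_cons_succ, ih i (by omega)]
        congr 2
        omega
  set e : ℕ → ℕ := fun i => if i < k then k - 1 - i else i with he
  have hinj : Function.Injective e := by
    intro i j hij
    simp only [he] at hij
    split_ifs at hij <;> omega
  rw [superCountList, ← superCount_relabel (b := fun _ => b) (d := d) hinj
    (b' := letterKind (exponents b d k))]
  · congr 1
    refine (mapDomain_eq_of_forall hinj (fun i => ?_) fun j hj => ?_).symm
    · rw [letterExponents_apply]
      by_cases h : i < k
      · have : e i = k - 1 - i := if_pos h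
        rw [this, hget k _ (by omega), show k - 1 - (k - 1 - i) = i by omega]
      · have : e i = i := if_neg h
        rw [this, hd i (not_lt.1 h), List.getD_eq_default _ _ (by rw [hlen]; exact not_lt.1 h)]
    · refine absurd ?_ hj
      by_cases h : j < k
      · refine ⟨k - 1 - j, ?_⟩
        have : k - 1 - j < k := by omega
        simp only [he, if_pos this]
        omega
      · exact ⟨j, if_neg h⟩
  · intro i hi
    have h : i < k := by
      by_contra h
      exact hi (hd i (not_lt.1 h))
    have : e i = k - 1 - i := if_pos h
    rw [this, letterKind, hget k _ (by omega)]

theorem exists_exponents {b : Bool} (L : List (Bool × ℕ)) (hL : ∀ x ∈ L, x.1 = b) :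
    ∃ d : ℕ →₀ ℕ, (∀ j, L.length ≤ j → d j = 0) ∧ L = exponents b d L.length := by
  induction L with
  | nil => exact ⟨0, fun _ _ => rfl, rfl⟩
  | cons x L ih =>
    obtain ⟨d, hd, hLd⟩ := ih fun y hy => hL y (List.mem_cons_of_mem x hy)
    refine ⟨d + Finsupp.single L.length x.2, fun j hj => ?_, ?_⟩
    · rw [List.length_cons] at hj
      rw [Finsupp.add_apply, hd j (by omega), Finsupp.single_eq_of_ne (by omega), add_zero]
    · rw [List.length_cons, exponents]
      congr 1
      · rw [Finsupp.add_apply, hd _ le_rfl, Finsupp.single_eq_same, zero_add, ← hL x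
          List.mem_cons_self]
      · conv_lhs => rw [hLd]
        refine exponents_congr b fun j hj => ?_
        rw [Finsupp.add_apply, Finsupp.single_eq_of_ne hj.ne, add_zero]

end Lists

section Monomials

/-- Multisets of blocks from the range of an injective map. -/
theorem card_weight_eq_ncard {ι : Type*} {f : ι → ℕ →₀ ℕ} (hf : Function.Injective f)
    (d : ℕ →₀ ℕ) : Nat.card {a : ι →₀ ℕ // Finsupp.weight f a = d} =
      {c : (ℕ →₀ ℕ) →₀ ℕ | (∀ w, c w ≠ 0 → w ∈ Set.range f) ∧ blockProduct c = d}.ncard := by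
  have hprod : ∀ a : ι →₀ ℕ, blockProduct (a.mapDomain f) = Finsupp.weight f a := by
    intro a
    rw [Finsupp.weight_apply, Finsupp.weight_apply, Finsupp.sum_mapDomain_index_inj hf]
    rfl
  have himage : {c : (ℕ →₀ ℕ) →₀ ℕ | (∀ w, c w ≠ 0 → w ∈ Set.range f) ∧ blockProduct c = d} =
      Finsupp.mapDomain f '' {a : ι →₀ ℕ | Finsupp.weight f a = d} := by
    ext c
    constructor
    · rintro ⟨h1, h2⟩
      have h3 : Finsupp.mapDomain f (c.comapDomain f hf.injOn) = c :=
        Finsupp.mapDomain_comapDomain f hf c fun w hw => h1 w (Finsupp.mem_support_iff.1 hw)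
      refine ⟨_, ?_, h3⟩
      rw [Set.mem_ofPred_eq, ← hprod, h3, h2]
    · rintro ⟨a, ha, rfl⟩
      refine ⟨fun w hw => ?_, by rw [hprod]; exact ha⟩
      by_contra h
      exact hw (Finsupp.mapDomain_of_notMem_range _ _ h)
  rw [himage, Set.ncard_image_of_injective _ (Finsupp.mapDomain_injective hf)]
  rfl

/-- The monomial of a basis vector of the exterior power. -/
noncomputable def letterMonomial {m : ℕ} (S : Letters m) : ℕ →₀ ℕ :=
  Finsupp.indicator S.1 fun _ _ => 1

theorem letterMonomial_apply {m : ℕ} (S : Letters m) (j : ℕ) :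
    letterMonomial S j = if j ∈ S.1 then 1 else 0 := by
  rw [letterMonomial, Finsupp.indicator_apply]
  split_ifs <;> rfl

theorem letterMonomial_injective {m : ℕ} :
    Function.Injective (letterMonomial : Letters m → ℕ →₀ ℕ) := by
  intro S T h
  refine Subtype.ext (Finset.ext fun j => ?_)
  have := DFunLike.congr_fun h j
  rw [letterMonomial_apply, letterMonomial_apply] at this
  split_ifs at this <;> simp_all

theorem range_letterMonomial {m : ℕ} (w : ℕ →₀ ℕ) :
    w ∈ Set.range (letterMonomial : Letters m → ℕ →₀ ℕ) ↔ IsBlock m (fun _ => false) w := by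
  constructor
  · rintro ⟨S, rfl⟩
    refine ⟨?_, fun i _ => ?_⟩
    · have : (letterMonomial S).support ⊆ S.1 := fun j hj => by
        by_contra h
        rw [Finsupp.mem_support_iff, letterMonomial_apply, if_neg h] at hj
        exact hj rfl
      rw [Finsupp.degree_apply, Finset.sum_subset this, Finset.sum_congr rfl fun j hj => by
        rw [letterMonomial_apply, if_pos hj], Finset.sum_const, smul_eq_mul, mul_one, S.2]
      exact fun j _ hj => Finsupp.notMem_support_iff.1 hj
    · rw [letterMonomial_apply]
      split_ifs <;> omega
  · rintro ⟨h1, h2⟩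
    have h3 : ∀ i ∈ w.support, w i = 1 := fun i hi =>
      le_antisymm (h2 i rfl) (Nat.one_le_iff_ne_zero.2 (Finsupp.mem_support_iff.1 hi))
    refine ⟨⟨w.support, ?_⟩, ?_⟩
    · rw [← h1, Finsupp.degree_apply, Finset.sum_congr rfl h3, Finset.sum_const, smul_eq_mul,
        mul_one]
    · ext j
      rw [letterMonomial_apply]
      split_ifs with h
      · exact (h3 j h).symm
      · exact (Finsupp.notMem_support_iff.1 h).symm

theorem oddDegree_false (w : ℕ →₀ ℕ) : oddDegree (fun _ => false) w = w.degree := by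
  rw [oddDegree, Finsupp.weight_apply, Finsupp.degree_apply]
  exact Finset.sum_congr rfl fun i _ => by simp

theorem oddDegree_true (w : ℕ →₀ ℕ) : oddDegree (fun _ => true) w = 0 := by
  rw [oddDegree, Finsupp.weight_apply]
  exact Finset.sum_eq_zero fun i _ => by simp

theorem isSuperMultiset_false {m : ℕ} (hm : Even m) (c : (ℕ →₀ ℕ) →₀ ℕ) :
    IsSuperMultiset m (fun _ => false) c ↔ ∀ w, c w ≠ 0 → IsBlock m (fun _ => false) w := by
  refine forall₂_congr fun w _ => ⟨fun h => h.1, fun h => ⟨h, fun hodd => ?_⟩⟩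
  rw [oddDegree_false, h.1] at hodd
  exact absurd hm (Nat.not_even_iff_odd.2 hodd)

theorem isSuperMultiset_true {m : ℕ} (c : (ℕ →₀ ℕ) →₀ ℕ) :
    IsSuperMultiset m (fun _ => true) c ↔ ∀ w, c w ≠ 0 → w.degree = m := by
  refine forall₂_congr fun w _ => ⟨fun h => h.1.1, fun h => ⟨⟨h, fun i hi => ?_⟩, fun hodd => ?_⟩⟩
  · exact Bool.noConfusion hi
  · rw [oddDegree_true] at hodd
    exact absurd hodd (by decide)

theorem finrank_eq_superCount {m : ℕ} (hm : 0 < m) (hm' : Even m) (d : ℕ →₀ ℕ) :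
    Module.finrank ℚ ((letterModule hm 0).W fun j => (d j : ℤ)) =
      superCount m (fun _ => false) d := by
  have h1 : ∀ a : Letters m →₀ ℕ, Finsupp.weight letterWeight a = (fun j => (d j : ℤ)) ↔
      Finsupp.weight letterMonomial a = d := by
    intro a
    have h2 : ∀ j, Finsupp.weight letterWeight a j =
        ((Finsupp.weight letterMonomial a : ℕ →₀ ℕ) j : ℤ) := by
      intro j
      rw [weight_letterWeight_apply, Finsupp.weight_apply, Finsupp.sum_apply, Finsupp.sum,
        Nat.cast_sum]
      refine Finset.sum_congr rfl fun S _ => ?_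
      rw [Finsupp.smul_apply, letterMonomial_apply, smul_eq_mul]
      split_ifs <;> simp
    rw [funext_iff, Finsupp.ext_iff]
    simp only [h2, Nat.cast_inj]
  change Module.finrank ℚ (weightedHomogeneousSubmodule ℚ letterWeight _) = _
  rw [finrank_weightedHomogeneousSubmodule, superCount]
  simp only [h1, isSuperMultiset_false hm']
  rw [card_weight_eq_ncard letterMonomial_injective]
  simp only [range_letterMonomial]

end Monomials

/-- Conjugation of the multiplicities: for even `m`, the involution `ω` exchanges `h_n ∘ e_m` and
`h_n ∘ h_m`. Both sides satisfy the relations between the `e_i` and the `h_i`, so that they need to be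
compared for odd letters only, where they are the character of the symmetric algebra of the exterior
power. -/
theorem superCount_true_eq_sum {m : ℕ} (hm : 0 < m) (hm' : Even m) {d : ℕ →₀ ℕ} {k : ℕ}
    (hd : ∀ j, k ≤ j → d j = 0) :
    superCount m (fun _ => true) d = ∑ lam ∈ partitionsOf (∑ j ∈ Finset.range k, d j),
      stripCount (exponents true d k) lam * multiplicity m lam.transpose := by
  rw [← superCountList_exponents m true hd]
  set s := ∑ j ∈ Finset.range k, d j with hs
  have key := eq_of_eq_on_odd (s := s) (Φ := fun L => superCountList m L)
    (Ψ := fun L => ∑ lam ∈ partitionsOf s,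
      (stripCount L lam : ℤ) * multiplicity m lam.transpose) ?_ ?_ ?_ ?_ ?_
      (exponents true d k) (sum_exponents true d k)
  · exact_mod_cast key
  · intro pre post b
    rw [superCountList_drop]
  · intro pre post b
    simp only [stripCount_drop]
  · intro pre post K hK
    exact sum_superCountList_eq_zero hm pre post hK
  · intro pre post K hK
    simp only [Finset.mul_sum, ← mul_assoc]
    rw [Finset.sum_comm]
    refine Finset.sum_eq_zero fun lam _ => ?_
    rw [← Finset.sum_mul, sum_stripCount_eq_zero pre post hK, zero_mul]
  · intro L hL hLs
    obtain ⟨d', hd', hLd⟩ := exists_exponents L hL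
    have h1 : s = ∑ j ∈ Finset.range L.length, d' j := by
      rw [← hLs, hLd, sum_exponents]
      rw [← hLd]
    have h2 : L.map (fun x => (!x.1, x.2)) = exponents true d' L.length := by
      rw [← map_not_exponents, ← hLd]
    have h3 := finrank_eq_sum_stripCount hm d' hd'
    rw [finrank_eq_superCount hm hm', ← superCountList_exponents m false hd', ← hLd, ← h1] at h3
    rw [h3, Nat.cast_sum]
    refine Finset.sum_bij' (fun lam _ => lam.transpose) (fun lam _ => lam.transpose) ?_ ?_ ?_ ?_ ?_
    · intro lam hlam
      rwa [mem_partitionsOf, card_transpose, ← mem_partitionsOf]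
    · intro lam hlam
      rwa [mem_partitionsOf, card_transpose, ← mem_partitionsOf]
    · intro lam _
      exact lam.transpose_transpose
    · intro lam _
      exact lam.transpose_transpose
    · intro lam _
      rw [YoungDiagram.transpose_transpose, ← h2]
      conv_lhs => rw [← lam.transpose_transpose, stripCount_transpose,
        YoungDiagram.transpose_transpose]
      push_cast
      rfl

/-! ### Rows and columns -/

section Shapes

theorem rowLen_ofRowLens_getD (w : List ℕ) (hw : w.SortedGE) (i : ℕ) :
    (YoungDiagram.ofRowLens w hw).rowLen i = w.getD i 0 := by
  refine eq_of_forall_lt_iff fun j => ?_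
  rw [← YoungDiagram.mem_iff_lt_rowLen, YoungDiagram.mem_ofRowLens]
  by_cases h : i < w.length
  · rw [List.getD_eq_getElem _ _ h]
    exact ⟨fun h' => h'.2, fun h' => ⟨h, h'⟩⟩
  · rw [List.getD_eq_default _ _ (not_lt.1 h)]
    exact ⟨fun h' => absurd h'.1 h, fun h' => absurd h' (Nat.not_lt_zero j)⟩

theorem rowLen_oneRow (n i : ℕ) : (oneRow n).rowLen i = if i = 0 then n else 0 := by
  rw [oneRow, rowLen_ofRowLens_getD]
  cases i <;> simp

theorem rowLen_oneCol (n i : ℕ) : (oneCol n).rowLen i = if i < n then 1 else 0 := by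
  rw [oneCol, rowLen_ofRowLens_getD]
  split_ifs with h
  · rw [List.getD_eq_getElem _ _ (by simpa using h), List.getElem_replicate]
  · rw [List.getD_eq_default _ _ (by simpa using h)]

theorem transpose_oneRow (n : ℕ) : (oneRow n).transpose = oneCol n := by
  ext ⟨i, j⟩
  rw [YoungDiagram.mem_cells, YoungDiagram.mem_cells, YoungDiagram.mem_transpose,
    YoungDiagram.mem_iff_lt_rowLen, Prod.fst_swap, Prod.snd_swap, YoungDiagram.mem_iff_lt_rowLen,
    rowLen_oneRow, rowLen_oneCol]
  dsimp only
  split_ifs <;> omega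

theorem card_oneRow (n : ℕ) : (oneRow n).card = n := by
  rw [card_eq_sum_rowLen (n := 1) (by rw [rowLen_oneRow]; rfl), Finset.sum_range_one, rowLen_oneRow,
    if_pos rfl]

theorem card_oneCol (n : ℕ) : (oneCol n).card = n := by
  rw [← transpose_oneRow, card_transpose, card_oneRow]

theorem eq_oneRow {lam : YoungDiagram} (h : lam.rowLen 1 = 0) : lam = oneRow lam.card := by
  refine ext_rowLen fun i => ?_
  rw [rowLen_oneRow, card_eq_sum_rowLen h, Finset.sum_range_one]
  split_ifs with hi
  · rw [hi]
  · have := lam.rowLen_anti 1 i (Nat.one_le_iff_ne_zero.2 hi)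
    omega

theorem rowLen_addParts (lam th : YoungDiagram) (i : ℕ) :
    (addParts lam th).rowLen i = lam.rowLen i + th.rowLen i := by
  have h0 : ∀ mu : YoungDiagram, mu.colLen 0 ≤ i → mu.rowLen i = 0 := fun mu h => by
    by_contra h'
    have := YoungDiagram.mem_iff_lt_colLen.1
      (YoungDiagram.mem_iff_lt_rowLen.2 (Nat.pos_of_ne_zero h'))
    omega
  rw [addParts, rowLen_ofRowLens_getD]
  by_cases h : i < max (lam.colLen 0) (th.colLen 0)
  · rw [List.getD_eq_getElem _ _ (by simpa using h), List.getElem_map, List.getElem_range]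
  · rw [List.getD_eq_default _ _ (by simpa using h), h0 lam (by omega), h0 th (by omega)]

theorem card_addParts (lam th : YoungDiagram) : (addParts lam th).card = lam.card + th.card := by
  have h : ∀ mu : YoungDiagram, mu.rowLen (mu.colLen 0) = 0 := fun mu => by
    by_contra h'
    have := YoungDiagram.mem_iff_lt_colLen.1
      (YoungDiagram.mem_iff_lt_rowLen.2 (Nat.pos_of_ne_zero h'))
    omega
  have h1 := lam.rowLen_anti _ _ (le_max_left (lam.colLen 0) (th.colLen 0))
  have h2 := th.rowLen_anti _ _ (le_max_right (lam.colLen 0) (th.colLen 0))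
  rw [h] at h1 h2
  rw [card_eq_sum_rowLen (n := max (lam.colLen 0) (th.colLen 0))
    (by rw [rowLen_addParts]; omega), card_eq_sum_rowLen (Nat.eq_zero_of_le_zero h1),
    card_eq_sum_rowLen (Nat.eq_zero_of_le_zero h2), ← Finset.sum_add_distrib]
  exact Finset.sum_congr rfl fun i _ => rowLen_addParts lam th i

theorem rowLen_consPart_zero {k : ℕ} {lam : YoungDiagram} (h : lam.rowLen 0 ≤ k) :
    (consPart k lam h).rowLen 0 = k := by
  rw [consPart, rowLen_ofRowLens_getD, List.getD_cons_zero]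

theorem rowLen_consPart_succ {k : ℕ} {lam : YoungDiagram} (h : lam.rowLen 0 ≤ k) (i : ℕ) :
    (consPart k lam h).rowLen (i + 1) = lam.rowLen i := by
  rw [consPart, rowLen_ofRowLens_getD, List.getD_cons_succ, ← rowLen_ofRowLens_getD _
    lam.rowLens_sorted, YoungDiagram.ofRowLens_to_rowLens_eq_self]

/-- The two versions of the inequality are conjugate. -/
theorem transpose_consPart {k : ℕ} {lam : YoungDiagram} (h : lam.rowLen 0 ≤ k) :
    (consPart k lam h).transpose = addParts lam.transpose (oneCol k) := by
  ext ⟨i, j⟩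
  rw [YoungDiagram.mem_cells, YoungDiagram.mem_cells, YoungDiagram.mem_transpose, Prod.swap_prod_mk,
    YoungDiagram.mem_iff_lt_rowLen, YoungDiagram.mem_iff_lt_rowLen, rowLen_addParts, rowLen_oneCol]
  have h1 : ∀ r, r < lam.transpose.rowLen i ↔ i < lam.rowLen r := fun r => by
    rw [← YoungDiagram.mem_iff_lt_rowLen, YoungDiagram.mem_transpose, Prod.swap_prod_mk,
      YoungDiagram.mem_iff_lt_rowLen]
  cases j with
  | zero =>
    have h2 := h1 0
    rw [rowLen_consPart_zero]
    split_ifs with h3 <;> omega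
  | succ j =>
    rw [rowLen_consPart_succ, ← h1]
    have h2 := h1 j
    have h3 := lam.rowLen_anti 0 j (Nat.zero_le j)
    split_ifs with h4 <;> omega

theorem mem_strips_oneRow {b : Bool} {n c : ℕ} {mu : YoungDiagram} :
    mu ∈ strips b (oneRow n) c ↔ (c ≤ n ∧ (b = false → c ≤ 1)) ∧ mu = oneRow (n - c) := by
  have hmem : ∀ n i j, (i, j) ∈ oneRow n ↔ i = 0 ∧ j < n := by
    intro n i j
    rw [YoungDiagram.mem_iff_lt_rowLen, rowLen_oneRow]
    split_ifs <;> omega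
  rw [mem_strips, card_oneRow]
  constructor
  · rintro ⟨h1, h2⟩
    have h3 : mu = oneRow mu.card := by
      refine eq_oneRow ?_
      by_contra h
      have := (hmem n 1 0).1 (h1.le (YoungDiagram.mem_iff_lt_rowLen.2 (Nat.pos_of_ne_zero h)))
      exact absurd this.1 one_ne_zero
    refine ⟨⟨by omega, fun hb => ?_⟩, by rw [h2, Nat.add_sub_cancel]; exact h3⟩
    subst hb
    by_contra! hc
    have h4 := h1.2 0 mu.card ((hmem n 0 _).2 ⟨rfl, by omega⟩)
    rw [h3, hmem, card_oneRow] at h4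
    exact lt_irrefl _ h4.2
  · rintro ⟨⟨h1, h2⟩, rfl⟩
    refine ⟨?_, by rw [card_oneRow]; omega⟩
    have hle : oneRow (n - c) ≤ oneRow n := by
      rintro ⟨i, j⟩ hij
      have hij' := (hmem _ i j).1 hij
      exact (hmem n i j).2 ⟨hij'.1, by omega⟩
    cases b
    · refine ⟨hle, fun i j hij => ?_⟩
      rw [hmem] at hij ⊢
      have := h2 rfl
      omega
    · refine ⟨hle, fun i j hij => ?_⟩
      rw [hmem] at hij
      omega

open Classical in
theorem stripCount_oneRow (b : Bool) (d : ℕ → ℕ) (k n : ℕ) :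
    stripCount (exponents b d k) (oneRow n) =
      if ∑ j ∈ Finset.range k, d j = n ∧ (b = false → ∀ j < k, d j ≤ 1) then 1 else 0 := by
  induction k generalizing n with
  | zero =>
    rw [exponents, stripCount]
    refine if_congr ⟨fun h => ⟨?_, fun _ j hj => absurd hj (Nat.not_lt_zero j)⟩, fun h => ?_⟩ rfl rfl
    · rw [Finset.sum_range_zero, ← card_oneRow n, h]
      rfl
    · rw [← h.1, Finset.sum_range_zero]
      exact YoungDiagram.ext (Finset.card_eq_zero.1 (card_oneRow 0))
  | succ k ih =>
    rw [exponents, stripCount_cons]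
    by_cases h : d k ≤ n ∧ (b = false → d k ≤ 1)
    · have : strips b (oneRow n) (d k) = {oneRow (n - d k)} := by
        ext mu
        rw [mem_strips_oneRow, Finset.mem_singleton, and_iff_right h]
      rw [this, Finset.sum_singleton, ih, Finset.sum_range_succ]
      refine if_congr ⟨fun h' => ⟨by omega, fun hb j hj => ?_⟩, fun h' => ⟨by omega, fun hb j hj =>
        h'.2 hb j (hj.trans k.lt_succ_self)⟩⟩ rfl rfl
      rcases Nat.lt_succ_iff_lt_or_eq.1 hj with hj | rfl
      · exact h'.2 hb j hj
      · exact h.2 hb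
    · have : strips b (oneRow n) (d k) = ∅ := by
        refine Finset.eq_empty_of_forall_notMem fun mu hmu => h (mem_strips_oneRow.1 hmu).1
      rw [this, Finset.sum_empty, if_neg]
      rintro ⟨h1, h2⟩
      rw [Finset.sum_range_succ] at h1
      exact h ⟨by omega, fun hb => h2 hb k k.lt_succ_self⟩

theorem exists_bound (d : ℕ →₀ ℕ) : ∃ k, ∀ j, k ≤ j → d j = 0 := by
  refine ⟨d.support.sup id + 1, fun j hj => ?_⟩
  by_contra h
  have := Finset.le_sup (f := id) (Finsupp.mem_support_iff.2 h)
  rw [id] at this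
  omega

theorem sum_range_eq_degree {d : ℕ →₀ ℕ} {k : ℕ} (hd : ∀ j, k ≤ j → d j = 0) :
    ∑ j ∈ Finset.range k, d j = d.degree := by
  rw [Finsupp.degree_apply]
  refine (Finset.sum_subset (fun j hj => ?_) fun j _ hj => Finsupp.notMem_support_iff.1 hj).symm
  rw [Finset.mem_range]
  by_contra h
  exact Finsupp.mem_support_iff.1 hj (hd j (not_lt.1 h))

open Classical in
/-- The coefficients of a complete symmetric function. -/
theorem coeff_schur_oneRow (n : ℕ) (d : ℕ →₀ ℕ) :
    MvPowerSeries.coeff d (schur (oneRow n)) = if d.degree = n then 1 else 0 := by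
  obtain ⟨k, hk⟩ := exists_bound d
  rw [coeff_schur _ d hk, stripCount_oneRow, sum_range_eq_degree hk]
  exact if_congr (and_iff_left fun h => Bool.noConfusion h) rfl rfl

open Classical in
/-- The coefficients of an elementary symmetric function. -/
theorem coeff_schur_oneCol (m : ℕ) (d : ℕ →₀ ℕ) :
    MvPowerSeries.coeff d (schur (oneCol m)) = if IsBlock m (fun _ => false) d then 1 else 0 := by
  obtain ⟨k, hk⟩ := exists_bound d
  rw [coeff_schur _ d hk, ← map_not_exponents, ← transpose_oneRow, stripCount_transpose, stripCount_oneRow,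
    sum_range_eq_degree hk]
  refine if_congr (and_congr Iff.rfl ⟨fun h i _ => ?_, fun h _ j _ => h j rfl⟩) rfl rfl
  by_cases hi : i < k
  · exact h rfl i hi
  · rw [hk i (not_lt.1 hi)]
    exact Nat.zero_le _

end Shapes

/-! ### Plethysms with a complete symmetric function -/

section Plethysm

/-- If `g` is a sum of distinct monomials of degree `m`, then `h_n ∘ g` is the sum over the multisets of
`n` of them; the number of elements of a multiset is determined by the degree of its product. -/
theorem coeff_plethysm_oneRow {m n : ℕ} (hm : 0 < m) {g : MvPowerSeries ℕ ℕ}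
    {P : (ℕ →₀ ℕ) → Prop} [DecidablePred P]
    (hg : ∀ α, MvPowerSeries.coeff α g = if P α then 1 else 0)
    (hP : ∀ α, P α → α.degree = m) (d : ℕ →₀ ℕ) :
    MvPowerSeries.coeff d (plethysm (schur (oneRow n)) g) = if d.degree = m * n then
      {c : (ℕ →₀ ℕ) →₀ ℕ | (∀ w, c w ≠ 0 → P w) ∧ blockProduct c = d}.ncard else 0 := by
  let f : MonomialIndex g → ℕ →₀ ℕ := fun y => y.1
  have hle : ∀ α, MvPowerSeries.coeff α g ≤ 1 := fun α => by
    rw [hg]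
    split_ifs <;> omega
  have hPf : ∀ y, P (f y) := by
    rintro ⟨α, i⟩
    by_contra h
    have h0 : MvPowerSeries.coeff α g = 0 := by rw [hg, if_neg h]
    have h1 := i.2
    omega
  have hf : Function.Injective f := by
    rintro ⟨α, i⟩ ⟨β, j⟩ (rfl : α = β)
    have h1 := i.2
    have h2 := j.2
    have h3 := hle α
    have : i = j := Fin.ext (by omega)
    rw [this]
  have hrange : ∀ w, w ∈ Set.range f ↔ P w := by
    intro w
    constructor
    · rintro ⟨y, rfl⟩
      exact hPf y
    · intro h
      exact ⟨⟨w, ⟨0, by rw [hg, if_pos h]; exact one_pos⟩⟩, rfl⟩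
  have hdeg : ∀ k : MonomialIndex g →₀ ℕ, (Finsupp.weight f k).degree = m * k.degree := by
    intro k
    rw [Finsupp.weight_apply, Finsupp.sum, map_sum, Finsupp.degree_apply, Finset.mul_sum]
    refine Finset.sum_congr rfl fun y _ => ?_
    rw [map_nsmul, hP _ (hPf y), smul_eq_mul, mul_comm]
  have h1 : MvPowerSeries.coeff d (plethysm (schur (oneRow n)) g) =
      {k : MonomialIndex g →₀ ℕ | Finsupp.weight f k = d ∧ k.degree = n}.ncard := by
    rw [← finsum_one]
    change (∑ᶠ (k : MonomialIndex g →₀ ℕ) (_ : (k.sum fun y e => e • y.1) = d),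
      MvPowerSeries.coeff (k.mapDomain (enumIndex g)) (schur (oneRow n))) = _
    refine finsum_congr fun k => ?_
    rw [coeff_schur_oneRow, Finsupp.degree_mapDomain]
    by_cases h : k.degree = n
    · rw [if_pos h]
      exact finsum_congr_Prop (propext (and_iff_left h).symm) fun _ => rfl
    · have h' : ¬ (Finsupp.weight f k = d ∧ k.degree = n) := fun h' => h h'.2
      rw [if_neg h, finsum_zero]
      rw [finsum_congr_Prop (propext (iff_false_intro h')) fun _ => rfl, finsum_false]
  rw [h1]
  split_ifs with hd
  · have h2 : {k : MonomialIndex g →₀ ℕ | Finsupp.weight f k = d ∧ k.degree = n} =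
        {k : MonomialIndex g →₀ ℕ | Finsupp.weight f k = d} := by
      ext k
      refine and_iff_left_of_imp fun h => ?_
      have := hdeg k
      rw [show Finsupp.weight f k = d from h, hd] at this
      exact (Nat.eq_of_mul_eq_mul_left hm this).symm
    rw [h2]
    have := card_weight_eq_ncard hf d
    simp only [hrange] at this
    exact this
  · have h2 : {k : MonomialIndex g →₀ ℕ | Finsupp.weight f k = d ∧ k.degree = n} = ∅ := by
      refine Set.eq_empty_of_forall_notMem ?_
      rintro k ⟨h, rfl⟩
      exact hd (by rw [← h, hdeg])
    rw [h2, Set.ncard_empty]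

theorem coeff_plethysm_oneRow_oneRow {m : ℕ} (hm : 0 < m) (n : ℕ) (d : ℕ →₀ ℕ) :
    MvPowerSeries.coeff d (plethysm (schur (oneRow n)) (schur (oneRow m))) =
      if d.degree = m * n then superCount m (fun _ => true) d else 0 := by
  rw [coeff_plethysm_oneRow hm (coeff_schur_oneRow m) fun _ h => h, superCount]
  simp only [isSuperMultiset_true]

open Classical in
theorem coeff_plethysm_oneRow_oneCol {m : ℕ} (hm : 0 < m) (hm' : Even m) (n : ℕ) (d : ℕ →₀ ℕ) :
    MvPowerSeries.coeff d (plethysm (schur (oneRow n)) (schur (oneCol m))) =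
      if d.degree = m * n then superCount m (fun _ => false) d else 0 := by
  rw [coeff_plethysm_oneRow hm (coeff_schur_oneCol m) fun _ h => h.1, superCount]
  simp only [isSuperMultiset_false hm']

/-- Plethysm coefficients are read off from the monomial coefficients, written as a combination of those
of Schur functions. -/
theorem plethysmCoeff_of_coeff {nu mu : YoungDiagram} {s : ℕ} {h : YoungDiagram → ℕ}
    (hF : ∀ (d : ℕ →₀ ℕ) (k : ℕ), (∀ j, k ≤ j → d j = 0) →
      MvPowerSeries.coeff d (plethysm (schur nu) (schur mu)) = if d.degree = s then
        ∑ lam ∈ partitionsOf s, stripCount (exponents true d k) lam * h lam else 0)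
    {lam : YoungDiagram} (hlam : lam.card = s) : plethysmCoeff lam nu mu = h lam := by
  have hexp : IsSchurExpansion (plethysm (schur nu) (schur mu))
      (Finsupp.indicator (partitionsOf s) fun lam _ => (h lam : ℤ)) := by
    rw [IsSchurExpansion, Finsupp.sum_of_support_subset _ (Finsupp.support_indicator_subset _ _)
      (fun lam z => z • MvPowerSeries.map (Nat.castRingHom ℤ) (schur lam))
      fun _ _ => zero_smul ℤ _]
    ext d
    obtain ⟨k, hk⟩ := exists_bound d
    rw [MvPowerSeries.coeff_map, hF d k hk, map_sum]
    have h1 : ∀ lam ∈ partitionsOf s, MvPowerSeries.coeff d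
        ((Finsupp.indicator (partitionsOf s) fun lam _ => (h lam : ℤ)) lam •
          MvPowerSeries.map (Nat.castRingHom ℤ) (schur lam)) =
        ((stripCount (exponents true d k) lam * h lam : ℕ) : ℤ) := by
      intro lam hlam
      rw [Finsupp.indicator_of_mem hlam, map_zsmul, MvPowerSeries.coeff_map, coeff_schur lam d hk,
        smul_eq_mul, Nat.cast_mul, mul_comm]
      rfl
    rw [Finset.sum_congr rfl h1, ← Nat.cast_sum]
    split_ifs with hd
    · rfl
    · rw [Finset.sum_eq_zero, map_zero, Nat.cast_zero]
      intro lam hlam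
      by_contra hne
      have h2 := card_eq_of_stripCount_ne_zero (left_ne_zero_of_mul hne)
      rw [sum_exponents, sum_range_eq_degree hk, mem_partitionsOf.1 hlam] at h2
      exact hd h2.symm
  rw [plethysmCoeff_eq hexp, Finsupp.indicator_of_mem (mem_partitionsOf.2 hlam)]

/-- `h_n ∘ e_m` is the character of the degree-`n` part of the symmetric algebra of the `m`-th exterior
power. -/
theorem plethysmCoeff_oneRow_oneCol {m n : ℕ} (hm : 0 < m) (hm' : Even m) {lam : YoungDiagram}
    (hlam : lam.card = m * n) : plethysmCoeff lam (oneRow n) (oneCol m) = multiplicity m lam := by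
  refine plethysmCoeff_of_coeff (s := m * n) (fun d k hk => ?_) hlam
  rw [coeff_plethysm_oneRow_oneCol hm hm', ← finrank_eq_superCount hm hm',
    finrank_eq_sum_stripCount hm d hk, sum_range_eq_degree hk]
  split_ifs with h
  · rw [h]
  · rfl

theorem plethysmCoeff_oneRow_oneRow {m n : ℕ} (hm : 0 < m) (hm' : Even m) {lam : YoungDiagram}
    (hlam : lam.card = m * n) :
    plethysmCoeff lam (oneRow n) (oneRow m) = multiplicity m lam.transpose := by
  refine plethysmCoeff_of_coeff (s := m * n) (h := fun lam => multiplicity m lam.transpose)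
    (fun d k hk => ?_) hlam
  rw [coeff_plethysm_oneRow_oneRow hm, superCount_true_eq_sum hm hm' hk, sum_range_eq_degree hk]
  split_ifs with h
  · rw [h]
  · rfl

end Plethysm

/-! ### Multiplication by a highest weight vector -/

section Monotonicity

variable {m : ℕ}

theorem mul_mem_highestSpace {lam th : YoungDiagram} {f g : MvPolynomial (Letters m) ℚ}
    (hf : f ∈ highestSpace m lam) (hg : g ∈ highestSpace m th) :
    f * g ∈ highestSpace m (addParts lam th) := by
  rw [mem_highestSpace] at hf hg ⊢
  constructor
  · have := hf.1.mul hg.1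
    convert this using 1
    funext j
    rw [rowLen_addParts, Nat.cast_add]
    rfl
  · intro i
    rw [Derivation.leibniz, hf.2, hg.2, smul_zero, smul_zero, add_zero]

/-- Multiplication by a highest weight vector of weight `th` is injective, as polynomials form a domain,
and maps highest weight vectors to highest weight vectors, as the raising operators are derivations. -/
theorem multiplicity_le_addParts (hm : 0 < m) {th : YoungDiagram} (hth : multiplicity m th ≠ 0)
    (lam : YoungDiagram) : multiplicity m lam ≤ multiplicity m (addParts lam th) := by
  have : FiniteDimensional ℚ (highestSpace m th) := finiteDimensional_highestSpace hm th
  have : FiniteDimensional ℚ (highestSpace m (addParts lam th)) :=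
    finiteDimensional_highestSpace hm _
  obtain ⟨g, hg0⟩ : ∃ g : highestSpace m th, g ≠ 0 := by
    have := Module.finrank_pos_iff.1 (Nat.pos_of_ne_zero hth)
    exact exists_ne 0
  have hg0' : (g : MvPolynomial (Letters m) ℚ) ≠ 0 := fun h => hg0 (Subtype.ext h)
  let φ : highestSpace m lam →ₗ[ℚ] highestSpace m (addParts lam th) :=
    ((LinearMap.mulRight ℚ (g : MvPolynomial (Letters m) ℚ)).domRestrict _).codRestrict _
      fun f => mul_mem_highestSpace f.2 g.2
  refine LinearMap.finrank_le_finrank_of_injective (f := φ) ?_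
  rw [injective_iff_map_eq_zero]
  intro f hf
  have h : (f : MvPolynomial (Letters m) ℚ) * g = 0 := congrArg Subtype.val hf
  exact Subtype.ext ((mul_eq_zero.1 h).resolve_right hg0')

/-- There is a highest weight vector of weight `(1 ^ (a m))`: the conjugate statement is that
`x_0 ^ (a m)` occurs in `h_a ∘ h_m`. -/
theorem multiplicity_oneCol_ne_zero (hm : 0 < m) (hm' : Even m) (a : ℕ) :
    multiplicity m (oneCol (a * m)) ≠ 0 := by
  have h1 : superCount m (fun _ => true) (Finsupp.single 0 (a * m)) ≠ 0 := by
    have hmem : Finsupp.single (Finsupp.single 0 m) a ∈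
        {c | IsSuperMultiset m (fun _ => true) c ∧
          blockProduct c = Finsupp.single 0 (a * m)} := by
      refine ⟨(isSuperMultiset_true _).2 fun w hw => ?_, ?_⟩
      · have : w = Finsupp.single 0 m := by
          by_contra h
          exact hw (Finsupp.single_eq_of_ne h)
        rw [this, Finsupp.degree_single]
      · rw [Finsupp.weight_single, id, Finsupp.smul_single, smul_eq_mul]
    exact ((Set.ncard_pos (finite_superMultisets hm _ _)).2 ⟨_, hmem⟩).ne'
  rw [superCount_true_eq_sum hm hm' (k := 1) fun j hj =>
    Finsupp.single_eq_of_ne (Nat.one_le_iff_ne_zero.1 hj)] at h1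
  obtain ⟨lam, hlam, hne⟩ := Finset.exists_ne_zero_of_sum_ne_zero h1
  rw [mem_partitionsOf, Finset.sum_range_one, Finsupp.single_eq_same] at hlam
  have h2 := eq_oneRow (rowLen_eq_zero_of_stripCount_ne_zero (left_ne_zero_of_mul hne))
  rw [hlam] at h2
  rw [h2, transpose_oneRow] at hne
  exact right_ne_zero_of_mul hne

end Monotonicity

end Pleth

theorem theorem2 (m n a : ℕ) (hm : Even m) (ha : 2 ≤ a) (lam : YoungDiagram)
    (hlam : lam.card = m * n) :
    (lam.colLen 0 < 2 * m →
      Pleth.plethysmCoeff lam (Pleth.oneRow n) (Pleth.oneCol m) ≤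
        Pleth.plethysmCoeff (Pleth.addParts lam (Pleth.oneCol (a * m)))
          (Pleth.oneRow (n + a)) (Pleth.oneCol m)) ∧
    (∀ h : lam.rowLen 0 < 2 * m,
      Pleth.plethysmCoeff lam (Pleth.oneRow n) (Pleth.oneRow m) ≤
        Pleth.plethysmCoeff
          (Pleth.consPart (a * m) lam (Pleth.le_mul_of_lt_two_mul ha h))
          (Pleth.oneRow (n + a)) (Pleth.oneRow m)) := by
  have hcard : ∀ mu : YoungDiagram, mu.card = m * n →
      (Pleth.addParts mu (Pleth.oneCol (a * m))).card = m * (n + a) := fun mu hmu => by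
    rw [Pleth.card_addParts, Pleth.card_oneCol, hmu, mul_add, mul_comm a]
  constructor
  · intro h
    have hm0 : 0 < m := by omega
    rw [Pleth.plethysmCoeff_oneRow_oneCol hm0 hm hlam,
      Pleth.plethysmCoeff_oneRow_oneCol hm0 hm (hcard lam hlam), Nat.cast_le]
    exact Pleth.multiplicity_le_addParts hm0 (Pleth.multiplicity_oneCol_ne_zero hm0 hm a) lam
  · intro h
    have hm0 : 0 < m := by omega
    have hlam' : lam.transpose.card = m * n := by rw [Pleth.card_transpose, hlam]
    have hcons := Pleth.transpose_consPart (Pleth.le_mul_of_lt_two_mul ha h)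
    rw [Pleth.plethysmCoeff_oneRow_oneRow hm0 hm hlam, Pleth.plethysmCoeff_oneRow_oneRow hm0 hm
      (by rw [← Pleth.card_transpose, hcons]; exact hcard _ hlam'), hcons, Nat.cast_le]
    exact Pleth.multiplicity_le_addParts hm0 (Pleth.multiplicity_oneCol_ne_zero hm0 hm a) _
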